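/- All matroids are finite. For a loopless matroid $M$ with ground set $E$ and rank function $\operatorname{rk}$, let $\chi_M(t)=\sum_{A\subseteq E}(-1)^{|A|}t^{\operatorname{rk}E-\operatorname{rk}A}$ be its characteristic polynomial. The Kazhdan–Lusztig polynomial $P_M(t)\in\mathbb Z[t]$ is determined by: $P_M=1$ if $\operatorname{rk}M=0$; and, if $\operatorname{rk}M>0$, $\deg P_M<\tfrac12\operatorname{rk}M$ and $t^{\operatorname{rk}M}P_M(t^{-1})=\sum_F\chi_{M|F}(t)\,P_{M/F}(t)$, the sum being over all flats $F$ of $M$. The inverse Kazhdan–Lusztig polynomial $Q_M(t)\in\mathbb Z[t]$ is determined by: $Q_M=1$ if $\operatorname{rk}M=0$; and $\sum_F(-1)^{\operatorname{rk}F}P_{M|F}(t)\,Q_{M/F}(t)=0$ if $\operatorname{rk}M>0$. Let $a,b\ge 1$ and $n\ge 0$ be integers. Let $C_n^{a,b}$ be the $(a,b)$-Catalan matroid, that is, the Schubert matroid on $\{1,\dots,n(a+b)\}$ whose bases are the sets $T$ with $|T|=|S|$ whose $i$-th smallest element is at most that of $S$ for all $i$, where $S$ is the set with indicator vector $(0^a,1^b,0^a,1^b,\dots,0^a,1^b)$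 ($n$ blocks $0^a,1^b$). Let $U_{k,N}$ be the uniform matroid of rank $k$ on $N$ elements, $U_m^{a,b}=U_{mb,\,m(a+b)}$, and for a partition $\lambda=(\lambda_1,\dots,\lambda_\ell)$ of $n$ put $$Q_{U_\lambda^{a,b}}(t)=\prod_{i=1}^{\ell}Q_{U_{\lambda_i}^{a,b}}(t),\qquad z_\lambda=\prod_{i=1}^n i^{\alpha_i}\,\alpha_i!,$$ where $\alpha_i$ is the number of parts of $\lambda$ equal to $i$. Then $$Q_{C_n^{a,b}}(t)=\sum_{\lambda\vdash n}\frac1{z_\lambda}\,Q_{U_\lambda^{a,b}}(t).$$ Explicitly, $$Q_{C_n^{a,b}}(t)=\sum_{\lambda\vdash n}\frac1{z_\lambda}\prod_{i=1}^{\ell(\lambda)}q_{\lambda_ib,\;\lambda_i(a+b)}(t),$$ where $\ell(\lambda)$ is the number of parts of $\lambda$ and, for $1\le k<N$, $$q_{k,N}(t)=\binom Nk\sum_{j=0}^{\lfloor (k-1)/2\rfloor}\frac{(N-k)(k-2j)}{(N-k+j)(N-j)}\binom kj\,t^j .$$ -/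

import Mathlib

open Polynomial

noncomputable section

namespace CatalanMatroid

/-! ### Uniform matroids, Schubert matroids and `(a,b)`-Catalan matroids -/

/-- The uniform matroid `U_{k,N}`, with ground set all of `Fin N`: a set is independent iff it has at
most `k` elements. For `k ≤ N` its bases are the `k`-element subsets, see `uniform_isBase_iff`. -/
def uniform (k N : ℕ) : Matroid (Fin N) :=
  (IndepMatroid.ofFinset Set.univ (fun I : Finset (Fin N) ↦ I.card ≤ k)
    (by simp)
    (fun _ _ hJ hIJ ↦ (Finset.card_le_card hIJ).trans hJ)
    (fun I J _ hJ hlt ↦ by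
      obtain ⟨e, heJ, heI⟩ := Finset.exists_mem_notMem_of_card_lt_card hlt
      exact ⟨e, heJ, heI, by rw [Finset.card_insert_of_notMem heI]; omega⟩)
    (fun _ _ ↦ Set.subset_univ _)).matroid

theorem uniform_indep_iff (k N : ℕ) (I : Finset (Fin N)) :
    (uniform k N).Indep (I : Set (Fin N)) ↔ I.card ≤ k := by
  rw [uniform, IndepMatroid.matroid_Indep]
  exact IndepMatroid.ofFinset_indep ..

theorem uniform_isBase_iff {k N : ℕ} (hk : k ≤ N) (B : Finset (Fin N)) :
    (uniform k N).IsBase (B : Set (Fin N)) ↔ B.card = k := by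
  rw [Matroid.isBase_iff_maximal_indep]
  constructor
  · intro h
    have hB := (uniform_indep_iff k N B).1 h.prop
    by_contra hne
    obtain ⟨C, hBC, hC⟩ := Finset.exists_superset_card_eq (s := B) (n := k) hB (by simpa using hk)
    have hCi : (uniform k N).Indep (C : Set (Fin N)) := (uniform_indep_iff k N C).2 hC.le
    have := h.eq_of_subset hCi (by simpa using hBC)
    rw [Finset.coe_inj.1 this] at hne
    exact hne hC
  · intro h
    refine ⟨(uniform_indep_iff k N B).2 h.le, fun C hC hBC ↦ ?_⟩
    obtain ⟨C, rfl⟩ : ∃ C' : Finset (Fin N), (C' : Set (Fin N)) = C :=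
      ⟨(Set.toFinite C).toFinset, by simp⟩
    have hC' := (uniform_indep_iff k N C).1 hC
    have : B = C := Finset.eq_of_subset_of_card_le (by simpa using hBC) (by omega)
    simp [this]

/-- The number of elements of `T` that are at least `j`. -/
def tailCard {N : ℕ} (T : Finset (Fin N)) (j : Fin N) : ℕ := (T.filter (fun i ↦ j ≤ i)).card

/-- The Schubert matroid `SM_N(S)`, with ground set all of `Fin N`. A set is independent iff every
final segment of `Fin N` contains at most as many elements of it as of `S`; equivalently, the
bases are the sets that are componentwise at most `S`, see `schubert_isBase_iff`. -/
def schubert {N : ℕ} (S : Finset (Fin N)) : Matroid (Fin N) :=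
  (IndepMatroid.ofFinset Set.univ (fun I : Finset (Fin N) ↦ ∀ j, tailCard I j ≤ tailCard S j)
    (by simp [tailCard])
    (fun _ _ hJ hIJ j ↦
      (Finset.card_le_card (Finset.filter_subset_filter _ hIJ)).trans (hJ j))
    (fun I J hI hJ hlt ↦ by
      classical
      have key : ∃ e ∈ J, e ∉ I ∧ ∀ j ≤ e, tailCard I j < tailCard S j := by
        by_cases ht : ∃ j, tailCard I j = tailCard S j
        · obtain ⟨j, hj, hmin⟩ := WellFounded.has_min
            (wellFounded_lt (α := Fin N)) {j | tailCard I j = tailCard S j} ht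
          have h1 : tailCard J j ≤ tailCard I j := (hJ j).trans (le_of_eq (Eq.symm hj))
          have hI2 := Finset.card_filter_add_card_filter_not (s := I) (fun i ↦ j ≤ i)
          have hJ2 := Finset.card_filter_add_card_filter_not (s := J) (fun i ↦ j ≤ i)
          unfold tailCard at h1
          have h2 : (I.filter (fun i ↦ ¬ j ≤ i)).card < (J.filter (fun i ↦ ¬ j ≤ i)).card := by
            omega
          obtain ⟨e, he, he'⟩ := Finset.exists_mem_notMem_of_card_lt_card h2
          simp only [Finset.mem_filter] at he he'
          refine ⟨e, he.1, fun h ↦ he' ⟨h, he.2⟩, fun i hi ↦ lt_of_le_of_ne (hI i) fun hne ↦ ?_⟩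
          exact hmin i hne (lt_of_le_of_lt hi (not_le.1 he.2))
        · push Not at ht
          obtain ⟨e, heJ, heI⟩ := Finset.exists_mem_notMem_of_card_lt_card hlt
          exact ⟨e, heJ, heI, fun i _ ↦ lt_of_le_of_ne (hI i) (ht i)⟩
      obtain ⟨e, heJ, heI, he⟩ := key
      refine ⟨e, heJ, heI, fun j ↦ ?_⟩
      unfold tailCard at *
      rw [Finset.filter_insert]
      split_ifs with hje
      · exact (Finset.card_insert_le _ _).trans (he j hje)
      · exact hI j)
    (fun _ _ ↦ Set.subset_univ _)).matroid

theorem schubert_indep_iff {N : ℕ} (S I : Finset (Fin N)) :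
    (schubert S).Indep (I : Set (Fin N)) ↔ ∀ j, tailCard I j ≤ tailCard S j := by
  rw [schubert, IndepMatroid.matroid_Indep]
  exact IndepMatroid.ofFinset_indep ..

/-- `T ≤ S`: the two sets have the same size, and the `i`-th smallest element of `T` is at most the
`i`-th smallest element of `S` for every `i`. -/
def ComponentwiseLE {N : ℕ} (T S : Finset (Fin N)) : Prop :=
  ∃ h : T.card = S.card, ∀ i : Fin S.card, T.orderEmbOfFin h i ≤ S.orderEmbOfFin rfl i

theorem tailCard_eq {N k : ℕ} (T : Finset (Fin N)) (h : T.card = k) (j : Fin N) :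
    tailCard T j = (Finset.univ.filter (fun i : Fin k ↦ j ≤ T.orderEmbOfFin h i)).card := by
  unfold tailCard
  conv_lhs => rw [← Finset.map_orderEmbOfFin_univ T h]
  rw [Finset.filter_map, Finset.card_map]
  rfl

theorem componentwiseLE_iff {N : ℕ} (T S : Finset (Fin N)) :
    ComponentwiseLE T S ↔ T.card = S.card ∧ ∀ j, tailCard T j ≤ tailCard S j := by
  constructor
  · rintro ⟨h, hle⟩
    refine ⟨h, fun j ↦ ?_⟩
    rw [tailCard_eq T h, tailCard_eq S rfl]
    exact Finset.card_le_card fun i hi ↦ by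
      simp only [Finset.mem_filter, Finset.mem_univ, true_and] at hi ⊢
      exact hi.trans (hle i)
  · rintro ⟨h, hle⟩
    refine ⟨h, fun i ↦ ?_⟩
    by_contra! hlt
    have h1 := hle (T.orderEmbOfFin h i)
    rw [tailCard_eq T h, tailCard_eq S rfl] at h1
    refine absurd h1 (not_le.2 (Finset.card_lt_card ?_))
    rw [Finset.ssubset_iff_of_subset]
    · refine ⟨i, by simp, by simpa using hlt⟩
    · intro m hm
      simp only [Finset.mem_filter, Finset.mem_univ, true_and, OrderEmbedding.le_iff_le] at hm ⊢
      have h2 := hlt.trans_le hm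
      rw [OrderEmbedding.lt_iff_lt] at h2
      exact h2.le

theorem schubert_isBase_iff {N : ℕ} (S T : Finset (Fin N)) :
    (schubert S).IsBase (T : Set (Fin N)) ↔ ComponentwiseLE T S := by
  rw [componentwiseLE_iff, ← schubert_indep_iff]
  have hcard : ∀ I : Finset (Fin N), (schubert S).Indep (I : Set (Fin N)) → I.card ≤ S.card := by
    intro I hI
    rcases I.eq_empty_or_nonempty with rfl | ⟨e, he⟩
    · simp
    · have h0 : 0 < N := e.pos
      have := (schubert_indep_iff S I).1 hI ⟨0, h0⟩
      simpa [tailCard, Fin.le_def] using this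
  have hS : (schubert S).Indep (S : Set (Fin N)) := (schubert_indep_iff S S).2 fun _ ↦ le_rfl
  obtain ⟨B, hB, hSB⟩ := hS.exists_isBase_superset
  have hBS : B.encard = S.card := by
    obtain ⟨B, rfl⟩ : ∃ C' : Finset (Fin N), (C' : Set (Fin N)) = B :=
      ⟨(Set.toFinite B).toFinset, by simp⟩
    have h1 := hcard B hB.indep
    have h2 := Finset.card_le_card (Finset.coe_subset.1 hSB)
    rw [Set.encard_coe_eq_coe_finsetCard, le_antisymm h1 h2]
  constructor
  · intro hT
    refine ⟨?_, hT.indep⟩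
    have := hT.encard_eq_encard_of_isBase hB
    rw [hBS, Set.encard_coe_eq_coe_finsetCard] at this
    exact_mod_cast this
  · rintro ⟨hc, hT⟩
    obtain ⟨B', hB', hTB⟩ := hT.exists_isBase_superset
    have h1 := hB'.encard_eq_encard_of_isBase hB
    have : (T : Set (Fin N)) = B' := Set.Finite.eq_of_subset_of_encard_le (Set.toFinite _) hTB
      (by rw [h1, hBS, Set.encard_coe_eq_coe_finsetCard, hc])
    rwa [this]

/-- The `(a,b)`-Catalan matroid `C_n^{a,b}` on `n(a+b)` elements: the Schubert matroid of the set whose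
indicator vector is `(0^a, 1^b, 0^a, 1^b, …, 0^a, 1^b)`, with `n` blocks `0^a, 1^b`. -/
def catalan (n a b : ℕ) : Matroid (Fin (n * (a + b))) :=
  schubert (Finset.univ.filter (fun i ↦ a ≤ i.val % (a + b)))

/-! ### Kazhdan–Lusztig and inverse Kazhdan–Lusztig polynomials of matroids -/

/-- The rank of a matroid as a natural number. -/
def rank {α : Type*} (M : Matroid α) : ℕ := M.eRank.toNat

open Classical in
/-- The characteristic polynomial `χ_M(t) = ∑_{A ⊆ E} (-1)^{|A|} t^{rk E - rk A}`. -/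
def charPoly {α : Type*} [Fintype α] (M : Matroid α) : ℤ[X] :=
  ∑ A : {A : Finset α // (A : Set α) ⊆ M.E},
    (-1) ^ A.1.card * X ^ (rank M - (M.eRk (A.1 : Set α)).toNat)

open Classical in
theorem card_contract_lt {α : Type*} [Fintype α] (M : Matroid α)
    (F : {F : Set α // M.IsFlat F ∧ F.Nonempty}) :
    (Finset.univ.filter (fun e ↦ e ∈ (M.contract F.1).E)).card <
      (Finset.univ.filter (fun e ↦ e ∈ M.E)).card := by
  obtain ⟨F, hF, e, he⟩ := F
  refine Finset.card_lt_card ((Finset.ssubset_iff_of_subset fun x hx ↦ ?_).2 ⟨e, ?_, ?_⟩)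
  · have h := (Finset.mem_filter.1 hx).2
    rw [Matroid.contract_ground] at h
    exact Finset.mem_filter.2 ⟨Finset.mem_univ _, h.1⟩
  · simpa using hF.subset_ground he
  · simpa [Matroid.contract_ground] using fun _ ↦ he

open Classical in
/-- The Kazhdan–Lusztig polynomial `P_M(t)` of a loopless matroid `M`, which is characterised by
* `P_M = 1` if `rk M = 0`,
* `deg P_M < rk M / 2` if `rk M > 0`,
* `t^{rk M} P_M(t⁻¹) = ∑_F χ_{M|F}(t) P_{M/F}(t)`, the sum being over all flats `F` of `M`.

The flat `F = ∅` contributes `P_M(t)` to the sum. So, if `rk M > 0`, then by the last condition the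
sum over the nonempty flats is `t^{rk M} P_M(t⁻¹) - P_M(t)`, where the first term only has
monomials of degree `> rk M / 2` and the second only has monomials of degree `< rk M / 2`. Therefore
`P_M` is minus the part of degree `< rk M / 2` of the sum over the nonempty flats, which is the
recursion used here (see `klPoly_unique`). By convention `P_M = 0` if `M` has loops. -/
def klPoly {α : Type*} [Fintype α] (M : Matroid α) : ℤ[X] :=
  if ¬ M.Loopless then 0
  else if rank M = 0 then 1
  else
    ∑ i ∈ (Finset.range (rank M)).filter (fun i ↦ 2 * i < rank M),
      monomial i (-(∑ F : {F : Set α // M.IsFlat F ∧ F.Nonempty},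
        charPoly (M.restrict F.1) * klPoly (M.contract F.1)).coeff i)
termination_by (Finset.univ.filter (fun e ↦ e ∈ M.E)).card
decreasing_by exact card_contract_lt M F

theorem loopless_contract {α : Type*} (M : Matroid α) {F : Set α} (hF : M.IsFlat F) :
    (M.contract F).Loopless := by
  rw [Matroid.loopless_iff, Matroid.contract_loops_eq, hF.closure, Set.sdiff_self]

theorem charPoly_restrict_empty {α : Type*} [Fintype α] (M : Matroid α) :
    charPoly (M.restrict ∅) = 1 := by
  classical
  unfold charPoly
  rw [Fintype.sum_eq_single (⟨∅, by simp⟩ : {A : Finset α // (A : Set α) ⊆ (M.restrict ∅).E})]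
  · simp [rank]
  · rintro ⟨A, hA⟩ hne
    simp only [Matroid.restrict_ground_eq, Set.subset_empty_iff, Finset.coe_eq_empty] at hA
    simp [hA] at hne

open Classical in
/-- Any assignment satisfying the three conditions that characterise Kazhdan–Lusztig polynomials
agrees with `klPoly` on loopless matroids. Here `reflect r p` is `t^r p(t⁻¹)`. -/
theorem klPoly_unique {α : Type*} [Fintype α] (P : Matroid α → ℤ[X])
    (h0 : ∀ M : Matroid α, M.Loopless → rank M = 0 → P M = 1)
    (hdeg : ∀ M : Matroid α, M.Loopless → 0 < rank M → 2 * (P M).natDegree < rank M)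
    (hrec : ∀ M : Matroid α, M.Loopless → 0 < rank M →
      (P M).reflect (rank M) =
        ∑ F : {F : Set α // M.IsFlat F}, charPoly (M.restrict F.1) * P (M.contract F.1))
    (M : Matroid α) (hM : M.Loopless) : P M = klPoly M := by
  induction hc : (Finset.univ.filter (fun e ↦ e ∈ M.E)).card using Nat.strong_induction_on
    generalizing M with
  | _ c ih =>
    subst hc
    rw [klPoly, if_neg (not_not.2 hM)]
    split_ifs with hr
    · exact h0 M hM hr
    have hr' : 0 < rank M := Nat.pos_of_ne_zero hr
    have hd := hdeg M hM hr'
    have hempty : M.IsFlat ∅ := by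
      rw [Matroid.isFlat_iff_closure_eq]
      exact hM.loops_eq_empty
    have hsum : (P M).reflect (rank M) = P M +
        ∑ F : {F : Set α // M.IsFlat F ∧ F.Nonempty},
          charPoly (M.restrict F.1) * klPoly (M.contract F.1) := by
      rw [hrec M hM hr', ← Finset.add_sum_erase _ _
        (Finset.mem_univ (⟨∅, hempty⟩ : {F : Set α // M.IsFlat F}))]
      congr 1
      · simp [charPoly_restrict_empty, -Matroid.restrict_empty]
      · refine Finset.sum_bij' (fun F hF ↦ ⟨F.1, F.2, ?_⟩) (fun F _ ↦ ⟨F.1, F.2.1⟩)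
          ?_ ?_ ?_ ?_ ?_
        · rw [Set.nonempty_iff_ne_empty]
          rintro h
          exact (Finset.mem_erase.1 hF).1 (Subtype.ext h)
        · simp
        · intro F _
          refine Finset.mem_erase.2 ⟨fun h ↦ ?_, Finset.mem_univ _⟩
          exact F.2.2.ne_empty (congrArg Subtype.val h)
        · simp
        · simp
        · intro F hF
          have hne : F.1.Nonempty := by
            rw [Set.nonempty_iff_ne_empty]
            rintro h
            exact (Finset.mem_erase.1 hF).1 (Subtype.ext h)
          rw [ih _ (card_contract_lt M ⟨F.1, F.2, hne⟩) _ (loopless_contract M F.2) rfl]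
    ext i
    simp only [finsetSum_coeff, coeff_monomial]
    rw [Finset.sum_ite_eq']
    have hi := congrArg (fun p ↦ p.coeff i) hsum
    simp only [coeff_add, coeff_reflect] at hi
    split_ifs with hm
    · simp only [Finset.mem_filter, Finset.mem_range] at hm
      rw [revAt_le hm.1.le, coeff_eq_zero_of_natDegree_lt (by omega)] at hi
      simp only [finsetSum_coeff] at hi
      linarith
    · simp only [Finset.mem_filter, Finset.mem_range] at hm
      exact coeff_eq_zero_of_natDegree_lt (by omega)

open Classical in
/-- The inverse Kazhdan–Lusztig polynomial `Q_M(t)` of a loopless matroid `M`, which is defined by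
`Q_M = 1` if `rk M = 0`, and by
`∑_F (-1)^{rk (M|F)} P_{M|F}(t) Q_{M/F}(t) = 0` if `rk M > 0`, the sum being over all flats `F` of `M`.
(The flat `F = ∅` contributes `Q_M`.) By convention `Q_M = 0` if `M` has loops. -/
def invKLPoly {α : Type*} [Fintype α] (M : Matroid α) : ℤ[X] :=
  if ¬ M.Loopless then 0
  else if rank M = 0 then 1
  else
    -∑ F : {F : Set α // M.IsFlat F ∧ F.Nonempty},
      (-1) ^ rank (M.restrict F.1) * klPoly (M.restrict F.1) * invKLPoly (M.contract F.1)
termination_by (Finset.univ.filter (fun e ↦ e ∈ M.E)).card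
decreasing_by exact card_contract_lt M F

/-! ### The right-hand sides -/

/-- `z_λ = ∏_{i=1}^n i^{α_i} α_i!`, where `α_i` is the number of parts of `λ` equal to `i`. -/
def zPart {n : ℕ} (l : n.Partition) : ℕ :=
  ∏ i ∈ Finset.Icc 1 n, i ^ l.parts.count i * (l.parts.count i).factorial

/-- The inverse Kazhdan–Lusztig polynomial of `M`, with its coefficients regarded as rationals. -/
def invKLPolyQ {α : Type*} [Fintype α] (M : Matroid α) : ℚ[X] :=
  (invKLPoly M).map (Int.castRingHom ℚ)

/-- `Q_{U_λ^{a,b}} = ∏_i Q_{U_{λ_i}^{a,b}}`, where `U_m^{a,b}` is the uniform matroid of rank `mb` on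
`m(a+b)` elements. -/
def invKLPolyU {n : ℕ} (a b : ℕ) (l : n.Partition) : ℚ[X] :=
  (l.parts.map (fun m ↦ invKLPolyQ (uniform (m * b) (m * (a + b))))).prod

/-- The closed formula
`binom(N,k) ∑_{j=0}^{⌊(k-1)/2⌋} (N-k)(k-2j) / ((N-k+j)(N-j)) binom(k,j) t^j`,
to be used for `1 ≤ k < N`, where no denominator vanishes. -/
def closedFormula (k N : ℕ) : ℚ[X] :=
  C (N.choose k : ℚ) * ∑ j ∈ Finset.range ((k - 1) / 2 + 1),
    C ((((N : ℚ) - k) * ((k : ℚ) - 2 * j)) / (((N : ℚ) - k + j) * ((N : ℚ) - j)) * (k.choose j : ℚ))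
      * X ^ j

end CatalanMatroid

end

open Polynomial

noncomputable section

namespace CatalanMatroid

/-! Write `c n` for the inverse Kazhdan–Lusztig polynomial of the Catalan matroid with `n` blocks
and `u m` for that of the uniform matroid of rank `m * b` on `m * (a + b)` elements. The partition
formula is the coefficient form of `∑ c n x^n = exp (∑ u m x^m / m)`, hence is equivalent to `c 0 =
1` and the recursion `n * c n = ∑_{1 ≤ m ≤ n} u m * c (n - m)` (`eq_partitionSum`,
`natCast_mul_partitionSum`, `smul_invKLPoly_catalan`).

The recursion comes from a linear relation between matroids on `n` fixed blocks of `a + b` elements.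
An order `L` of the blocks gives a nested matroid `N_L`, in which the last `k` blocks have rank at
most `k * b`; it is isomorphic to the Catalan matroid. A set `T` of blocks carries a uniform matroid
`U_T` of rank `b * |T|`. For every valuative invariant `f`, `n ∑_L f(N_L) = ∑_T |T| (|T| - 1)! ∑_L
f(U_T ⊕ N_L)`, where on the right `L` runs over the orders of the complement of `T`. This is proved
for inverse Kazhdan–Lusztig polynomials in `card_smul_sum_iq_nestedRk`. Since they are
multiplicative on direct sums (`iq_union`), counting orders and dividing by `n!` gives the
recursion.

To make valuativity visible, the polynomials are defined for an arbitrary set function `r` and an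
interval `[F, G]` of sets, with sums over all sets instead of flats. Intervals containing a loop
have polynomial zero (`kl_eq_zero`, `iq_eq_zero`), so for rank functions the values are the usual
ones (`klPoly_eq_kl`, `invKLPoly_eq_iq`). Unfolding the recursions yields sums of functions that
read `r` only on a chain of sets (`isValuative_iq`). A chain refines to a full flag, that is, to the
initial sets of a total order `t`, and the values of a matroid rank function on a flag amount to its
greedy basis `B` (`exists_card_inter_eq`). So a relation need only be checked by counting, for fixed
`t` and `B`, the terms with greedy basis `B` (`IsValuative.sum_eq_zero`).

These terms are described by `Valid` for `N_L` and `Good` for `U_T`. Let `e` be the `t`-last element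
of `B` in the blocks of `U`. A valid order of `U` splits uniquely into a valid order of `U \ T` and
a rotation of a cyclic order of a good set `T` containing the block of `e`; by the cycle lemma each
cyclic order has exactly one admissible rotation (`validCount_eq_sum_of_max`). The resulting
recursion turns out to hold with any block of `U` in place of that of `e` (`sum_mem_eq_of_exists`),
and summation over the blocks gives the required count (`card_mul_validCount`).

The closed formula for uniform matroids is verified by checking that explicit candidates for both
polynomials satisfy the defining recursions (`kl_univ`, `iq_univ`, `uniformCoeff_eq`). -/

/-! ### Kazhdan–Lusztig polynomials of set functions

For a set function `r` on the finite subsets of a type, the polynomials below are indexed by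
intervals `[F, G]`. If `r` is the rank function of a matroid `M`, they are the polynomials of the
minor `(M|G)/F`. -/

/-- The part of a polynomial consisting of the terms of degree less than `d / 2`. -/
def low (d : ℕ) : ℤ[X] →ₗ[ℤ] ℤ[X] :=
  ∑ i ∈ (Finset.range d).filter (fun i ↦ 2 * i < d), monomial i ∘ₗ lcoeff ℤ i

theorem low_apply (d : ℕ) (p : ℤ[X]) :
    low d p = ∑ i ∈ (Finset.range d).filter (fun i ↦ 2 * i < d), monomial i (p.coeff i) := by
  simp [low]

theorem coeff_low (d : ℕ) (p : ℤ[X]) (i : ℕ) :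
    (low d p).coeff i = if 2 * i < d then p.coeff i else 0 := by
  rw [low_apply, finsetSum_coeff]
  simp only [coeff_monomial]
  rw [Finset.sum_ite_eq']
  simp only [Finset.mem_filter, Finset.mem_range]
  congr 1
  exact propext ⟨fun h ↦ h.2, fun h ↦ ⟨by omega, h⟩⟩

section Definitions

variable {α : Type*} [DecidableEq α]

/-- The characteristic polynomial of an interval. -/
def chi (r : Finset α → ℕ) (F G : Finset α) : ℤ[X] :=
  ∑ A ∈ Finset.Icc F G, (-1) ^ (A \ F).card * X ^ (r G - r A)

theorem card_sdiff_lt_of_mem_Ioc {F G H : Finset α} (h : H ∈ Finset.Ioc F G) :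
    (G \ H).card < (G \ F).card := by
  rw [Finset.mem_Ioc] at h
  have h1 := Finset.card_lt_card h.1
  have h2 := Finset.card_le_card h.2
  rw [Finset.card_sdiff_of_subset h.2, Finset.card_sdiff_of_subset (h.1.le.trans h.2)]
  omega

/-- The Kazhdan–Lusztig polynomial of an interval. -/
def kl (r : Finset α → ℕ) (F G : Finset α) : ℤ[X] :=
  -- The value 0 on rank-zero intervals with `F ≠ G`, which consist of loops, is what allows the
  -- sums to run over all sets: sets that are not closed contribute nothing.
  if r G = r F then if F = G then 1 else 0
  else -low (r G - r F) (∑ H : Finset.Ioc F G, chi r F H.1 * kl r H.1 G)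
termination_by (G \ F).card
decreasing_by exact card_sdiff_lt_of_mem_Ioc H.2

/-- The inverse Kazhdan–Lusztig polynomial of an interval. -/
def iq (r : Finset α → ℕ) (F G : Finset α) : ℤ[X] :=
  if r G = r F then if F = G then 1 else 0
  else -∑ H : Finset.Ioc F G, (-1) ^ (r H.1 - r F) * kl r F H.1 * iq r H.1 G
termination_by (G \ F).card
decreasing_by exact card_sdiff_lt_of_mem_Ioc H.2

variable {r : Finset α → ℕ} {F G : Finset α}

theorem kl_of_eq (h : r G = r F) : kl r F G = if F = G then 1 else 0 := by
  rw [kl, if_pos h]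

theorem kl_of_ne (h : r G ≠ r F) :
    kl r F G = -low (r G - r F) (∑ H ∈ Finset.Ioc F G, chi r F H * kl r H G) := by
  rw [kl, if_neg h, ← Finset.sum_coe_sort (Finset.Ioc F G) (fun H ↦ chi r F H * kl r H G)]

theorem iq_of_eq (h : r G = r F) : iq r F G = if F = G then 1 else 0 := by
  rw [iq, if_pos h]

theorem iq_of_ne (h : r G ≠ r F) :
    iq r F G = -∑ H ∈ Finset.Ioc F G, (-1) ^ (r H - r F) * kl r F H * iq r H G := by
  rw [iq, if_neg h,
    ← Finset.sum_coe_sort (Finset.Ioc F G) (fun H ↦ (-1) ^ (r H - r F) * kl r F H * iq r H G)]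

@[simp] theorem kl_self : kl r F F = 1 := by simp [kl_of_eq]

@[simp] theorem iq_self : iq r F F = 1 := by simp [iq_of_eq]

@[simp] theorem chi_self : chi r F F = 1 := by simp [chi]

theorem sum_Icc_eq_add_sum_Ioc {M : Type*} [AddCommMonoid M] (h : F ⊆ G) (f : Finset α → M) :
    ∑ H ∈ Finset.Icc F G, f H = f F + ∑ H ∈ Finset.Ioc F G, f H := by
  rw [← Finset.Icc_erase_left, Finset.add_sum_erase _ _ (Finset.left_mem_Icc.2 h)]

theorem coeff_kl_eq_zero (h : r G ≠ r F) {i : ℕ} (hi : r G - r F ≤ 2 * i) :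
    (kl r F G).coeff i = 0 := by
  rw [kl_of_ne h, coeff_neg, coeff_low, if_neg (by omega), neg_zero]

/-- For a matroid this sum is `t^d P(t⁻¹)` with `d` the rank. Only the vanishing of its terms below
degree `d / 2` is used, and that is built into the recursion. -/
theorem coeff_sum_chi_mul_kl_eq_zero (hFG : F ⊆ G) {i : ℕ} (hi : 2 * i < r G - r F) :
    (∑ H ∈ Finset.Icc F G, chi r F H * kl r H G).coeff i = 0 := by
  rw [sum_Icc_eq_add_sum_Ioc hFG, chi_self, one_mul, coeff_add, kl_of_ne (by omega), coeff_neg,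
    coeff_low, if_pos hi]
  ring

/-- The degree bound and the vanishing of the lower half of the convolution determine the
polynomial. Product and closed formulas for `kl` are checked through this criterion. -/
theorem kl_eq_of_coeff (h : r G ≠ r F) {p : ℤ[X]}
    (hdeg : ∀ i, r G - r F ≤ 2 * i → p.coeff i = 0)
    (hsum : ∀ i, 2 * i < r G - r F →
      (p + ∑ H ∈ Finset.Ioc F G, chi r F H * kl r H G).coeff i = 0) : kl r F G = p := by
  ext i
  rw [kl_of_ne h, coeff_neg, coeff_low]
  split_ifs with hi
  · have := hsum i hi
    rw [coeff_add] at this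
    linarith
  · rw [hdeg i (by omega), neg_zero]

theorem sum_kl_mul_iq (hFG : F ⊆ G) (h : r G ≠ r F) :
    ∑ H ∈ Finset.Icc F G, (-1) ^ (r H - r F) * kl r F H * iq r H G = 0 := by
  rw [sum_Icc_eq_add_sum_Ioc hFG, iq_of_ne h]
  simp

end Definitions

/-! ### Transfer along embeddings -/

section Transfer

variable {α β : Type*} [DecidableEq β] (e : α ↪ β) (C : Finset β)

theorem map_union_subset_map_union {A B : Finset α} (hA : ∀ x ∈ A, e x ∉ C) :
    A.map e ∪ C ⊆ B.map e ∪ C ↔ A ⊆ B := by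
  constructor
  · intro h x hx
    have := h (Finset.mem_union_left C (Finset.mem_map_of_mem e hx))
    simpa [hA x hx] using this
  · intro h
    exact Finset.union_subset_union (Finset.map_subset_map.2 h) le_rfl

theorem map_union_inj {A B : Finset α} (hA : ∀ x ∈ A, e x ∉ C) (hB : ∀ x ∈ B, e x ∉ C) :
    A.map e ∪ C = B.map e ∪ C ↔ A = B := by
  rw [Finset.Subset.antisymm_iff, map_union_subset_map_union e C hA,
    map_union_subset_map_union e C hB, ← Finset.Subset.antisymm_iff]

variable [DecidableEq α]

theorem card_map_union_sdiff {A B : Finset α} (hA : ∀ x ∈ A, e x ∉ C) :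
    ((A.map e ∪ C) \ (B.map e ∪ C)).card = (A \ B).card := by
  rw [← Finset.card_map e]
  congr 1
  ext y
  simp only [Finset.mem_sdiff, Finset.mem_union, Finset.mem_map]
  constructor
  · rintro ⟨⟨x, hx, rfl⟩ | h, h2⟩
    · exact ⟨x, ⟨hx, fun hB ↦ h2 (Or.inl ⟨x, hB, rfl⟩)⟩, rfl⟩
    · exact absurd (Or.inr h) h2
  · rintro ⟨x, ⟨hx, hB⟩, rfl⟩
    refine ⟨Or.inl ⟨x, hx, rfl⟩, ?_⟩
    rintro (⟨z, hz, h⟩ | h)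
    · exact hB (e.injective h ▸ hz)
    · exact hA x hx h

theorem sum_Icc_map_union {M : Type*} [AddCommMonoid M] {F G : Finset α} (hFG : F ⊆ G)
    (hG : ∀ x ∈ G, e x ∉ C) (f : Finset β → M) :
    ∑ H ∈ Finset.Icc (F.map e ∪ C) (G.map e ∪ C), f H =
      ∑ A ∈ Finset.Icc F G, f (A.map e ∪ C) := by
  symm
  refine Finset.sum_nbij (fun A ↦ A.map e ∪ C) ?_ ?_ ?_ (fun _ _ ↦ rfl)
  · intro A hA
    rw [Finset.mem_Icc] at hA ⊢
    exact ⟨Finset.union_subset_union (Finset.map_subset_map.2 hA.1) le_rfl,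
      Finset.union_subset_union (Finset.map_subset_map.2 hA.2) le_rfl⟩
  · intro A hA B hB h
    rw [Finset.coe_Icc, Set.mem_Icc] at hA hB
    exact (map_union_inj e C (fun x hx ↦ hG x (hA.2 hx)) (fun x hx ↦ hG x (hB.2 hx))).1 h
  · intro H hH
    rw [Finset.coe_Icc, Set.mem_Icc] at hH
    refine ⟨G.filter (fun x ↦ e x ∈ H), ?_, ?_⟩
    · rw [Finset.coe_Icc, Set.mem_Icc]
      exact ⟨fun x hx ↦ Finset.mem_filter.2 ⟨hFG hx,
        hH.1 (Finset.mem_union_left C (Finset.mem_map_of_mem e hx))⟩, Finset.filter_subset _ _⟩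
    · ext y
      simp only [Finset.mem_union, Finset.mem_map, Finset.mem_filter]
      constructor
      · rintro (⟨x, ⟨-, hx⟩, rfl⟩ | hy)
        · exact hx
        · exact hH.1 (Finset.mem_union_right _ hy)
      · intro hy
        rcases Finset.mem_union.1 (hH.2 hy) with h | h
        · obtain ⟨x, hx, rfl⟩ := Finset.mem_map.1 h
          exact Or.inl ⟨x, ⟨hx, hy⟩, rfl⟩
        · exact Or.inr h

theorem sum_Ioc_map_union {M : Type*} [AddCommGroup M] {F G : Finset α} (hFG : F ⊆ G)
    (hG : ∀ x ∈ G, e x ∉ C) (f : Finset β → M) :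
    ∑ H ∈ Finset.Ioc (F.map e ∪ C) (G.map e ∪ C), f H =
      ∑ A ∈ Finset.Ioc F G, f (A.map e ∪ C) := by
  have h := sum_Icc_map_union e C hFG hG f
  rw [sum_Icc_eq_add_sum_Ioc hFG, sum_Icc_eq_add_sum_Ioc
    (Finset.union_subset_union (Finset.map_subset_map.2 hFG) le_rfl)] at h
  exact add_left_cancel h

variable {e C} {r : Finset α → ℕ} {r' : Finset β → ℕ} {c : ℕ} {E : Finset α}
  (hE : ∀ x ∈ E, e x ∉ C) (hr : ∀ A ⊆ E, r' (A.map e ∪ C) = r A + c)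

include hE hr

/-- The map `A ↦ A.map e ∪ C` is an isomorphism of intervals, and only differences of ranks enter,
so the constant `c` is harmless. Taking `C = ∅` gives relabelling of elements; taking `C` to be a
contracted set gives minors. -/
theorem chi_map_union {F G : Finset α} (hFG : F ⊆ G) (hG : G ⊆ E) :
    chi r' (F.map e ∪ C) (G.map e ∪ C) = chi r F G := by
  rw [chi, sum_Icc_map_union e C hFG (fun x hx ↦ hE x (hG hx)), chi]
  refine Finset.sum_congr rfl fun A hA ↦ ?_
  rw [Finset.mem_Icc] at hA
  rw [card_map_union_sdiff e C (fun x hx ↦ hE x (hG (hA.2 hx))), hr G hG,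
    hr A (hA.2.trans hG), Nat.add_sub_add_right]

theorem kl_map_union {F G : Finset α} (hFG : F ⊆ G) (hG : G ⊆ E) :
    kl r' (F.map e ∪ C) (G.map e ∪ C) = kl r F G := by
  induction hn : (G \ F).card using Nat.strong_induction_on generalizing F with
  | _ n ih =>
    subst hn
    by_cases h : r G = r F
    · rw [kl_of_eq h, kl_of_eq (by rw [hr G hG, hr F (hFG.trans hG), h])]
      simp only [map_union_inj e C (fun x hx ↦ hE x (hG (hFG hx))) (fun x hx ↦ hE x (hG hx))]
    · rw [kl_of_ne h, kl_of_ne (by rw [hr G hG, hr F (hFG.trans hG)]; omega),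
        sum_Ioc_map_union e C hFG (fun x hx ↦ hE x (hG hx)), hr G hG, hr F (hFG.trans hG),
        Nat.add_sub_add_right]
      refine congrArg (fun p ↦ -low _ p) (Finset.sum_congr rfl fun A hA ↦ ?_)
      have hA' := Finset.mem_Ioc.1 hA
      rw [chi_map_union hE hr hA'.1.le (hA'.2.trans hG),
        ih _ (card_sdiff_lt_of_mem_Ioc hA) hA'.2 rfl]

theorem iq_map_union {F G : Finset α} (hFG : F ⊆ G) (hG : G ⊆ E) :
    iq r' (F.map e ∪ C) (G.map e ∪ C) = iq r F G := by
  induction hn : (G \ F).card using Nat.strong_induction_on generalizing F with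
  | _ n ih =>
    subst hn
    by_cases h : r G = r F
    · rw [iq_of_eq h, iq_of_eq (by rw [hr G hG, hr F (hFG.trans hG), h])]
      simp only [map_union_inj e C (fun x hx ↦ hE x (hG (hFG hx))) (fun x hx ↦ hE x (hG hx))]
    · rw [iq_of_ne h, iq_of_ne (by rw [hr G hG, hr F (hFG.trans hG)]; omega),
        sum_Ioc_map_union e C hFG (fun x hx ↦ hE x (hG hx))]
      congr 1
      refine Finset.sum_congr rfl fun A hA ↦ ?_
      have hA' := Finset.mem_Ioc.1 hA
      rw [kl_map_union hE hr hA'.1.le (hA'.2.trans hG),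
        ih _ (card_sdiff_lt_of_mem_Ioc hA) hA'.2 rfl, hr A (hA'.2.trans hG),
        hr F (hFG.trans hG), Nat.add_sub_add_right]

end Transfer

section Congr

variable {α : Type*} [DecidableEq α] {r r' : Finset α → ℕ} {E : Finset α}

theorem chi_congr (hr : ∀ A ⊆ E, r' A = r A) {F G : Finset α} (hFG : F ⊆ G) (hG : G ⊆ E) :
    chi r' F G = chi r F G := by
  simpa using chi_map_union (e := Function.Embedding.refl α) (C := ∅) (c := 0) (by simp)
    (by simpa using hr) hFG hG

theorem kl_congr (hr : ∀ A ⊆ E, r' A = r A) {F G : Finset α} (hFG : F ⊆ G) (hG : G ⊆ E) :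
    kl r' F G = kl r F G := by
  simpa using kl_map_union (e := Function.Embedding.refl α) (C := ∅) (c := 0) (by simp)
    (by simpa using hr) hFG hG

theorem iq_congr (hr : ∀ A ⊆ E, r' A = r A) {F G : Finset α} (hFG : F ⊆ G) (hG : G ⊆ E) :
    iq r' F G = iq r F G := by
  simpa using iq_map_union (e := Function.Embedding.refl α) (C := ∅) (c := 0) (by simp)
    (by simpa using hr) hFG hG

end Congr

/-! ### Loops -/

section Loops

variable {α : Type*} [DecidableEq α] {r : Finset α → ℕ} {F G : Finset α} {e : α}

/-- Adding or removing `e` is an involution on `[F, G]` that preserves the rank and reverses the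
sign. -/
theorem chi_eq_zero (he : e ∈ G \ F) (h : ∀ A, F ⊆ A → r (insert e A) = r A) :
    chi r F G = 0 := by
  rw [Finset.mem_sdiff] at he
  refine Finset.sum_involution (fun A _ ↦ if e ∈ A then A.erase e else insert e A) ?_ ?_ ?_ ?_
  · intro A hA
    have hA' := Finset.mem_Icc.1 hA
    split_ifs with hm
    · have hF : F ⊆ A.erase e := Finset.subset_erase.2 ⟨hA'.1, he.2⟩
      have h1 := h _ hF
      rw [Finset.insert_erase hm] at h1
      rw [h1, Finset.erase_sdiff_comm, ← Finset.card_erase_add_one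
        (Finset.mem_sdiff.2 ⟨hm, he.2⟩ : e ∈ A \ F)]
      ring
    · rw [h _ hA'.1, Finset.insert_sdiff_of_notMem _ he.2, Finset.card_insert_of_notMem
        (fun h ↦ hm (Finset.mem_sdiff.1 h).1)]
      ring
  · intro A hA _
    split_ifs with hm
    · exact fun h ↦ by rw [← h] at hm; simp at hm
    · exact fun h ↦ hm (h ▸ Finset.mem_insert_self e A)
  · intro A hA
    rw [Finset.mem_Icc] at hA ⊢
    split_ifs with hm
    · exact ⟨Finset.subset_erase.2 ⟨hA.1, he.2⟩, (Finset.erase_subset _ _).trans hA.2⟩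
    · exact ⟨hA.1.trans (Finset.subset_insert _ _), Finset.insert_subset he.1 hA.2⟩
  · intro A hA
    by_cases hm : e ∈ A
    · simp [hm]
    · simp [hm]

/-- In each term of the recursion `e` lies in `H \ F`, and the characteristic polynomial vanishes,
or in `G \ H`, and induction applies, since the hypothesis passes from `F` to the larger set `H`. -/
theorem kl_eq_zero (he : e ∈ G \ F) (h : ∀ A, F ⊆ A → r (insert e A) = r A) :
    kl r F G = 0 := by
  induction hn : (G \ F).card using Nat.strong_induction_on generalizing F with
  | _ n ih =>
    subst hn
    by_cases hr : r G = r F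
    · rw [kl_of_eq hr, if_neg]
      rintro rfl
      simp at he
    · rw [kl_of_ne hr, Finset.sum_eq_zero, map_zero, neg_zero]
      intro H hH
      have hH' := Finset.mem_Ioc.1 hH
      by_cases hm : e ∈ H
      · rw [chi_eq_zero (Finset.mem_sdiff.2 ⟨hm, (Finset.mem_sdiff.1 he).2⟩) h, zero_mul]
      · rw [ih _ (card_sdiff_lt_of_mem_Ioc hH) (Finset.mem_sdiff.2 ⟨(Finset.mem_sdiff.1 he).1, hm⟩)
          (fun A hA ↦ h A (hH'.1.le.trans hA)) rfl, mul_zero]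

theorem iq_eq_zero (he : e ∈ G \ F) (h : ∀ A, F ⊆ A → r (insert e A) = r A) :
    iq r F G = 0 := by
  induction hn : (G \ F).card using Nat.strong_induction_on generalizing F with
  | _ n ih =>
    subst hn
    by_cases hr : r G = r F
    · rw [iq_of_eq hr, if_neg]
      rintro rfl
      simp at he
    · rw [iq_of_ne hr, Finset.sum_eq_zero, neg_zero]
      intro H hH
      have hH' := Finset.mem_Ioc.1 hH
      by_cases hm : e ∈ H
      · rw [kl_eq_zero (Finset.mem_sdiff.2 ⟨hm, (Finset.mem_sdiff.1 he).2⟩) h, mul_zero, zero_mul]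
      · rw [ih _ (card_sdiff_lt_of_mem_Ioc hH) (Finset.mem_sdiff.2 ⟨(Finset.mem_sdiff.1 he).1, hm⟩)
          (fun A hA ↦ h A (hH'.1.le.trans hA)) rfl, mul_zero]

end Loops

/-! ### Direct sums -/

section DirectSum

variable {α : Type*} [DecidableEq α] {r : Finset α → ℕ} {E E' : Finset α}

theorem union_inter_eq_left {H H' : Finset α} (hd : Disjoint E E') (hH : H ⊆ E) (hH' : H' ⊆ E') :
    (H ∪ H') ∩ E = H := by
  rw [Finset.union_inter_distrib_right, Finset.inter_eq_left.2 hH,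
    Finset.disjoint_iff_inter_eq_empty.1 (Finset.disjoint_of_subset_left hH' hd.symm),
    Finset.union_empty]

theorem union_inter_eq_right {H H' : Finset α} (hd : Disjoint E E') (hH : H ⊆ E) (hH' : H' ⊆ E') :
    (H ∪ H') ∩ E' = H' := by
  rw [Finset.union_comm, union_inter_eq_left hd.symm hH' hH]

theorem sum_Icc_union {M : Type*} [AddCommMonoid M] {F G F' G' : Finset α} (hd : Disjoint E E')
    (hFG : F ⊆ G) (hG : G ⊆ E) (hFG' : F' ⊆ G') (hG' : G' ⊆ E') (f : Finset α → M) :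
    ∑ H ∈ Finset.Icc (F ∪ F') (G ∪ G'), f H =
      ∑ H ∈ Finset.Icc F G, ∑ H' ∈ Finset.Icc F' G', f (H ∪ H') := by
  rw [← Finset.sum_product']
  refine Finset.sum_bij' (fun H _ ↦ (H ∩ E, H ∩ E')) (fun p _ ↦ p.1 ∪ p.2) ?_ ?_ ?_ ?_ ?_
  · intro H hH
    rw [Finset.mem_Icc] at hH
    rw [Finset.mem_product, Finset.mem_Icc, Finset.mem_Icc]
    have h1 := union_inter_eq_left hd (hFG.trans hG) (hFG'.trans hG')
    have h2 := union_inter_eq_left hd hG hG'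
    have h3 := union_inter_eq_right hd (hFG.trans hG) (hFG'.trans hG')
    have h4 := union_inter_eq_right hd hG hG'
    refine ⟨⟨?_, ?_⟩, ?_, ?_⟩
    · exact h1.symm.le.trans (Finset.inter_subset_inter_right hH.1)
    · exact (Finset.inter_subset_inter_right hH.2).trans h2.le
    · exact h3.symm.le.trans (Finset.inter_subset_inter_right hH.1)
    · exact (Finset.inter_subset_inter_right hH.2).trans h4.le
  · rintro ⟨A, B⟩ h
    rw [Finset.mem_product, Finset.mem_Icc, Finset.mem_Icc] at h
    exact Finset.mem_Icc.2 ⟨Finset.union_subset_union h.1.1 h.2.1,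
      Finset.union_subset_union h.1.2 h.2.2⟩
  · intro H hH
    rw [Finset.mem_Icc] at hH
    rw [← Finset.inter_union_distrib_left, Finset.inter_eq_left]
    exact hH.2.trans (Finset.union_subset_union hG hG')
  · rintro ⟨A, B⟩ h
    rw [Finset.mem_product, Finset.mem_Icc, Finset.mem_Icc] at h
    simp only [union_inter_eq_left hd (h.1.2.trans hG) (h.2.2.trans hG'),
      union_inter_eq_right hd (h.1.2.trans hG) (h.2.2.trans hG')]
  · intro H hH
    rw [Finset.mem_Icc] at hH
    rw [← Finset.inter_union_distrib_left, Finset.inter_eq_left.2]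
    exact hH.2.trans (Finset.union_subset_union hG hG')

theorem union_inj_of_disjoint {F G F' G' : Finset α} (hd : Disjoint E E')
    (hF : F ⊆ E) (hG : G ⊆ E) (hF' : F' ⊆ E') (hG' : G' ⊆ E') :
    F ∪ F' = G ∪ G' ↔ F = G ∧ F' = G' := by
  constructor
  · intro h
    constructor
    · rw [← union_inter_eq_left hd hF hF', h, union_inter_eq_left hd hG hG']
    · rw [← union_inter_eq_right hd hF hF', h, union_inter_eq_right hd hG hG']
  · rintro ⟨rfl, rfl⟩
    rfl

variable (hd : Disjoint E E') (hr : ∀ A ⊆ E, ∀ B ⊆ E', r (A ∪ B) = r A + r B)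
  (hm : Monotone r)

include hd hr hm

theorem chi_union {F G F' G' : Finset α} (hFG : F ⊆ G) (hG : G ⊆ E) (hFG' : F' ⊆ G')
    (hG' : G' ⊆ E') : chi r (F ∪ F') (G ∪ G') = chi r F G * chi r F' G' := by
  rw [chi, sum_Icc_union hd hFG hG hFG' hG', chi, chi, Finset.sum_mul_sum]
  refine Finset.sum_congr rfl fun A hA ↦ Finset.sum_congr rfl fun B hB ↦ ?_
  rw [Finset.mem_Icc] at hA hB
  have h1 : ((A ∪ B) \ (F ∪ F')).card = (A \ F).card + (B \ F').card := by
    rw [← Finset.card_union_of_disjoint]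
    · congr 1
      have h2 := Finset.disjoint_left.1 hd
      ext x
      simp only [Finset.mem_sdiff, Finset.mem_union]
      constructor
      · tauto
      · rintro (⟨h3, h4⟩ | ⟨h3, h4⟩)
        · exact ⟨Or.inl h3, fun h5 ↦ h5.elim h4 fun h6 ↦
            h2 (hG (hA.2 h3)) (hG' (hFG' h6))⟩
        · exact ⟨Or.inr h3, fun h5 ↦ h5.elim (fun h6 ↦
            h2 (hG (hFG h6)) (hG' (hB.2 h3))) h4⟩
    · exact Finset.disjoint_of_subset_left (Finset.sdiff_subset.trans (hA.2.trans hG))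
        (Finset.disjoint_of_subset_right (Finset.sdiff_subset.trans (hB.2.trans hG')) hd)
  have h2 : r (G ∪ G') - r (A ∪ B) = (r G - r A) + (r G' - r B) := by
    rw [hr _ hG _ hG', hr _ (hA.2.trans hG) _ (hB.2.trans hG')]
    have := hm hA.2
    have := hm hB.2
    omega
  rw [h1, h2, pow_add, pow_add]
  ring

/-- The convolution sum over the product interval is the product of the two convolution sums. A
coefficient in the lower half of the total degree range is a sum of products in which one factor
lies in the lower half of its own range, where it vanishes. The degree bound follows in the same way
from the upper halves. -/
theorem kl_union {F G F' G' : Finset α} (hFG : F ⊆ G) (hG : G ⊆ E) (hFG' : F' ⊆ G')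
    (hG' : G' ⊆ E') : kl r (F ∪ F') (G ∪ G') = kl r F G * kl r F' G' := by
  induction hn : ((G ∪ G') \ (F ∪ F')).card using Nat.strong_induction_on generalizing F F' with
  | _ n ih =>
    subst hn
    have hF := hFG.trans hG
    have hF' := hFG'.trans hG'
    have hrF := hm hFG
    have hrF' := hm hFG'
    have e1 := hr _ hG _ hG'
    have e2 := hr _ hF _ hF'
    have hU : F ∪ F' ⊆ G ∪ G' := Finset.union_subset_union hFG hFG'
    by_cases h : r G = r F ∧ r G' = r F'
    · rw [kl_of_eq (by omega), kl_of_eq h.1, kl_of_eq h.2]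
      simp only [union_inj_of_disjoint hd hF hG hF' hG']
      split_ifs <;> simp_all
    -- One of the two factors may have rank zero. Its polynomial can then be 1, which violates the
    -- degree bound at `i = 0` only.
    have hcoeff : ∀ (A B : Finset α), r A ≤ r B → ∀ i, r B - r A ≤ 2 * i →
        (r B ≠ r A ∨ i ≠ 0) → (kl r A B).coeff i = 0 := by
      intro A B hAB i hi h
      by_cases hAB' : r B = r A
      · rw [kl_of_eq hAB']
        split_ifs
        · rw [coeff_one, if_neg]
          tauto
        · simp
      · exact coeff_kl_eq_zero hAB' hi
    refine kl_eq_of_coeff (by omega) ?_ ?_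
    · intro i hi
      rw [coeff_mul]
      refine Finset.sum_eq_zero fun p hp ↦ ?_
      rw [Finset.HasAntidiagonal.mem_antidiagonal] at hp
      by_cases h1 : r G - r F ≤ 2 * p.1 ∧ (r G ≠ r F ∨ p.1 ≠ 0)
      · rw [hcoeff _ _ hrF _ h1.1 h1.2, zero_mul]
      · rw [hcoeff _ _ hrF' p.2 (by omega) (by omega), mul_zero]
    · intro i hi
      -- Induction covers every set except `F ∪ F'`. At that set the summand is replaced by the
      -- claimed product, so that the sum over the closed interval factors completely.
      have key : kl r F G * kl r F' G' + ∑ H ∈ Finset.Ioc (F ∪ F') (G ∪ G'),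
          chi r (F ∪ F') H * kl r H (G ∪ G') =
          (∑ H ∈ Finset.Icc F G, chi r F H * kl r H G) *
            ∑ H ∈ Finset.Icc F' G', chi r F' H * kl r H G' := by
        rw [Finset.sum_mul_sum]
        have h3 := sum_Icc_union (M := ℤ[X]) hd hFG hG hFG' hG' (fun H ↦
          chi r (F ∪ F') H * if H = F ∪ F' then kl r F G * kl r F' G' else kl r H (G ∪ G'))
        rw [sum_Icc_eq_add_sum_Ioc hU, if_pos rfl, chi_self, one_mul] at h3
        rw [Finset.sum_congr rfl (g := fun H ↦ chi r (F ∪ F') H *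
          if H = F ∪ F' then kl r F G * kl r F' G' else kl r H (G ∪ G')), h3]
        · refine Finset.sum_congr rfl fun A hA ↦ Finset.sum_congr rfl fun B hB ↦ ?_
          have hA' := Finset.mem_Icc.1 hA
          have hB' := Finset.mem_Icc.1 hB
          rw [chi_union hd hr hm hA'.1 (hA'.2.trans hG) hB'.1 (hB'.2.trans hG')]
          split_ifs with heq
          · obtain ⟨rfl, rfl⟩ := (union_inj_of_disjoint hd (hA'.2.trans hG) hF
              (hB'.2.trans hG') hF').1 heq
            ring
          · rw [ih _ (card_sdiff_lt_of_mem_Ioc (Finset.mem_Ioc.2 ⟨lt_of_le_of_ne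
              (Finset.union_subset_union hA'.1 hB'.1) (Ne.symm heq),
              Finset.union_subset_union hA'.2 hB'.2⟩)) hA'.2 hB'.2 rfl]
            ring
        · intro H hH
          rw [if_neg (Finset.mem_Ioc.1 hH).1.ne']
      rw [key, coeff_mul]
      refine Finset.sum_eq_zero fun p hp ↦ ?_
      rw [Finset.HasAntidiagonal.mem_antidiagonal] at hp
      by_cases h1 : 2 * p.1 < r G - r F
      · rw [coeff_sum_chi_mul_kl_eq_zero hFG h1, zero_mul]
      · rw [coeff_sum_chi_mul_kl_eq_zero hFG' (by omega), mul_zero]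

theorem iq_union {F G F' G' : Finset α} (hFG : F ⊆ G) (hG : G ⊆ E) (hFG' : F' ⊆ G')
    (hG' : G' ⊆ E') : iq r (F ∪ F') (G ∪ G') = iq r F G * iq r F' G' := by
  induction hn : ((G ∪ G') \ (F ∪ F')).card using Nat.strong_induction_on generalizing F F' with
  | _ n ih =>
    subst hn
    have hF := hFG.trans hG
    have hF' := hFG'.trans hG'
    have hrF := hm hFG
    have hrF' := hm hFG'
    have e1 := hr _ hG _ hG'
    have e2 := hr _ hF _ hF'
    have hU : F ∪ F' ⊆ G ∪ G' := Finset.union_subset_union hFG hFG'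
    by_cases h : r G = r F ∧ r G' = r F'
    · rw [iq_of_eq (by omega), iq_of_eq h.1, iq_of_eq h.2]
      simp only [union_inj_of_disjoint hd hF hG hF' hG']
      split_ifs <;> simp_all
    have key : iq r F G * iq r F' G' + ∑ H ∈ Finset.Ioc (F ∪ F') (G ∪ G'),
        (-1) ^ (r H - r (F ∪ F')) * kl r (F ∪ F') H * iq r H (G ∪ G') =
        (∑ H ∈ Finset.Icc F G, (-1) ^ (r H - r F) * kl r F H * iq r H G) *
          ∑ H ∈ Finset.Icc F' G', (-1) ^ (r H - r F') * kl r F' H * iq r H G' := by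
      rw [Finset.sum_mul_sum]
      have h3 := sum_Icc_union (M := ℤ[X]) hd hFG hG hFG' hG' (fun H ↦
        (-1) ^ (r H - r (F ∪ F')) * kl r (F ∪ F') H *
          if H = F ∪ F' then iq r F G * iq r F' G' else iq r H (G ∪ G'))
      rw [sum_Icc_eq_add_sum_Ioc hU, if_pos rfl, kl_self, Nat.sub_self, pow_zero, one_mul,
        one_mul] at h3
      rw [Finset.sum_congr rfl (g := fun H ↦ (-1) ^ (r H - r (F ∪ F')) * kl r (F ∪ F') H *
        if H = F ∪ F' then iq r F G * iq r F' G' else iq r H (G ∪ G')), h3]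
      · refine Finset.sum_congr rfl fun A hA ↦ Finset.sum_congr rfl fun B hB ↦ ?_
        have hA' := Finset.mem_Icc.1 hA
        have hB' := Finset.mem_Icc.1 hB
        have h4 : r (A ∪ B) - r (F ∪ F') = (r A - r F) + (r B - r F') := by
          have := hm hA'.1
          have := hm hB'.1
          rw [hr _ (hA'.2.trans hG) _ (hB'.2.trans hG')]
          omega
        rw [kl_union hd hr hm hA'.1 (hA'.2.trans hG) hB'.1 (hB'.2.trans hG'), h4, pow_add]
        split_ifs with heq
        · obtain ⟨rfl, rfl⟩ := (union_inj_of_disjoint hd (hA'.2.trans hG) hF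
            (hB'.2.trans hG') hF').1 heq
          ring
        · rw [ih _ (card_sdiff_lt_of_mem_Ioc (Finset.mem_Ioc.2 ⟨lt_of_le_of_ne
            (Finset.union_subset_union hA'.1 hB'.1) (Ne.symm heq),
            Finset.union_subset_union hA'.2 hB'.2⟩)) hA'.2 hB'.2 rfl]
          ring
      · intro H hH
        rw [if_neg (Finset.mem_Ioc.1 hH).1.ne']
    have hzero : (∑ H ∈ Finset.Icc F G, (-1) ^ (r H - r F) * kl r F H * iq r H G) *
        ∑ H ∈ Finset.Icc F' G', (-1) ^ (r H - r F') * kl r F' H * iq r H G' = 0 := by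
      by_cases h1 : r G = r F
      · rw [sum_kl_mul_iq hFG' (by tauto), mul_zero]
      · rw [sum_kl_mul_iq hFG h1, zero_mul]
    rw [hzero] at key
    rw [iq_of_ne (by omega)]
    linear_combination -key

end DirectSum

/-! ### The polynomials of a matroid in terms of its rank function -/

section RankFunction

variable {α : Type*} (M : Matroid α)

/-- The rank function of a matroid on finite sets. -/
def rkFun (A : Finset α) : ℕ := (M.eRk (A : Set α)).toNat

theorem rkFun_empty : rkFun M ∅ = 0 := by simp [rkFun]

theorem coe_rkFun (A : Finset α) : (rkFun M A : ℕ∞) = M.eRk (A : Set α) :=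
  ENat.natCast_toNat (ne_top_of_le_ne_top (by simp) (M.eRk_le_encard (A : Set α)))

variable {M}

theorem rank_eq_rkFun {E : Finset α} (hE : (E : Set α) = M.E) : rank M = rkFun M E := by
  rw [rank, rkFun, hE, Matroid.eRk_ground]

theorem rkFun_restrict {A G : Finset α} (h : A ⊆ G) :
    rkFun (M.restrict (G : Set α)) A = rkFun M A := by
  rw [rkFun, Matroid.restrict_eRk_eq _ (Finset.coe_subset.2 h), rkFun]

/-- Extend a basis `I` of `F` to a basis of `A ∪ F`: what is added is independent in the
contraction. Conversely, a basis of `A` in the contraction together with `I` is independent in `M`.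
The sets `A` and `F` may overlap, as elements of `F` do not count in the contraction. -/
theorem rkFun_contract [DecidableEq α] (F A : Finset α) :
    rkFun M (A ∪ F) = rkFun (M.contract (F : Set α)) A + rkFun M F := by
  have key : M.eRk ((A ∪ F : Finset α) : Set α) =
      (M.contract (F : Set α)).eRk A + M.eRk (F : Set α) := by
    obtain ⟨I, hI⟩ := M.exists_isBasis' (F : Set α)
    rw [Finset.coe_union, hI.eRk_eq_encard]
    apply le_antisymm
    · obtain ⟨K, hK, hIK⟩ := hI.indep.subset_isBasis'_of_subset
        (hI.subset.trans (Set.subset_union_right (s := (A : Set α))))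
      have hKF : K ∩ F = I := (hI.eq_of_subset_indep (hK.indep.inter_right _)
        (Set.subset_inter hIK hI.subset) Set.inter_subset_right).symm
      have hJ : (M.contract (F : Set α)).Indep (K \ F) := by
        rw [hI.contract_indep_iff]
        refine ⟨?_, Set.disjoint_sdiff_right⟩
        rw [← hKF, Set.sdiff_union_inter]
        exact hK.indep
      rw [hK.eRk_eq_encard, ← Set.encard_sdiff_add_encard_inter K F, hKF]
      gcongr
      refine hJ.encard_le_eRk_of_subset fun x hx ↦ ?_
      exact (hK.subset hx.1).resolve_right hx.2
    · obtain ⟨J, hJ⟩ := (M.contract (F : Set α)).exists_isBasis' (A : Set α)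
      have h := hI.contract_indep_iff.1 hJ.indep
      rw [hJ.eRk_eq_encard, ← Set.encard_union_eq (h.2.symm.mono_right hI.subset)]
      exact h.1.encard_le_eRk_of_subset (Set.union_subset_union hJ.subset hI.subset)
  rw [← coe_rkFun, ← coe_rkFun, ← coe_rkFun] at key
  exact_mod_cast key

theorem rkFun_insert [DecidableEq α] {e : α} {F A : Finset α}
    (he : e ∈ M.closure (F : Set α)) (hFA : F ⊆ A) :
    rkFun M (insert e A) = rkFun M A := by
  rw [rkFun, Finset.coe_insert, ← Matroid.eRk_closure_eq,
    Matroid.closure_insert_eq_of_mem_closure (M.closure_mono (Finset.coe_subset.2 hFA) he),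
    Matroid.eRk_closure_eq, rkFun]

theorem kl_rkFun_eq_zero [DecidableEq α] {F G : Finset α}
    (h : ∃ e ∈ G, e ∉ F ∧ e ∈ M.closure (F : Set α)) : kl (rkFun M) F G = 0 := by
  obtain ⟨e, heG, heF, he⟩ := h
  exact kl_eq_zero (Finset.mem_sdiff.2 ⟨heG, heF⟩) fun A hA ↦ rkFun_insert he hA

theorem iq_rkFun_eq_zero [DecidableEq α] {F G : Finset α}
    (h : ∃ e ∈ G, e ∉ F ∧ e ∈ M.closure (F : Set α)) : iq (rkFun M) F G = 0 := by
  obtain ⟨e, heG, heF, he⟩ := h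
  exact iq_eq_zero (Finset.mem_sdiff.2 ⟨heG, heF⟩) fun A hA ↦ rkFun_insert he hA

theorem exists_mem_closure_of_not_isFlat {E F : Finset α} (hE : (E : Set α) = M.E) (hF : F ⊆ E)
    (h : ¬ M.IsFlat (F : Set α)) : ∃ e ∈ E, e ∉ F ∧ e ∈ M.closure (F : Set α) := by
  rw [Matroid.isFlat_iff_closure_eq] at h
  have h1 : (F : Set α) ⊆ M.closure F :=
    M.subset_closure _ (by rw [← hE]; exact Finset.coe_subset.2 hF)
  obtain ⟨e, he, heF⟩ := Set.exists_of_ssubset (h1.ssubset_of_ne (Ne.symm h))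
  refine ⟨e, ?_, heF, he⟩
  have := M.closure_subset_ground (F : Set α) he
  rwa [← hE] at this

theorem eq_empty_of_loopless [DecidableEq α] {E : Finset α} (hE : (E : Set α) = M.E)
    (hM : M.Loopless)
    (h : rank M = 0) : E = ∅ := by
  rw [rank_eq_rkFun hE] at h
  have h1 := coe_rkFun M E
  rw [h, Nat.cast_zero, eq_comm, Matroid.eRk_eq_zero_iff (hE.le), hM.loops_eq_empty] at h1
  simpa using h1

theorem exists_loop [DecidableEq α] {E : Finset α} (hE : (E : Set α) = M.E) (hM : ¬ M.Loopless) :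
    ∃ e ∈ E, e ∉ (∅ : Finset α) ∧ e ∈ M.closure ((∅ : Finset α) : Set α) := by
  rw [Matroid.loopless_iff] at hM
  obtain ⟨e, he⟩ := Set.nonempty_iff_ne_empty.2 hM
  refine ⟨e, ?_, by simp, by simpa [Matroid.loops] using he⟩
  have := M.loops_subset_ground he
  rwa [← hE] at this

theorem kl_contract [DecidableEq α] {F H G : Finset α} (hFH : F ⊆ H)
    (hHG : H ⊆ G) :
    kl (rkFun (M.contract (F : Set α))) (H \ F) (G \ F) = kl (rkFun M) H G := by
  have h := kl_map_union (e := Function.Embedding.refl α) (C := F) (c := rkFun M F) (E := G \ F)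
    (r := rkFun (M.contract (F : Set α))) (r' := rkFun M)
    (by simp) (fun A _ ↦ by simpa using rkFun_contract F A)
    (Finset.sdiff_subset_sdiff hHG le_rfl) le_rfl
  rw [← h]
  simp [Finset.union_eq_left.2 hFH, Finset.union_eq_left.2 (hFH.trans hHG)]

theorem iq_contract [DecidableEq α] {F H G : Finset α} (hFH : F ⊆ H)
    (hHG : H ⊆ G) :
    iq (rkFun (M.contract (F : Set α))) (H \ F) (G \ F) = iq (rkFun M) H G := by
  have h := iq_map_union (e := Function.Embedding.refl α) (C := F) (c := rkFun M F) (E := G \ F)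
    (r := rkFun (M.contract (F : Set α))) (r' := rkFun M)
    (by simp) (fun A _ ↦ by simpa using rkFun_contract F A)
    (Finset.sdiff_subset_sdiff hHG le_rfl) le_rfl
  rw [← h]
  simp [Finset.union_eq_left.2 hFH, Finset.union_eq_left.2 (hFH.trans hHG)]

variable [Fintype α]

open Classical in
theorem charPoly_eq_chi [DecidableEq α] {E : Finset α} (hE : (E : Set α) = M.E) :
    charPoly M = chi (rkFun M) ∅ E := by
  rw [charPoly, chi, rank_eq_rkFun hE]
  refine Finset.sum_bij (fun A _ ↦ A.1) ?_ ?_ ?_ ?_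
  · intro A _
    exact Finset.mem_Icc.2 ⟨Finset.empty_subset _,
      Finset.coe_subset.1 (A.2.trans hE.ge)⟩
  · intro A _ B _ h
    exact Subtype.ext h
  · intro A hA
    exact ⟨⟨A, (Finset.coe_subset.2 (Finset.mem_Icc.1 hA).2).trans hE.le⟩, Finset.mem_univ _, rfl⟩
  · intro A _
    rw [Finset.sdiff_empty]
    rfl

open Classical in
theorem sum_Ioc_eq_sum_flats [DecidableEq α] {E : Finset α} (hE : (E : Set α) = M.E)
    (f : Finset α → ℤ[X])
    (hf : ∀ H ⊆ E, ¬ M.IsFlat (H : Set α) → f H = 0) :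
    ∑ H ∈ Finset.Ioc ∅ E, f H =
      ∑ F : {F : Set α // M.IsFlat F ∧ F.Nonempty}, f F.1.toFinset := by
  rw [← Finset.sum_filter_of_ne (p := fun H : Finset α ↦ M.IsFlat (H : Set α))]
  · symm
    refine Finset.sum_bij (fun F _ ↦ F.1.toFinset) ?_ ?_ ?_ (fun _ _ ↦ rfl)
    · intro F _
      rw [Finset.mem_filter, Finset.mem_Ioc, Set.coe_toFinset]
      refine ⟨⟨?_, ?_⟩, F.2.1⟩
      · rw [Finset.empty_ssubset, Set.toFinset_nonempty]
        exact F.2.2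
      · rw [← Finset.coe_subset, Set.coe_toFinset, hE]
        exact F.2.1.subset_ground
    · intro F _ F' _ h
      exact Subtype.ext (Set.toFinset_inj.1 h)
    · intro H hH
      rw [Finset.mem_filter, Finset.mem_Ioc, Finset.empty_ssubset] at hH
      exact ⟨⟨H, hH.2, by simpa using hH.1.1⟩, Finset.mem_univ _, by simp⟩
  · intro H hH hne
    by_contra h
    exact hne (hf H (Finset.mem_Ioc.1 hH).2 h)

/-- Sets that are not flats drop out because some element outside them becomes a loop after
contraction. On flats, the two factors are the polynomials of the restriction and of the
contraction. If `M` itself has a loop, both sides are zero. -/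
theorem klPoly_eq_kl [DecidableEq α] {E : Finset α} (hE : (E : Set α) = M.E) :
    klPoly M = kl (rkFun M) ∅ E := by
  induction hn : E.card using Nat.strong_induction_on generalizing M E with
  | _ n ih =>
    subst hn
    rw [klPoly]
    split_ifs with hM h0
    · have hempty := eq_empty_of_loopless hE hM h0
      rw [hempty, kl_self]
    · rw [rank_eq_rkFun hE] at h0 ⊢
      rw [kl_of_ne (by rwa [rkFun_empty]), low_apply, rkFun_empty, Nat.sub_zero,
        ← Finset.sum_neg_distrib]
      refine Finset.sum_congr rfl fun i _ ↦ ?_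
      rw [monomial_neg, sum_Ioc_eq_sum_flats hE]
      · refine congrArg (fun p : ℤ[X] ↦ -monomial i (p.coeff i))
          (Finset.sum_congr rfl fun F _ ↦ ?_)
        obtain ⟨F, hF, hne⟩ := F
        obtain ⟨F, rfl⟩ : ∃ F' : Finset α, (F' : Set α) = F := ⟨F.toFinite.toFinset, by simp⟩
        have hFE : F ⊆ E := Finset.coe_subset.1 (hF.subset_ground.trans hE.ge)
        have hlt : (E \ F).card < E.card := by
          rw [Finset.card_sdiff_of_subset hFE]
          have h1 := Finset.card_pos.2 (Finset.coe_nonempty.1 hne)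
          have h2 := Finset.card_le_card hFE
          omega
        rw [Finset.toFinset_coe, charPoly_eq_chi (E := F) rfl, ih _ hlt (E := E \ F)
          (by rw [Finset.coe_sdiff, hE, Matroid.contract_ground]) rfl,
          chi_congr (fun A hA ↦ rkFun_restrict hA) (Finset.empty_subset F) le_rfl,
          ← kl_contract (F := F) le_rfl hFE, Finset.sdiff_self]
      · intro H hH hflat
        rw [kl_rkFun_eq_zero (exists_mem_closure_of_not_isFlat hE hH hflat), mul_zero]
    · rw [kl_rkFun_eq_zero (exists_loop hE hM)]

theorem invKLPoly_eq_iq [DecidableEq α] {E : Finset α} (hE : (E : Set α) = M.E) :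
    invKLPoly M = iq (rkFun M) ∅ E := by
  induction hn : E.card using Nat.strong_induction_on generalizing M E with
  | _ n ih =>
    subst hn
    rw [invKLPoly]
    split_ifs with hM h0
    · have hempty := eq_empty_of_loopless hE hM h0
      rw [hempty, iq_self]
    · rw [rank_eq_rkFun hE] at h0
      rw [iq_of_ne (by rwa [rkFun_empty]), sum_Ioc_eq_sum_flats hE]
      · refine congrArg Neg.neg (Finset.sum_congr rfl fun F _ ↦ ?_)
        obtain ⟨F, hF, hne⟩ := F
        obtain ⟨F, rfl⟩ : ∃ F' : Finset α, (F' : Set α) = F := ⟨F.toFinite.toFinset, by simp⟩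
        have hFE : F ⊆ E := Finset.coe_subset.1 (hF.subset_ground.trans hE.ge)
        have hlt : (E \ F).card < E.card := by
          rw [Finset.card_sdiff_of_subset hFE]
          have h1 := Finset.card_pos.2 (Finset.coe_nonempty.1 hne)
          have h2 := Finset.card_le_card hFE
          omega
        rw [Finset.toFinset_coe, klPoly_eq_kl (E := F) rfl, ih _ hlt (E := E \ F)
          (by rw [Finset.coe_sdiff, hE, Matroid.contract_ground]) rfl,
          kl_congr (fun A hA ↦ rkFun_restrict hA) (Finset.empty_subset F) le_rfl,
          ← iq_contract (F := F) le_rfl hFE, Finset.sdiff_self,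
          rank_eq_rkFun (E := F) rfl, rkFun_restrict le_rfl, rkFun_empty, Nat.sub_zero]
      · intro H hH hflat
        rw [iq_rkFun_eq_zero (exists_mem_closure_of_not_isFlat hE hH hflat), mul_zero]
    · rw [iq_rkFun_eq_zero (exists_loop hE hM)]

end RankFunction

/-! ### Valuativity -/

section Valuative

variable {α : Type*} {F G H : Finset α}

/-- Sums of functions of `r : Finset α → ℕ` that only depend on the values of `r` on a chain in the
interval `[F, G]`. -/
inductive IsValuative (F G : Finset α) : ((Finset α → ℕ) → ℤ[X]) → Prop
  | of_chain (c : Set (Finset α)) (hc : IsChain (· ⊆ ·) c) (hFG : c ⊆ Set.Icc F G)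
      (k : (Finset α → ℕ) → ℤ[X]) (hk : DependsOn k c) : IsValuative F G k
  | add (f g : (Finset α → ℕ) → ℤ[X]) : IsValuative F G f → IsValuative F G g →
      IsValuative F G (fun r ↦ f r + g r)

theorem IsValuative.const (p : ℤ[X]) : IsValuative F G (fun _ ↦ p) :=
  .of_chain ∅ (by simp [IsChain]) (Set.empty_subset _) _ (fun _ _ _ ↦ rfl)

theorem IsValuative.sum {ι : Type*} (s : Finset ι) {f : ι → (Finset α → ℕ) → ℤ[X]}
    (hf : ∀ i ∈ s, IsValuative F G (f i)) : IsValuative F G (fun r ↦ ∑ i ∈ s, f i r) := by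
  classical
  induction s using Finset.induction_on with
  | empty => simpa using IsValuative.const 0
  | insert a s ha ih =>
    simp only [Finset.sum_insert ha]
    exact .add _ _ (hf a (Finset.mem_insert_self a s))
      (ih fun i hi ↦ hf i (Finset.mem_insert_of_mem hi))

/-- Chains in `[F, H]` and `[H, G]` combine into a chain in `[F, G]`; this is why the interval is
part of the notion. -/
theorem IsValuative.mul (hFH : F ⊆ H) (hHG : H ⊆ G) {f g : (Finset α → ℕ) → ℤ[X]}
    (hf : IsValuative F H f) (hg : IsValuative H G g) : IsValuative F G (fun r ↦ f r * g r) := by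
  induction hf with
  | add f₁ f₂ _ _ h₁ h₂ =>
    simp only [add_mul]
    exact .add _ _ h₁ h₂
  | of_chain c hc hcFH k hk =>
    induction hg with
    | add g₁ g₂ _ _ h₁ h₂ =>
      simp only [mul_add]
      exact .add _ _ h₁ h₂
    | of_chain c' hc' hcHG k' hk' =>
      refine .of_chain (c ∪ c') ?_ ?_ _ ?_
      · rintro A (hA | hA) B (hB | hB) hne
        · exact hc hA hB hne
        · exact Or.inl ((hcFH hA).2.trans (hcHG hB).1)
        · exact Or.inr ((hcFH hB).2.trans (hcHG hA).1)
        · exact hc' hA hB hne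
      · rintro A (hA | hA)
        · exact ⟨(hcFH hA).1, (hcFH hA).2.trans hHG⟩
        · exact ⟨hFH.trans (hcHG hA).1, (hcHG hA).2⟩
      · intro x y h
        simp only
        rw [hk fun A hA ↦ h A (Or.inl hA), hk' fun A hA ↦ h A (Or.inr hA)]

/-- Operations that depend on `r F` and `r G`, such as truncation at half the rank, are allowed
because the endpoints can be added to any chain in the interval. -/
theorem IsValuative.map (hFG : F ⊆ G) (T : ℕ → ℕ → ℤ[X] →+ ℤ[X]) {f : (Finset α → ℕ) → ℤ[X]}
    (hf : IsValuative F G f) : IsValuative F G (fun r ↦ T (r F) (r G) (f r)) := by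
  induction hf with
  | add f₁ f₂ _ _ h₁ h₂ =>
    simp only [map_add]
    exact .add _ _ h₁ h₂
  | of_chain c hc hcFG k hk =>
    refine .of_chain (insert F (insert G c)) ?_ ?_ _ ?_
    · refine (hc.insert fun A hA _ ↦ Or.inr (hcFG hA).2).insert fun A hA _ ↦ Or.inl ?_
      rcases hA with rfl | hA
      · exact hFG
      · exact (hcFG hA).1
    · rintro A (rfl | rfl | hA)
      · exact ⟨le_rfl, hFG⟩
      · exact ⟨hFG, le_rfl⟩
      · exact hcFG hA
    · intro x y h
      simp only
      rw [hk fun A hA ↦ h A (Or.inr (Or.inr hA)), h F (Or.inl rfl), h G (Or.inr (Or.inl rfl))]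

variable [DecidableEq α]

theorem isValuative_chi : IsValuative F G (fun r ↦ chi r F G) := by
  unfold chi
  refine .sum _ fun A hA ↦ ?_
  rw [Finset.mem_Icc] at hA
  refine .of_chain {A, G} ?_ ?_ _ ?_
  · exact (IsChain.singleton (r := (· ⊆ ·)) (a := G)).insert fun B hB _ ↦ Or.inl
      (Set.mem_singleton_iff.1 hB ▸ hA.2)
  · rintro B (rfl | rfl)
    · exact hA
    · exact ⟨hA.1.trans hA.2, le_rfl⟩
  · intro x y h
    simp only
    rw [h A (Or.inl rfl), h G (Or.inr rfl)]

theorem isValuative_kl (hFG : F ⊆ G) : IsValuative F G (fun r ↦ kl r F G) := by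
  induction hn : (G \ F).card using Nat.strong_induction_on generalizing F with
  | _ n ih =>
    subst hn
    have h1 : IsValuative F G (fun r ↦ ∑ H ∈ Finset.Ioc F G, chi r F H * kl r H G) := by
      refine .sum _ fun H hH ↦ ?_
      have hH' := Finset.mem_Ioc.1 hH
      exact isValuative_chi.mul hH'.1.le hH'.2 (ih _ (card_sdiff_lt_of_mem_Ioc hH) hH'.2 rfl)
    -- The two cases of the definition become two summands, each an additive operator chosen by `r
    -- F` and `r G`.
    have h2 := h1.map hFG (fun m n ↦ if n = m then 0 else -(low (n - m)).toAddMonoidHom)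
    have h3 := (IsValuative.const (F := F) (G := G) (if F = G then 1 else 0)).map hFG
      (fun m n ↦ if n = m then AddMonoidHom.id _ else 0)
    convert IsValuative.add _ _ h3 h2 using 2 with r
    by_cases h : r G = r F
    · simp [h, kl_of_eq h]
    · simp [h, kl_of_ne h]

theorem isValuative_iq (hFG : F ⊆ G) : IsValuative F G (fun r ↦ iq r F G) := by
  induction hn : (G \ F).card using Nat.strong_induction_on generalizing F with
  | _ n ih =>
    subst hn
    have h1 : IsValuative F G
        (fun r ↦ ∑ H ∈ Finset.Ioc F G, (-1) ^ (r H - r F) * kl r F H * iq r H G) := by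
      refine .sum _ fun H hH ↦ ?_
      have hH' := Finset.mem_Ioc.1 hH
      exact ((isValuative_kl hH'.1.le).map hH'.1.le
        (fun m n ↦ AddMonoidHom.mulLeft ((-1) ^ (n - m)))).mul hH'.1.le hH'.2
        (ih _ (card_sdiff_lt_of_mem_Ioc hH) hH'.2 rfl)
    have h2 := h1.map hFG (fun m n ↦ if n = m then 0 else -AddMonoidHom.id _)
    have h3 := (IsValuative.const (F := F) (G := G) (if F = G then 1 else 0)).map hFG
      (fun m n ↦ if n = m then AddMonoidHom.id _ else 0)
    convert IsValuative.add _ _ h3 h2 using 2 with r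
    by_cases h : r G = r F
    · simp [h, iq_of_eq h]
    · simp [h, iq_of_ne h]

/-- The sets that are closed downwards with respect to `t`. -/
def IsInitial (t : α → ℕ) (S : Finset α) : Prop := ∀ x ∈ S, ∀ y, t y ≤ t x → y ∈ S

/-- Order the elements by the number of members of the chain that miss them, and break ties by an
enumeration: this is the order in which the chain picks up the elements. -/
theorem exists_isInitial_of_isChain [Fintype α] {c : Set (Finset α)} (hc : IsChain (· ⊆ ·) c) :
    ∃ t : α → ℕ, Function.Injective t ∧ ∀ S ∈ c, IsInitial t S := by
  classical
  let lev : α → ℕ := fun x ↦ (Finset.univ.filter (fun S ↦ S ∈ c ∧ x ∉ S)).card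
  let idx : α ≃ Fin (Fintype.card α) := Fintype.equivFin α
  refine ⟨fun x ↦ idx x + Fintype.card α * lev x, ?_, ?_⟩
  · intro x y h
    have h1 := congrArg (· % Fintype.card α) h
    simp only [Nat.add_mul_mod_self_left, Nat.mod_eq_of_lt (idx _).2] at h1
    exact idx.injective (Fin.ext h1)
  · intro S hS x hx y hxy
    by_contra hy
    have hlt : lev x < lev y := by
      refine Finset.card_lt_card ((Finset.ssubset_iff_of_subset fun S' hS' ↦ ?_).2 ⟨S, ?_, ?_⟩)
      · simp only [Finset.mem_filter, Finset.mem_univ, true_and] at hS' ⊢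
        refine ⟨hS'.1, fun hyS' ↦ ?_⟩
        rcases hc.total hS hS'.1 with h | h
        · exact hS'.2 (h hx)
        · exact hy (h hyS')
      · simp [hS, hy]
      · simp [hx]
    have h2 : Fintype.card α * (lev x + 1) ≤ Fintype.card α * lev y := Nat.mul_le_mul_left _ hlt
    have h3 := (idx x).2
    simp only at hxy
    rw [mul_add] at h2
    omega

-- A summand that reads `r` on a chain reads it only on initial sets of some total order `t`.
-- Grouping the indices by the restriction of `r i` to these sets makes the summand constant on each
-- group, and the weights of each group cancel by hypothesis.
open Classical in
theorem IsValuative.sum_eq_zero [Fintype α] {ι : Type*} (s : Finset ι) (w : ι → ℤ)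
    (r : ι → Finset α → ℕ)
    (h : ∀ t : α → ℕ, Function.Injective t → ∀ i₀ ∈ s,
      ∑ i ∈ s with (∀ S, IsInitial t S → r i S = r i₀ S), w i = 0)
    {f : (Finset α → ℕ) → ℤ[X]} (hf : IsValuative F G f) : ∑ i ∈ s, w i • f (r i) = 0 := by
  classical
  induction hf with
  | add f₁ f₂ _ _ h₁ h₂ => simp only [smul_add, Finset.sum_add_distrib, h₁, h₂, add_zero]
  | of_chain c hc _ k hk =>
    obtain ⟨t, ht, htc⟩ := exists_isInitial_of_isChain hc
    let res : ι → ({S // IsInitial t S} → ℕ) := fun i S ↦ r i S.1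
    rw [← Finset.sum_fiberwise_of_maps_to (t := s.image res) (g := res)
      (fun i hi ↦ Finset.mem_image_of_mem res hi)]
    refine Finset.sum_eq_zero fun ρ hρ ↦ ?_
    obtain ⟨i₀, hi₀, rfl⟩ := Finset.mem_image.1 hρ
    rw [Finset.sum_congr rfl (g := fun i ↦ w i • k (r i₀)), ← Finset.sum_smul]
    · have h1 := h t ht i₀ hi₀
      rw [Finset.sum_congr (s₂ := s.filter fun i ↦ ∀ S, IsInitial t S → r i S = r i₀ S) _
        (fun _ _ ↦ rfl), h1, zero_smul]
      ext i
      simp only [Finset.mem_filter, and_congr_right_iff]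
      intro _
      simp only [res, funext_iff, Subtype.forall]
    · intro i hi
      rw [hk fun S hS ↦ congrFun (Finset.mem_filter.1 hi).2 ⟨S, htc S hS⟩]

end Valuative

/-! ### Nested matroids of sequences of blocks -/

section Blocks

variable {α I : Type*} [DecidableEq I] (blk : α → I) (b : ℕ)

/-- The number of elements of `S` in the blocks of `T`. -/
def tot (T : Finset I) (S : Finset α) : ℕ := (S.filter (fun x ↦ blk x ∈ T)).card

/-- The rank function of the nested matroid in which, for all `k`, the union of the last `k` blocks
of the list has rank at most `k * b`. -/
def nestedRk : List I → Finset α → ℕ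
  | [], _ => 0
  | i :: L, S => min (tot blk {i} S + nestedRk L S) (b * (L.length + 1))

variable {blk b}

theorem tot_mono {T : Finset I} {S S' : Finset α} (h : S ⊆ S') : tot blk T S ≤ tot blk T S' :=
  Finset.card_le_card (Finset.filter_subset_filter _ h)

theorem tot_union {T T' : Finset I} (h : Disjoint T T') (S : Finset α) :
    tot blk (T ∪ T') S = tot blk T S + tot blk T' S := by
  classical
  rw [tot, tot, tot, ← Finset.card_union_of_disjoint, ← Finset.filter_or]
  · simp only [Finset.mem_union]
  · rw [Finset.disjoint_filter]
    exact fun x _ h1 h2 ↦ Finset.disjoint_left.1 h h1 h2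

@[simp] theorem tot_empty (S : Finset α) : tot blk ∅ S = 0 := by simp [tot]

theorem tot_toFinset_append {Q P : List I} (h : (Q ++ P).Nodup) (S : Finset α) :
    tot blk (Q ++ P).toFinset S = tot blk Q.toFinset S + tot blk P.toFinset S := by
  rw [List.toFinset_append, tot_union]
  exact List.disjoint_toFinset_iff_disjoint.2 (List.disjoint_of_nodup_append h)

theorem tot_toFinset_cons {i : I} {L : List I} (h : (i :: L).Nodup) (S : Finset α) :
    tot blk (i :: L).toFinset S = tot blk {i} S + tot blk L.toFinset S := by
  have := tot_toFinset_append (blk := blk) (Q := [i]) (P := L) h S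
  simpa using this

theorem mul_card_le_tot [Fintype α] (hb : ∀ i, b ≤ tot blk {i} Finset.univ) (T : Finset I) :
    b * T.card ≤ tot blk T (Finset.univ : Finset α) := by
  induction T using Finset.induction_on with
  | empty => simp
  | insert i T hi ih =>
    rw [Finset.insert_eq, tot_union (by simpa using hi), ← Finset.insert_eq,
      Finset.card_insert_of_notMem hi, mul_add]
    have := hb i
    omega

theorem tot_erase [DecidableEq α] {T : Finset I} {S : Finset α} {e : α} (he : e ∈ S) :
    tot blk T S = tot blk T (S.erase e) + if blk e ∈ T then 1 else 0 := by
  rw [tot, tot, Finset.filter_erase]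
  split_ifs with h
  · rw [Finset.card_erase_add_one (Finset.mem_filter.2 ⟨he, h⟩)]
  · rw [Finset.erase_eq_of_notMem (a := e) (fun h' ↦ h (Finset.mem_filter.1 h').2), add_zero]

theorem tot_inter_le_left [DecidableEq α] {T : Finset I} (B S : Finset α) :
    tot blk T (B ∩ S) ≤ tot blk T B := tot_mono Finset.inter_subset_left

theorem tot_inter_le_right [DecidableEq α] {T : Finset I} (B S : Finset α) :
    tot blk T (B ∩ S) ≤ tot blk T S := tot_mono Finset.inter_subset_right

theorem tot_congr {T : Finset I} {S S' : Finset α} (h : ∀ x, blk x ∈ T → (x ∈ S ↔ x ∈ S')) :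
    tot blk T S = tot blk T S' := by
  rw [tot, tot]
  congr 1
  ext x
  simp only [Finset.mem_filter]
  constructor
  · exact fun h1 ↦ ⟨(h x h1.2).1 h1.1, h1.2⟩
  · exact fun h1 ↦ ⟨(h x h1.2).2 h1.1, h1.2⟩

theorem mem_of_tot_inter_eq [DecidableEq α] {T : Finset I} {B S : Finset α}
    (h : tot blk T (B ∩ S) = tot blk T B) {x : α} (hx : x ∈ B) (hxT : blk x ∈ T) : x ∈ S := by
  have h1 := Finset.eq_of_subset_of_card_le
    (Finset.filter_subset_filter (fun x ↦ blk x ∈ T) (Finset.inter_subset_left (s₁ := B) (s₂ := S)))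
    h.ge
  have h2 : x ∈ B.filter (fun x ↦ blk x ∈ T) := Finset.mem_filter.2 ⟨hx, hxT⟩
  rw [← h1] at h2
  exact (Finset.mem_inter.1 (Finset.mem_filter.1 h2).1).2

/-- Unwinding the recursion shows that the rank is the minimum, over all splittings of the list as
`Q ++ P`, of the number of elements in `Q` plus `b * P.length`. This is the upper bound;
`exists_nestedRk_eq` says that it is attained. -/
theorem nestedRk_append_le {Q P : List I} (h : (Q ++ P).Nodup) (S : Finset α) :
    nestedRk blk b (Q ++ P) S ≤ tot blk Q.toFinset S + b * P.length := by
  induction Q with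
  | nil =>
    cases P with
    | nil => simp [nestedRk]
    | cons i P =>
      simp only [List.nil_append, nestedRk, List.length_cons]
      exact (min_le_right _ _).trans (Nat.le_add_left _ _)
  | cons i Q ih =>
    have hn : (Q ++ P).Nodup := (List.nodup_cons.1 h).2
    have hi : (i :: Q).Nodup := h.sublist (by simp)
    rw [List.cons_append, nestedRk, tot_toFinset_cons hi]
    have := ih hn
    exact (min_le_left _ _).trans (by omega)

theorem exists_nestedRk_eq {L : List I} (h : L.Nodup) (S : Finset α) :
    ∃ Q P, L = Q ++ P ∧ nestedRk blk b L S = tot blk Q.toFinset S + b * P.length := by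
  induction L with
  | nil => exact ⟨[], [], by simp [nestedRk]⟩
  | cons i L ih =>
    obtain ⟨Q, P, rfl, hQP⟩ := ih (List.nodup_cons.1 h).2
    rw [nestedRk]
    rcases min_choice (tot blk {i} S + nestedRk blk b (Q ++ P) S) (b * ((Q ++ P).length + 1))
      with h1 | h1
    · refine ⟨i :: Q, P, rfl, ?_⟩
      rw [h1, hQP, tot_toFinset_cons (h.sublist (by simp))]
      omega
    · refine ⟨[], i :: (Q ++ P), rfl, ?_⟩
      rw [h1]
      simp

theorem nestedRk_mono (L : List I) : Monotone (nestedRk blk b L) := fun S S' h ↦ by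
  induction L with
  | nil => rfl
  | cons i L ih => exact min_le_min_right _ (add_le_add (tot_mono h) ih)

theorem nestedRk_congr {L : List I} {S S' : Finset α} (h : ∀ x, blk x ∈ L → (x ∈ S ↔ x ∈ S')) :
    nestedRk blk b L S = nestedRk blk b L S' := by
  induction L with
  | nil => rfl
  | cons i L ih =>
    rw [nestedRk, nestedRk, ih fun x hx ↦ h x (List.mem_cons_of_mem _ hx),
      tot_congr fun x hx ↦ h x (by rw [Finset.mem_singleton.1 hx]; exact List.mem_cons_self)]

variable [DecidableEq α] {t : α → ℕ} {B : Finset α}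

/-- Removing the `t`-largest element of an initial set leaves an initial set, so one can climb the
flag one element at a time. -/
theorem induction_isInitial (ht : Function.Injective t) {p : Finset α → Prop} (h0 : p ∅)
    (h1 : ∀ S e, IsInitial t S → e ∈ S → IsInitial t (S.erase e) → p (S.erase e) → p S)
    (S : Finset α) (hS : IsInitial t S) : p S := by
  induction hn : S.card using Nat.strong_induction_on generalizing S with
  | _ n ih =>
    subst hn
    rcases S.eq_empty_or_nonempty with rfl | hne
    · exact h0
    obtain ⟨e, he, hmax⟩ := Finset.exists_max_image S t hne
    have hi : IsInitial t (S.erase e) := by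
      intro x hx y hxy
      rw [Finset.mem_erase] at hx ⊢
      refine ⟨?_, hS x hx.2 y hxy⟩
      rintro rfl
      exact hx.1 (ht (le_antisymm (hmax x hx.2) hxy))
    exact h1 S e hS he hi (ih _ (Finset.card_erase_lt_of_mem he) _ hi rfl)

theorem tot_le_nestedRk (ht : Function.Injective t) {L : List I}
    (h : ∀ S e, IsInitial t S → e ∈ S → IsInitial t (S.erase e) → e ∈ B → blk e ∈ L →
      nestedRk blk b L (S.erase e) + 1 ≤ nestedRk blk b L S) (S : Finset α) (hS : IsInitial t S) :
    tot blk L.toFinset (B ∩ S) ≤ nestedRk blk b L S := by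
  refine induction_isInitial ht (p := fun S ↦ tot blk L.toFinset (B ∩ S) ≤ nestedRk blk b L S)
    (by simp [tot]) (fun S e hS he hS' ih ↦ ?_) S hS
  by_cases heB : e ∈ B
  · rw [tot_erase (Finset.mem_inter.2 ⟨heB, he⟩), ← Finset.inter_erase]
    split_ifs with hL
    · have := h S e hS he hS' heB (List.mem_toFinset.1 hL)
      omega
    · exact ih.trans (nestedRk_mono L (Finset.erase_subset _ _))
  · rw [← Finset.erase_eq_of_notMem (s := B ∩ S) (a := e) (fun h ↦ heB (Finset.mem_inter.1 h).1),
      ← Finset.inter_erase]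
    exact ih.trans (nestedRk_mono L (Finset.erase_subset _ _))

variable [Fintype α]

/-- Each minimum in the recursion can suppress a jump of the rank but never create one. So whenever
an element of `B` in `P` raises the rank for `Q ++ P`, it also raises the rank for `P`, and the
latter never exceeds `b * P.length`. -/
theorem tot_le_of_suffix (ht : Function.Injective t) {Q P : List I} (hL : (Q ++ P).Nodup)
    (h : ∀ S, IsInitial t S → nestedRk blk b (Q ++ P) S = tot blk (Q ++ P).toFinset (B ∩ S)) :
    tot blk P.toFinset B ≤ b * P.length := by
  have key : ∀ S e, IsInitial t S → e ∈ S → IsInitial t (S.erase e) → e ∈ B → blk e ∈ P →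
      nestedRk blk b P (S.erase e) + 1 ≤ nestedRk blk b P S := by
    intro S e hS he hS' heB heP
    have h1 : nestedRk blk b (Q ++ P) (S.erase e) + 1 ≤ nestedRk blk b (Q ++ P) S := by
      rw [h S hS, h _ hS', Finset.inter_erase, tot_erase (Finset.mem_inter.2 ⟨heB, he⟩), if_pos]
      simp [heP]
    clear h
    induction Q with
    | nil => simpa using h1
    | cons i Q ih =>
      refine ih (List.nodup_cons.1 hL).2 ?_
      have hne : blk e ∉ ({i} : Finset I) := by
        rw [Finset.mem_singleton]
        rintro rfl
        exact (List.nodup_cons.1 hL).1 (by simp [heP])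
      rw [List.cons_append, nestedRk, nestedRk, tot_erase he, if_neg hne] at h1
      omega
  have h2 := tot_le_nestedRk ht key Finset.univ (fun _ _ _ _ ↦ Finset.mem_univ _)
  rw [Finset.inter_univ] at h2
  have hP : P.Nodup := hL.sublist (by simp)
  have h3 := nestedRk_append_le (blk := blk) (b := b) (Q := []) (P := P) hP Finset.univ
  simp only [List.nil_append, List.toFinset_nil, tot_empty, zero_add] at h3
  exact h2.trans h3

variable (blk b t B)

/-- The condition for `B` to be the lexicographically first basis, with respect to `t`, of the
nested matroid of a list. -/
def Valid (L : List I) : Prop :=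
  (∀ P, P <:+ L → tot blk P.toFinset B ≤ b * P.length) ∧ tot blk L.toFinset B = b * L.length ∧
    ∀ y ∉ B, blk y ∈ L → ∃ P, P <:+ L ∧ tot blk P.toFinset B = b * P.length ∧ blk y ∈ P ∧
      ∀ x ∈ B, blk x ∈ P → t x < t y

/-- The condition for `B` to be the lexicographically first basis, with respect to `t`, of the
uniform matroid on the union of the blocks of `T`. -/
def Good (T : Finset I) : Prop :=
  tot blk T B = b * T.card ∧ ∀ x ∈ B, ∀ y ∉ B, blk x ∈ T → blk y ∈ T → t x < t y

variable {blk b t B}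

omit [DecidableEq α] in
theorem isInitial_filter_le (y : α) : IsInitial t (Finset.univ.filter (fun x ↦ t x ≤ t y)) := by
  intro x hx z hz
  simp only [Finset.mem_filter, Finset.mem_univ, true_and] at hx ⊢
  exact hz.trans hx

theorem isInitial_filter_le_erase (ht : Function.Injective t) (y : α) :
    IsInitial t ((Finset.univ.filter (fun x ↦ t x ≤ t y)).erase y) := by
  intro x hx z hz
  simp only [Finset.mem_erase, Finset.mem_filter, Finset.mem_univ, true_and] at hx ⊢
  refine ⟨?_, hz.trans hx.2⟩
  rintro rfl
  exact hx.1 (ht (le_antisymm hx.2 hz))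

/-- The three clauses of `Valid` say that `B` is independent, that it has full rank, and that it is
greedy: each `y ∉ B` is spanned by earlier elements, because it lies in a tight suffix `P` (one with
exactly `b * P.length` elements of `B`) whose elements of `B` all precede `y`. -/
theorem nestedRk_eq_iff_valid (ht : Function.Injective t)
    (hb : ∀ i, b ≤ tot blk {i} (Finset.univ : Finset α)) {L : List I} (hL : L.Nodup) :
    (∀ S, IsInitial t S → nestedRk blk b L S = tot blk L.toFinset (B ∩ S)) ↔
      Valid blk b t B L := by
  constructor
  · intro h
    have h1 : ∀ P, P <:+ L → tot blk P.toFinset B ≤ b * P.length := by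
      rintro P ⟨Q, rfl⟩
      exact tot_le_of_suffix ht hL h
    refine ⟨h1, ?_, ?_⟩
    · refine le_antisymm (h1 L List.suffix_rfl) ?_
      -- Every block has at least `b` elements, so whichever splitting attains the minimum, the rank
      -- of the whole set is at least `b * L.length`.
      have h2 := h Finset.univ (fun _ _ _ _ ↦ Finset.mem_univ _)
      rw [Finset.inter_univ] at h2
      rw [← h2]
      obtain ⟨Q, P, rfl, h3⟩ := exists_nestedRk_eq (blk := blk) (b := b) hL Finset.univ
      rw [h3, List.length_append, mul_add]
      have h4 := mul_card_le_tot hb Q.toFinset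
      rw [List.toFinset_card_of_nodup (hL.sublist (by simp))] at h4
      omega
    · intro y hy hyL
      -- The rank does not jump at `y`, so in a splitting that is minimal for `S` the block of `y`
      -- must lie in `P`. Equality of the counts then forces `P` to be tight and its elements of `B`
      -- to lie in `S`.
      set S := Finset.univ.filter (fun x ↦ t x ≤ t y) with hS
      have hyS : y ∈ S := by simp [hS]
      have e1 := h S (isInitial_filter_le y)
      have e2 := h (S.erase y) (isInitial_filter_le_erase ht y)
      rw [Finset.inter_erase, Finset.erase_eq_of_notMem
        (fun h ↦ hy (Finset.mem_inter.1 h).1), ← e1] at e2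
      obtain ⟨Q, P, rfl, h3⟩ := exists_nestedRk_eq (blk := blk) (b := b) hL S
      have h4 := nestedRk_append_le (b := b) (blk := blk) hL (S.erase y)
      have h5 := tot_erase (blk := blk) (T := Q.toFinset) hyS
      have hyQ : blk y ∉ Q.toFinset := by
        intro hyQ
        rw [if_pos hyQ] at h5
        omega
      have hyP : blk y ∈ P := by
        rcases List.mem_append.1 hyL with h6 | h6
        · exact absurd (List.mem_toFinset.2 h6) hyQ
        · exact h6
      have h6 := h1 P (List.suffix_append _ _)
      have h7 := tot_inter_le_left (blk := blk) (T := P.toFinset) B S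
      have h8 := tot_inter_le_right (blk := blk) (T := Q.toFinset) B S
      rw [tot_toFinset_append hL] at e1
      refine ⟨P, List.suffix_append _ _, by omega, hyP, fun x hx hxP ↦ ?_⟩
      have h9 : x ∈ S := mem_of_tot_inter_eq (by omega) hx (List.mem_toFinset.2 hxP)
      rw [hS, Finset.mem_filter] at h9
      exact lt_of_le_of_ne h9.2 fun h ↦ hy (ht h ▸ hx)
  · rintro ⟨h1, h2, h3⟩ S hS
    apply le_antisymm
    · have hex : ∃ k, tot blk (L.drop k).toFinset B = b * (L.drop k).length ∧
          ∀ x ∈ B, blk x ∈ L.drop k → x ∈ S := ⟨L.length, by simp⟩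
      classical
      obtain ⟨k, hk, hmin⟩ : ∃ k, (tot blk (L.drop k).toFinset B = b * (L.drop k).length ∧
          ∀ x ∈ B, blk x ∈ L.drop k → x ∈ S) ∧ ∀ m, (tot blk (L.drop m).toFinset B =
            b * (L.drop m).length ∧ ∀ x ∈ B, blk x ∈ L.drop m → x ∈ S) → k ≤ m :=
        ⟨Nat.find hex, Nat.find_spec hex, fun m hm ↦ Nat.find_min' hex hm⟩
      have hL' : (L.take k ++ L.drop k).Nodup := by rwa [List.take_append_drop]
      have h4 := nestedRk_append_le (b := b) (blk := blk) hL' S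
      have h5 := tot_toFinset_append (blk := blk) hL' (B ∩ S)
      rw [List.take_append_drop] at h4 h5
      rw [h5]
      refine h4.trans (add_le_add (le_of_eq (tot_congr fun x hx ↦ ?_)) ?_)
      · rw [Finset.mem_inter]
        refine ⟨fun hxS ↦ ⟨?_, hxS⟩, fun h ↦ h.2⟩
        by_contra hxB
        rw [List.mem_toFinset] at hx
        obtain ⟨P, hP, hP1, hxP, hP2⟩ := h3 x hxB (List.mem_of_mem_take hx)
        rw [List.suffix_iff_eq_drop] at hP
        rw [hP] at hP1 hP2 hxP
        have h6 := hmin _ ⟨hP1, fun z hz hzP ↦ hS x hxS z (hP2 z hz hzP).le⟩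
        have h7 : blk x ∈ L.drop k := (List.drop_subset_drop_left L h6) hxP
        exact List.disjoint_of_nodup_append hL' hx h7
      · rw [← hk.1]
        exact (tot_congr fun x hx ↦ by
          rw [Finset.mem_inter]
          exact ⟨fun hxB ↦ ⟨hxB, hk.2 x hxB (List.mem_toFinset.1 hx)⟩, fun h ↦ h.1⟩).le
    · obtain ⟨Q, P, rfl, h4⟩ := exists_nestedRk_eq (blk := blk) (b := b) hL S
      rw [h4, tot_toFinset_append hL]
      exact add_le_add (tot_inter_le_right B S)
        ((tot_inter_le_left B S).trans (h1 P (List.suffix_append _ _)))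

theorem min_tot_eq_iff_good (ht : Function.Injective t)
    (hb : ∀ i, b ≤ tot blk {i} (Finset.univ : Finset α)) {T : Finset I} :
    (∀ S, IsInitial t S → min (tot blk T S) (b * T.card) = tot blk T (B ∩ S)) ↔
      Good blk b t B T := by
  constructor
  · intro h
    have h1 := h Finset.univ (fun _ _ _ _ ↦ Finset.mem_univ _)
    rw [Finset.inter_univ, min_eq_right (mul_card_le_tot hb T)] at h1
    refine ⟨h1.symm, fun x hx y hy hxT hyT ↦ ?_⟩
    set S := Finset.univ.filter (fun x ↦ t x ≤ t y) with hS
    have h2 := h S (isInitial_filter_le y)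
    have h3 : tot blk T (B ∩ S) ≤ tot blk T (S.erase y) := tot_mono fun z hz ↦ by
      rw [Finset.mem_inter] at hz
      exact Finset.mem_erase.2 ⟨fun h ↦ hy (h ▸ hz.1), hz.2⟩
    have h4 := tot_erase (blk := blk) (T := T) (S := S) (e := y) (by simp [hS])
    rw [if_pos hyT] at h4
    have h9 : x ∈ S := mem_of_tot_inter_eq (by omega) hx hxT
    rw [hS, Finset.mem_filter] at h9
    exact lt_of_le_of_ne h9.2 fun h ↦ hy (ht h ▸ hx)
  · rintro ⟨h1, h2⟩ S hS
    by_cases hex : ∃ y ∈ S, y ∉ B ∧ blk y ∈ T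
    · obtain ⟨y, hyS, hyB, hyT⟩ := hex
      have h3 : tot blk T (B ∩ S) = tot blk T B := tot_congr fun x hx ↦ by
        rw [Finset.mem_inter]
        exact ⟨fun h ↦ h.1, fun h ↦ ⟨h, hS y hyS x (h2 x h y hyB hx hyT).le⟩⟩
      have h4 := tot_inter_le_right (blk := blk) (T := T) B S
      omega
    · push Not at hex
      have h3 : tot blk T (B ∩ S) = tot blk T S := tot_congr fun x hx ↦ by
        rw [Finset.mem_inter]
        refine ⟨fun h ↦ h.2, fun h ↦ ⟨?_, h⟩⟩
        by_contra hB
        exact hex x h hB hx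
      have h4 := tot_inter_le_left (blk := blk) (T := T) B S
      omega

/-- An added element affects at most one of the two summands. So, climbing the flag, equality of the
sums forces equality of the summands separately. -/
theorem min_tot_add_nestedRk_eq_iff (ht : Function.Injective t)
    (hb : ∀ i, b ≤ tot blk {i} (Finset.univ : Finset α)) {T : Finset I} {L : List I}
    (hL : L.Nodup) (hd : Disjoint T L.toFinset) :
    (∀ S, IsInitial t S → min (tot blk T S) (b * T.card) + nestedRk blk b L S =
      tot blk (T ∪ L.toFinset) (B ∩ S)) ↔ Good blk b t B T ∧ Valid blk b t B L := by
  rw [← min_tot_eq_iff_good ht hb, ← nestedRk_eq_iff_valid ht hb hL]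
  simp only [tot_union hd]
  constructor
  · intro h
    have key : ∀ S, IsInitial t S → min (tot blk T S) (b * T.card) = tot blk T (B ∩ S) ∧
        nestedRk blk b L S = tot blk L.toFinset (B ∩ S) := by
      refine induction_isInitial ht ?_ fun S e hS he _ ih ↦ ?_
      · have h1 := h ∅ (by simp [IsInitial])
        have h2 : tot blk T ∅ = 0 := by simp [tot]
        have h3 : tot blk L.toFinset ∅ = 0 := by simp [tot]
        rw [Finset.inter_empty, h2, h3, Nat.zero_min] at h1 ⊢
        omega
      · have h1 := h S hS
        by_cases heT : blk e ∈ T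
        · have heL : blk e ∉ L.toFinset := Finset.disjoint_left.1 hd heT
          have h2 : nestedRk blk b L S = nestedRk blk b L (S.erase e) := nestedRk_congr
            fun x hx ↦ by
              rw [Finset.mem_erase, and_iff_right]
              rintro rfl
              exact heL (List.mem_toFinset.2 hx)
          have h3 : tot blk L.toFinset (B ∩ S) = tot blk L.toFinset (B ∩ S.erase e) := tot_congr
            fun x hx ↦ by
              rw [Finset.mem_inter, Finset.mem_inter, Finset.mem_erase, and_iff_right (a := x ≠ e)]
              rintro rfl
              exact heL hx
          omega
        · have h2 : tot blk T S = tot blk T (S.erase e) := tot_congr fun x hx ↦ by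
            rw [Finset.mem_erase, and_iff_right]
            rintro rfl
            exact heT hx
          have h3 : tot blk T (B ∩ S) = tot blk T (B ∩ S.erase e) := tot_congr fun x hx ↦ by
            rw [Finset.mem_inter, Finset.mem_inter, Finset.mem_erase, and_iff_right (a := x ≠ e)]
            rintro rfl
            exact heT hx
          omega
    exact ⟨fun S hS ↦ (key S hS).1, fun S hS ↦ (key S hS).2⟩
  · rintro ⟨h1, h2⟩ S hS
    rw [h1 S hS, h2 S hS]

end Blocks

/-! ### The cycle lemma -/

section Lists

variable {I : Type*} (s : I → ℤ)

/-- All nonempty suffixes have negative weight. -/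
def NegSuffixes (A : List I) : Prop := ∀ C, C <:+ A → C ≠ [] → (C.map s).sum < 0

/-- All prefixes have nonnegative weight. -/
def NonnegPrefixes (D : List I) : Prop := ∀ C, C <+: D → 0 ≤ (C.map s).sum

variable {s}

theorem suffix_cases {C P Q : List I} (h : C <:+ Q ++ P) :
    C <:+ P ∨ ∃ C', C' ≠ [] ∧ C' <:+ Q ∧ C = C' ++ P := by
  obtain ⟨E, hE⟩ := h
  rcases List.append_eq_append_iff.1 hE with ⟨F, rfl, rfl⟩ | ⟨F, rfl, rfl⟩
  · rcases eq_or_ne F [] with rfl | hF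
    · exact Or.inl (by simp)
    · exact Or.inr ⟨F, hF, List.suffix_append _ _, rfl⟩
  · exact Or.inl (List.suffix_append _ _)

/-- Cut `W` where its partial sums first attain their minimum: this value is strictly below all
earlier partial sums and at most all later ones. When an appended letter produces a new strict
minimum, everything moves into `A`. -/
theorem exists_negSuffixes_append_nonnegPrefixes (W : List I) :
    ∃ A D, W = A ++ D ∧ NegSuffixes s A ∧ NonnegPrefixes s D := by
  induction W using List.reverseRecOn with
  | nil => exact ⟨[], [], rfl, by simp [NegSuffixes], by simp [NonnegPrefixes]⟩
  | append_singleton W x ih =>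
    obtain ⟨A, D, rfl, hA, hD⟩ := ih
    by_cases hx : 0 ≤ ((D ++ [x]).map s).sum
    · refine ⟨A, D ++ [x], by simp, hA, fun C hC ↦ ?_⟩
      rcases List.prefix_concat_iff.1 hC with rfl | hC
      · exact hx
      · exact hD C hC
    · refine ⟨A ++ D ++ [x], [], by simp, fun C hC hne ↦ ?_, by simp [NonnegPrefixes]⟩
      have hDx : ∀ C, C <:+ D ++ [x] → C ≠ [] → (C.map s).sum < 0 := by
        rintro C ⟨E, hE⟩ hne
        have hED : E <+: D := by
          rcases List.prefix_concat_iff.1 (⟨C, hE⟩ : E <+: D ++ [x]) with rfl | h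
          · exact absurd (List.append_right_eq_self.1 hE) hne
          · exact h
        have h1 := hD E hED
        rw [← hE, List.map_append, List.sum_append] at hx
        omega
      rw [List.append_assoc] at hC
      rcases suffix_cases hC with hC | ⟨C, hC', hCA, rfl⟩
      · exact hDx C hC hne
      · have h1 := hA C hCA hC'
        rw [List.map_append, List.sum_append]
        omega

theorem negSuffixes_append_nonnegPrefixes_unique {A D A' D' : List I} (h : A ++ D = A' ++ D')
    (hA : NegSuffixes s A) (hD : NonnegPrefixes s D) (hA' : NegSuffixes s A')
    (hD' : NonnegPrefixes s D') : A = A' ∧ D = D' := by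
  rcases List.append_eq_append_iff.1 h with ⟨C, rfl, rfl⟩ | ⟨C, rfl, rfl⟩
  · rcases eq_or_ne C [] with rfl | hC
    · simp
    · have h1 := hA' C (List.suffix_append _ _) hC
      have h2 := hD C (List.prefix_append _ _)
      omega
  · rcases eq_or_ne C [] with rfl | hC
    · simp
    · have h1 := hA C (List.suffix_append _ _) hC
      have h2 := hD' C (List.prefix_append _ _)
      omega

/-- `L` is the longest suffix of weight zero; as no suffix has positive weight, the longer ones are
strictly negative. -/
theorem exists_negSuffixes_append_sum_eq_zero (R : List I)
    (hR : ∀ P, P <:+ R → (P.map s).sum ≤ 0) :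
    ∃ A L, R = A ++ L ∧ (L.map s).sum = 0 ∧ NegSuffixes s A := by
  induction R with
  | nil => exact ⟨[], [], rfl, rfl, by simp [NegSuffixes]⟩
  | cons x R ih =>
    obtain ⟨A, L, rfl, hL, hA⟩ := ih fun P hP ↦ hR P (hP.trans (List.suffix_cons _ _))
    by_cases h0 : ((x :: (A ++ L)).map s).sum = 0
    · exact ⟨[], x :: (A ++ L), rfl, h0, by simp [NegSuffixes]⟩
    · refine ⟨x :: A, L, rfl, hL, fun C hC hne ↦ ?_⟩
      rcases List.suffix_cons_iff.1 hC with rfl | hC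
      · have h1 := lt_of_le_of_ne (hR _ List.suffix_rfl) h0
        rw [← List.cons_append, List.map_append, List.sum_append, hL, add_zero] at h1
        exact h1
      · exact hA C hC hne

theorem negSuffixes_append_sum_eq_zero_unique {A L A' L' : List I} (h : A ++ L = A' ++ L')
    (hA : NegSuffixes s A) (hL : (L.map s).sum = 0) (hA' : NegSuffixes s A')
    (hL' : (L'.map s).sum = 0) : A = A' ∧ L = L' := by
  rcases List.append_eq_append_iff.1 h with ⟨C, rfl, rfl⟩ | ⟨C, rfl, rfl⟩
  · rcases eq_or_ne C [] with rfl | hC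
    · simp
    · have h1 := hA' C (List.suffix_append _ _) hC
      rw [List.map_append, List.sum_append] at hL
      omega
  · rcases eq_or_ne C [] with rfl | hC
    · simp
    · have h1 := hA C (List.suffix_append _ _) hC
      rw [List.map_append, List.sum_append] at hL'
      omega

end Lists

/-! ### Valid orders in terms of block excesses -/

section Validity

variable {α I : Type*} [DecidableEq I] {blk : α → I} {b : ℕ} {t : α → ℕ} {B : Finset α}

variable (blk b B) in
/-- The excess of the number of elements of `B` in a block. -/
def excess (i : I) : ℤ := tot blk {i} B - b

theorem sum_excess {P : List I} (hP : P.Nodup) :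
    (P.map (excess blk b B)).sum = (tot blk P.toFinset B : ℤ) - b * P.length := by
  induction P with
  | nil => simp
  | cons i P ih =>
    rw [List.map_cons, List.sum_cons, ih (List.nodup_cons.1 hP).2, tot_toFinset_cons hP, excess,
      List.length_cons]
    push_cast
    ring

theorem valid_iff_excess {L : List I} (hL : L.Nodup) : Valid blk b t B L ↔
    (∀ P, P <:+ L → (P.map (excess blk b B)).sum ≤ 0) ∧ (L.map (excess blk b B)).sum = 0 ∧
    ∀ y ∉ B, blk y ∈ L → ∃ P, P <:+ L ∧ (P.map (excess blk b B)).sum = 0 ∧ blk y ∈ P ∧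
      ∀ x ∈ B, blk x ∈ P → t x < t y := by
  have h1 : ∀ P, P <:+ L → ((P.map (excess blk b B)).sum ≤ 0 ↔
      tot blk P.toFinset B ≤ b * P.length) := fun P hP ↦ by
    rw [sum_excess (hL.sublist hP.sublist)]
    zify
    constructor <;> intro h <;> linarith
  have h2 : ∀ P, P <:+ L → ((P.map (excess blk b B)).sum = 0 ↔
      tot blk P.toFinset B = b * P.length) := fun P hP ↦ by
    rw [sum_excess (hL.sublist hP.sublist)]
    zify
    constructor <;> intro h <;> linarith
  rw [Valid, ← h2 L List.suffix_rfl]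
  refine and_congr (forall₂_congr fun P hP ↦ (h1 P hP).symm) (and_congr Iff.rfl
    (forall₃_congr fun y hy hyL ↦ exists_congr fun P ↦ and_congr_right fun hP ↦ ?_))
  rw [h2 P hP]

theorem good_iff_excess {P : List I} (hP : P.Nodup) : Good blk b t B P.toFinset ↔
    (P.map (excess blk b B)).sum = 0 ∧
      ∀ x ∈ B, ∀ y ∉ B, blk x ∈ P → blk y ∈ P → t x < t y := by
  rw [Good, sum_excess hP, List.toFinset_card_of_nodup hP]
  simp only [List.mem_toFinset]
  refine and_congr_left fun _ ↦ ?_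
  zify
  constructor <;> intro h <;> linarith

/-- As `L` has weight zero and `A` has negative suffixes, a tight suffix that is not contained in
`L` reaches back at least to the block of `e`. So an element `y ∉ B` outside `L` has to come after
`e`, the last element of `B`, which is the order condition in `Good`; conversely the whole list then
serves as its tight suffix. As the total weight is zero, a suffix that starts after a prefix `C` of
`D` has the opposite weight of `C`, so the suffix bounds there say that prefixes of `D` are
nonnegative. -/
theorem valid_append_iff {D A L : List I} {e : α} (hn : (D ++ blk e :: (A ++ L)).Nodup)
    (he : e ∈ B) (hmax : ∀ x ∈ B, blk x ∈ D ++ blk e :: (A ++ L) → t x ≤ t e)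
    (hA : NegSuffixes (excess blk b B) A) :
    Valid blk b t B (D ++ blk e :: (A ++ L)) ∧ (L.map (excess blk b B)).sum = 0 ↔
      Valid blk b t B L ∧ Good blk b t B (blk e :: (A ++ D)).toFinset ∧
        NonnegPrefixes (excess blk b B) D := by
  have hn' : (blk e :: (A ++ D) ++ L).Nodup := by
    refine List.Perm.nodup (l := D ++ blk e :: A ++ L) ?_ (by simpa using hn)
    exact List.perm_append_comm.append_right L
  have hL : L.Nodup := hn'.sublist (List.sublist_append_right _ _)
  have hT : (blk e :: (A ++ D)).Nodup := hn'.sublist (List.sublist_append_left _ _)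
  rw [valid_iff_excess hn, valid_iff_excess hL, good_iff_excess hT]
  constructor
  · rintro ⟨⟨h1, h2, h3⟩, h4⟩
    have hLs : L <:+ D ++ blk e :: (A ++ L) := ⟨D ++ blk e :: A, by simp⟩
    have h5 : ((blk e :: (A ++ D)).map (excess blk b B)).sum = 0 := by
      simp only [List.map_append, List.map_cons, List.sum_append, List.sum_cons] at h2 ⊢
      linarith
    refine ⟨⟨fun P hP ↦ h1 P (hP.trans hLs), h4, fun y hy hyL ↦ ?_⟩, ⟨h5, ?_⟩, ?_⟩
    · obtain ⟨P, hP, hP1, hyP, hP2⟩ := h3 y hy (hLs.subset hyL)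
      rw [show D ++ blk e :: (A ++ L) = (D ++ blk e :: A) ++ L by simp] at hP
      rcases suffix_cases hP with hP | ⟨C, -, -, rfl⟩
      · exact ⟨P, hP, hP1, hyP, hP2⟩
      · exact ⟨L, List.suffix_rfl, h4, hyL, fun x hx hxL ↦ hP2 x hx (by simp [hxL])⟩
    · intro x hx y hy hxT hyT
      have hyL : blk y ∉ L := fun h ↦ List.disjoint_of_nodup_append hn' hyT h
      obtain ⟨P, hP, hP1, hyP, hP2⟩ := h3 y hy (by
        simp only [List.mem_cons, List.mem_append] at hyT ⊢
        tauto)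
      have heP : blk e ∈ P := by
        rw [show D ++ blk e :: (A ++ L) = (D ++ [blk e]) ++ (A ++ L) by simp] at hP
        rcases suffix_cases hP with hP | ⟨C, hC, hC', rfl⟩
        · rcases suffix_cases hP with hP | ⟨C, hC, hC', rfl⟩
          · exact absurd (hP.subset hyP) hyL
          · have := hA C hC' hC
            rw [List.map_append, List.sum_append] at hP1
            omega
        · obtain ⟨E, hE⟩ := hC'
          rcases List.eq_nil_or_concat C with rfl | ⟨C, z, rfl⟩
          · exact absurd rfl hC
          · rw [List.concat_eq_append, ← List.append_assoc] at hE
            have := (List.append_inj' hE rfl).2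
            simp_all
      refine (hmax x hx ?_).trans_lt (hP2 e he heP)
      simp only [List.mem_cons, List.mem_append] at hxT ⊢
      tauto
    · rintro C ⟨E, rfl⟩
      have h6 := h1 (E ++ blk e :: (A ++ L)) ⟨C, by simp⟩
      simp only [List.map_append, List.map_cons, List.sum_append, List.sum_cons] at h5 h6
      linarith
  · rintro ⟨⟨h1, h2, h3⟩, ⟨h4, h5⟩, h6⟩
    have h7 : ((D ++ blk e :: (A ++ L)).map (excess blk b B)).sum = 0 := by
      simp only [List.map_append, List.map_cons, List.sum_append, List.sum_cons] at h4 ⊢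
      linarith
    refine ⟨⟨fun P hP ↦ ?_, h7, fun y hy hyL ↦ ?_⟩, h2⟩
    · rw [show D ++ blk e :: (A ++ L) = (D ++ [blk e]) ++ (A ++ L) by simp] at hP
      rcases suffix_cases hP with hP | ⟨C, hC, hC', rfl⟩
      · rcases suffix_cases hP with hP | ⟨C, hC, hC', rfl⟩
        · exact h1 P hP
        · have := hA C hC' hC
          rw [List.map_append, List.sum_append]
          omega
      · obtain ⟨E, hE⟩ := hC'
        rcases List.eq_nil_or_concat C with rfl | ⟨C, z, rfl⟩
        · exact absurd rfl hC
        · rw [List.concat_eq_append, ← List.append_assoc] at hE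
          obtain ⟨rfl, hz⟩ := List.append_inj' hE rfl
          have h8 := h6 E (List.prefix_append _ _)
          rw [List.cons.injEq] at hz
          rw [hz.1]
          simp only [List.map_append, List.map_cons, List.sum_append, List.sum_cons,
            List.concat_eq_append, List.map_nil, List.sum_nil] at h7 ⊢
          linarith
    · by_cases hyL' : blk y ∈ L
      · obtain ⟨P, hP, hP1⟩ := h3 y hy hyL'
        exact ⟨P, hP.trans ⟨D ++ blk e :: A, by simp⟩, hP1⟩
      · refine ⟨_, List.suffix_rfl, h7, hyL, fun x hx hxL ↦ ?_⟩
        refine (hmax x hx hxL).trans_lt (h5 e he y hy (by simp) ?_)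
        simp only [List.mem_cons, List.mem_append] at hyL ⊢
        tauto

end Validity

/-! ### Counting valid orders of blocks -/

section Orders

variable {I : Type*} [DecidableEq I]

/-- The linear orders of a finite set, as lists. -/
def orders (T : Finset I) : Finset (List I) := T.toList.permutations.toFinset

theorem mem_orders {T : Finset I} {L : List I} : L ∈ orders T ↔ L.Nodup ∧ L.toFinset = T := by
  rw [orders, List.mem_toFinset, List.mem_permutations]
  constructor
  · intro h
    exact ⟨h.nodup_iff.2 T.nodup_toList, by rw [List.toFinset_eq_of_perm _ _ h, T.toList_toFinset]⟩
  · rintro ⟨h, rfl⟩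
    exact (List.toFinset_toList h).symm

theorem card_orders (T : Finset I) : (orders T).card = T.card.factorial := by
  rw [orders, List.toFinset_card_of_nodup (List.nodup_permutations _ T.nodup_toList),
    List.length_permutations, Finset.length_toList]

end Orders

section Count

variable {α I : Type*} [DecidableEq I] (blk : α → I) (b : ℕ) (t : α → ℕ) (B : Finset α)

open Classical in
/-- The number of valid orders of the blocks in `T`. -/
def validCount (T : Finset I) : ℕ := ((orders T).filter (Valid blk b t B)).card

open Classical in
/-- The number of cyclic orders of the blocks in `T` if `T` is good, and zero otherwise. -/
def goodCount (T : Finset I) : ℕ := if Good blk b t B T then (T.card - 1).factorial else 0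

variable {blk b t B}

-- Bijection between valid orders of `U` and triples `(T, W, L)`: a good set `T` containing the
-- block of `e`, an arbitrary order `W` of the other blocks of `T`, and a valid order `L` of `U \
-- T`. The valid order is `D W ++ blk e :: (A W ++ L)`. Since `W` is arbitrary, each good `T` occurs
-- with the factor `(|T| - 1)!`.
open Classical in
theorem validCount_eq_sum_of_max {U : Finset I} {e : α} (he : e ∈ B) (heU : blk e ∈ U)
    (hmax : ∀ x ∈ B, blk x ∈ U → t x ≤ t e) :
    validCount blk b t B U =
      ∑ T ∈ U.powerset with blk e ∈ T, goodCount blk b t B T * validCount blk b t B (U \ T) := by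
  -- The cycle lemma cuts every word `W` canonically as `A W ++ D W`; moving `D W` to the front is
  -- the unique admissible rotation.
  choose A D hW hA hD using exists_negSuffixes_append_nonnegPrefixes (s := excess blk b B)
  have hmax' : ∀ L ∈ orders U, ∀ x ∈ B, blk x ∈ L → t x ≤ t e := fun L hL x hx hxL ↦
    hmax x hx (by rw [← (mem_orders.1 hL).2]; exact List.mem_toFinset.2 hxL)
  have hsum : ∑ T ∈ U.powerset with blk e ∈ T, goodCount blk b t B T * validCount blk b t B (U \ T)
      = (((U.powerset.filter fun T ↦ blk e ∈ T).filter (Good blk b t B)).sigma fun T ↦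
        orders (T.erase (blk e)) ×ˢ (orders (U \ T)).filter (Valid blk b t B)).card := by
    rw [Finset.card_sigma, Finset.sum_filter (Good blk b t B)]
    refine Finset.sum_congr rfl fun T hT ↦ ?_
    rw [goodCount]
    split_ifs
    · rw [Finset.card_product, card_orders, Finset.card_erase_of_mem (Finset.mem_filter.1 hT).2,
        validCount]
    · rw [zero_mul]
  have key : ∀ T ⊆ U, blk e ∈ T → ∀ W ∈ orders (T.erase (blk e)), ∀ L ∈ orders (U \ T),
      D W ++ blk e :: (A W ++ L) ∈ orders U ∧ (blk e :: (A W ++ D W)).toFinset = T := by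
    intro T hTU heT W hWT L hLT
    rw [mem_orders] at hWT hLT
    have h1 : (blk e :: W).toFinset = T := by
      rw [List.toFinset_cons, hWT.2, Finset.insert_erase heT]
    have hp : List.Perm (D W ++ blk e :: (A W ++ L)) (blk e :: W ++ L) := by
      rw [show D W ++ blk e :: (A W ++ L) = (D W ++ blk e :: A W) ++ L by simp]
      refine List.Perm.append_right L ?_
      conv_rhs => rw [hW W]
      exact List.perm_append_comm
    refine ⟨mem_orders.2 ⟨hp.nodup_iff.2 ?_, ?_⟩, ?_⟩
    · refine List.nodup_append'.2 ⟨List.nodup_cons.2 ⟨?_, hWT.1⟩, hLT.1, ?_⟩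
      · rw [← List.mem_toFinset, hWT.2]
        simp
      · rw [← List.disjoint_toFinset_iff_disjoint, h1, hLT.2]
        exact Finset.disjoint_sdiff
    · rw [List.toFinset_eq_of_perm _ _ hp, List.toFinset_append, h1, hLT.2,
        Finset.union_sdiff_of_subset hTU]
    · rw [← hW W, h1]
  rw [hsum, validCount]
  symm
  refine Finset.card_nbij (fun p ↦ D p.2.1 ++ blk e :: (A p.2.1 ++ p.2.2)) ?_ ?_ ?_
  · rintro ⟨T, W, L⟩ hp
    simp only [Finset.coe_sigma, Set.mem_sigma_iff, Finset.mem_coe, Finset.mem_filter,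
      Finset.mem_powerset, Finset.mem_product] at hp ⊢
    obtain ⟨⟨⟨hTU, heT⟩, hgood⟩, hWT, hLT, hL⟩ := hp
    obtain ⟨h1, h2⟩ := key T hTU heT W hWT L hLT
    refine ⟨h1, ((valid_append_iff (mem_orders.1 h1).1 he (hmax' _ h1) (hA W)).2
      ⟨hL, ?_, hD W⟩).1⟩
    rwa [h2]
  · rintro ⟨T, W, L⟩ hp ⟨T', W', L'⟩ hp' heq
    simp only [Finset.coe_sigma, Set.mem_sigma_iff, Finset.mem_coe, Finset.mem_filter,
      Finset.mem_powerset, Finset.mem_product] at hp hp' heq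
    obtain ⟨⟨⟨hTU, heT⟩, hgood⟩, hWT, hLT, hL⟩ := hp
    obtain ⟨⟨⟨hTU', heT'⟩, hgood'⟩, hWT', hLT', hL'⟩ := hp'
    obtain ⟨h1, h2⟩ := key T hTU heT W hWT L hLT
    obtain ⟨h1', h2'⟩ := key T' hTU' heT' W' hWT' L' hLT'
    have hn := List.nodup_middle.1 (mem_orders.1 h1).1
    rw [List.nodup_cons, List.mem_append, not_or] at hn
    have hDD := (List.append_cons_inj_of_notMem hn.1.1 hn.1.2).1 heq
    have hAA := negSuffixes_append_sum_eq_zero_unique hDD.2.2 (hA W)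
      ((valid_iff_excess (mem_orders.1 hLT).1).1 hL).2.1 (hA W')
      ((valid_iff_excess (mem_orders.1 hLT').1).1 hL').2.1
    have hWW : W = W' := by rw [hW W, hW W', hAA.1, hDD.1]
    have hTT : T = T' := by rw [← h2, ← h2', hAA.1, hDD.1]
    rw [hWW, hTT, hAA.2]
  · intro L₀ hL₀
    simp only [Finset.coe_filter, Set.mem_ofPred_eq] at hL₀
    obtain ⟨hL₀, hvalid⟩ := hL₀
    have hL₀' := mem_orders.1 hL₀
    obtain ⟨D', R, rfl⟩ := List.append_of_mem (List.mem_toFinset.1 (hL₀'.2.symm ▸ heU))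
    obtain ⟨A', L, rfl, hL0, hA'⟩ := exists_negSuffixes_append_sum_eq_zero (s := excess blk b B) R
      fun P hP ↦ ((valid_iff_excess hL₀'.1).1 hvalid).1 P
        (hP.trans ((List.suffix_cons _ _).trans (List.suffix_append _ _)))
    obtain ⟨hL, hgood, hD'⟩ :=
      (valid_append_iff hL₀'.1 he (hmax' _ hL₀) hA').1 ⟨hvalid, hL0⟩
    obtain ⟨h1, h2⟩ := negSuffixes_append_nonnegPrefixes_unique (hW (A' ++ D')) hA' hD'
      (hA _) (hD _)
    have hn' : (blk e :: (A' ++ D') ++ L).Nodup := by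
      refine List.Perm.nodup (l := D' ++ blk e :: A' ++ L) ?_ (by simpa using hL₀'.1)
      exact List.perm_append_comm.append_right L
    have hU : U = (blk e :: (A' ++ D')).toFinset ∪ L.toFinset := by
      rw [← hL₀'.2]
      ext x
      simp only [List.mem_toFinset, Finset.mem_union, List.mem_append, List.mem_cons]
      tauto
    refine ⟨⟨(blk e :: (A' ++ D')).toFinset, A' ++ D', L⟩, ?_, ?_⟩
    · simp only [Finset.coe_sigma, Set.mem_sigma_iff, Finset.mem_coe, Finset.mem_filter,
        Finset.mem_powerset, Finset.mem_product, mem_orders]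
      have hn1 := List.nodup_append'.1 hn'
      have hn2 := List.nodup_cons.1 hn1.1
      refine ⟨⟨⟨?_, by simp⟩, hgood⟩, ⟨hn2.2, ?_⟩, ⟨hn1.2.1, ?_⟩, hL⟩
      · rw [hU]
        exact Finset.subset_union_left
      · rw [List.toFinset_cons, Finset.erase_insert]
        rw [List.mem_toFinset]
        exact hn2.1
      · rw [hU, Finset.union_sdiff_cancel_left]
        exact List.disjoint_toFinset_iff_disjoint.2 hn1.2.2
    · simp only
      rw [← h1, ← h2]

/-- Expand at `i`, and in the terms with `x ∉ T` expand `f (U \ T)` once more at `x`, which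
induction permits. The result is a sum over sets containing both elements plus a sum over disjoint
pairs of sets, one containing `i` and the other `x`. This is symmetric in `i` and `x`. -/
theorem sum_mem_eq_of_exists {f g : Finset I → ℕ}
    (h : ∀ U : Finset I, U.Nonempty → ∃ i ∈ U,
      f U = ∑ T ∈ U.powerset with i ∈ T, g T * f (U \ T)) (U : Finset I) :
    ∀ x ∈ U, f U = ∑ T ∈ U.powerset with x ∈ T, g T * f (U \ T) := by
  induction hn : U.card using Nat.strong_induction_on generalizing U with
  | _ n ih =>
    subst hn
    intro x hx
    obtain ⟨i, hi, hU⟩ := h U ⟨x, hx⟩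
    rw [hU]
    have key : ∀ x ∈ U, ∀ y ∈ U, ∑ T ∈ U.powerset with x ∈ T, g T * f (U \ T) =
        ∑ T ∈ U.powerset with x ∈ T ∧ y ∈ T, g T * f (U \ T) +
        ∑ p ∈ U.powerset ×ˢ U.powerset with x ∈ p.1 ∧ y ∈ p.2 ∧ Disjoint p.1 p.2,
          g p.1 * g p.2 * f (U \ (p.1 ∪ p.2)) := by
      intro x hx y hy
      rw [← Finset.sum_filter_add_sum_filter_not _ (fun T ↦ y ∈ T), Finset.filter_filter,
        Finset.filter_filter]
      congr 1
      rw [Finset.sum_filter, Finset.sum_filter, Finset.sum_product]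
      refine Finset.sum_congr rfl fun T hT ↦ ?_
      rw [Finset.mem_powerset] at hT
      split_ifs with hxy
      · rw [ih (U \ T).card (Finset.card_lt_card (Finset.sdiff_ssubset hT ⟨x, hxy.1⟩)) _ rfl y
          (Finset.mem_sdiff.2 ⟨hy, hxy.2⟩), Finset.mul_sum, ← Finset.sum_filter]
        refine Finset.sum_congr ?_ fun T' _ ↦ ?_
        · ext T'
          simp only [Finset.mem_filter, Finset.mem_powerset, Finset.subset_sdiff]
          constructor
          · exact fun h ↦ ⟨h.1.1, hxy.1, h.2, h.1.2.symm⟩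
          · exact fun h ↦ ⟨⟨h.1, h.2.2.2.symm⟩, h.2.2.1⟩
        · rw [mul_assoc, sdiff_sdiff_left, Finset.sup_eq_union]
      · symm
        refine Finset.sum_eq_zero fun T' _ ↦ if_neg ?_
        rintro ⟨h1, h2, h3⟩
        exact hxy ⟨h1, fun h ↦ Finset.disjoint_left.1 h3 h h2⟩
    rw [key i hi x hx, key x hx i hi]
    congr 1
    · simp only [and_comm]
    · refine Finset.sum_nbij' Prod.swap Prod.swap ?_ ?_ (by simp) (by simp) ?_
      · intro p hp
        simp only [Finset.mem_filter, Finset.mem_product, Prod.fst_swap, Prod.snd_swap] at hp ⊢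
        exact ⟨hp.1.symm, hp.2.2.1, hp.2.1, hp.2.2.2.symm⟩
      · intro p hp
        simp only [Finset.mem_filter, Finset.mem_product, Prod.fst_swap, Prod.snd_swap] at hp ⊢
        exact ⟨hp.1.symm, hp.2.2.1, hp.2.1, hp.2.2.2.symm⟩
      · intro p _
        rw [Prod.fst_swap, Prod.snd_swap, mul_comm (g p.1), Finset.union_comm]

theorem card_mul_eq_sum_of_exists {f g : Finset I → ℕ}
    (h : ∀ U : Finset I, U.Nonempty → ∃ i ∈ U,
      f U = ∑ T ∈ U.powerset with i ∈ T, g T * f (U \ T)) (U : Finset I) :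
    U.card * f U = ∑ T ∈ U.powerset, T.card * g T * f (U \ T) := by
  calc U.card * f U = ∑ x ∈ U, f U := by rw [Finset.sum_const, smul_eq_mul]
    _ = ∑ x ∈ U, ∑ T ∈ U.powerset, if x ∈ T then g T * f (U \ T) else 0 :=
      Finset.sum_congr rfl fun x hx ↦ by
        rw [sum_mem_eq_of_exists h U x hx, Finset.sum_filter]
    _ = _ := by
      rw [Finset.sum_comm]
      refine Finset.sum_congr rfl fun T hT ↦ ?_
      rw [Finset.mem_powerset] at hT
      rw [← Finset.sum_filter, Finset.sum_const, smul_eq_mul, mul_assoc,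
        Finset.filter_mem_eq_inter, Finset.inter_eq_right.2 hT]

theorem card_mul_validCount (hb : 1 ≤ b) (U : Finset I) :
    U.card * validCount blk b t B U =
      ∑ T ∈ U.powerset, T.card * goodCount blk b t B T * validCount blk b t B (U \ T) := by
  classical
  refine card_mul_eq_sum_of_exists (fun U hU ↦ ?_) U
  by_cases h : ∃ e ∈ B, blk e ∈ U
  · have hne : (B.filter fun x ↦ blk x ∈ U).Nonempty := by
      obtain ⟨e, he, heU⟩ := h
      exact ⟨e, Finset.mem_filter.2 ⟨he, heU⟩⟩
    obtain ⟨e, he, hmax⟩ := Finset.exists_max_image _ t hne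
    rw [Finset.mem_filter] at he
    exact ⟨blk e, he.2, validCount_eq_sum_of_max he.1 he.2
      fun x hx hxU ↦ hmax x (Finset.mem_filter.2 ⟨hx, hxU⟩)⟩
  -- If no element of `B` lies in the blocks of `U`, then no order of `U` is valid and no nonempty
  -- subset is good, since both would need a positive multiple of `b` elements of `B`.
  · push Not at h
    obtain ⟨i, hi⟩ := hU
    have h0 : ∀ T ⊆ U, tot blk T B = 0 := fun T hT ↦ by
      rw [tot, Finset.card_eq_zero, Finset.filter_eq_empty_iff]
      exact fun x hx hxT ↦ h x hx (hT hxT)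
    refine ⟨i, hi, ?_⟩
    rw [Finset.sum_eq_zero, validCount, Finset.card_eq_zero, Finset.filter_eq_empty_iff]
    · rintro L hL ⟨-, h1, -⟩
      rw [mem_orders] at hL
      rw [hL.2, h0 U le_rfl, eq_comm, mul_eq_zero, ← List.toFinset_card_of_nodup hL.1, hL.2,
        Finset.card_eq_zero] at h1
      rcases h1 with h1 | h1
      · omega
      · simp [h1] at hi
    · intro T hT
      rw [Finset.mem_filter, Finset.mem_powerset] at hT
      rw [goodCount, if_neg, zero_mul]
      rintro ⟨h1, -⟩
      rw [h0 T hT.1, eq_comm, mul_eq_zero, Finset.card_eq_zero] at h1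
      rcases h1 with h1 | h1
      · omega
      · simp [h1] at hT

end Count

/-! ### The linear relation between nested and uniform matroids -/

section Relation

variable {α I : Type*} [DecidableEq I] {blk : α → I} {b : ℕ}

/-- The rank function of the direct sum of the uniform matroid on the blocks of `T` and the nested
matroid of a list. -/
def sumRk (blk : α → I) (b : ℕ) (T : Finset I) (L : List I) (S : Finset α) : ℕ :=
  min (tot blk T S) (b * T.card) + nestedRk blk b L S

theorem nestedRk_empty {L : List I} (hL : L.Nodup) : nestedRk blk b L ∅ = 0 := by
  have h := nestedRk_append_le (blk := blk) (b := b) (Q := L) (P := []) (by simpa) ∅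
  simpa [tot] using h

variable [DecidableEq α]

theorem nestedRk_le_nestedRk_erase {L : List I} (hL : L.Nodup) {S : Finset α} {e : α}
    (he : e ∈ S) :
    nestedRk blk b L S ≤ nestedRk blk b L (S.erase e) + if blk e ∈ L then 1 else 0 := by
  obtain ⟨Q, P, rfl, h⟩ := exists_nestedRk_eq (blk := blk) (b := b) hL (S.erase e)
  have h1 := nestedRk_append_le (blk := blk) (b := b) hL S
  have h2 := tot_erase (blk := blk) (T := Q.toFinset) he
  have h3 : blk e ∈ Q.toFinset → blk e ∈ Q ++ P := fun h ↦
    List.mem_append_left _ (List.mem_toFinset.1 h)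
  by_cases h4 : blk e ∈ Q.toFinset
  · rw [if_pos h4] at h2
    rw [if_pos (h3 h4)]
    omega
  · rw [if_neg h4] at h2
    omega

theorem sumRk_le_sumRk_erase {T : Finset I} {L : List I} (hL : L.Nodup)
    (hd : Disjoint T L.toFinset) {S : Finset α} {e : α} (he : e ∈ S) :
    sumRk blk b T L S ≤ sumRk blk b T L (S.erase e) + 1 := by
  have h1 := nestedRk_le_nestedRk_erase (blk := blk) (b := b) hL he
  have h2 := tot_erase (blk := blk) (T := T) he
  have h3 : blk e ∈ T → blk e ∉ L := fun h h' ↦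
    Finset.disjoint_left.1 hd h (List.mem_toFinset.2 h')
  rw [sumRk, sumRk]
  split_ifs at h1 h2 with h4 h5
  · exact absurd h4 (h3 h5)
  all_goals omega

/-- `B` is the greedy basis: it consists of the elements at which the rank jumps along the flag, and
each jump is by one. -/
theorem exists_card_inter_eq [Fintype α] {t : α → ℕ} (ht : Function.Injective t)
    {r : Finset α → ℕ} (h0 : r ∅ = 0) (hm : Monotone r)
    (h1 : ∀ S, ∀ e ∈ S, r S ≤ r (S.erase e) + 1) :
    ∃ B : Finset α, ∀ S, IsInitial t S → r S = (B ∩ S).card := by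
  classical
  let J : α → Finset α := fun y ↦ Finset.univ.filter (fun x ↦ t x ≤ t y)
  refine ⟨Finset.univ.filter fun y ↦ r (J y) ≠ r ((J y).erase y), ?_⟩
  refine induction_isInitial ht (by simpa using h0) fun S e hS he hS' ih ↦ ?_
  have hJ : S = J e := by
    ext x
    simp only [J, Finset.mem_filter, Finset.mem_univ, true_and]
    refine ⟨fun hx ↦ ?_, fun hx ↦ hS e he x hx⟩
    by_contra hlt
    have := hS' x (Finset.mem_erase.2 ⟨fun h ↦ hlt (h ▸ le_rfl), hx⟩) e (by omega)
    simp at this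
  have h2 := h1 S e he
  have h3 := hm (Finset.erase_subset e S)
  rw [Finset.inter_erase] at ih
  by_cases h : r S = r (S.erase e)
  · rw [h, ih, Finset.erase_eq_of_notMem]
    rw [Finset.mem_inter, Finset.mem_filter, ← hJ]
    simp [h]
  · rw [← Finset.card_erase_add_one (a := e), ← ih]
    · omega
    · rw [Finset.mem_inter, Finset.mem_filter, ← hJ]
      exact ⟨⟨Finset.mem_univ _, h⟩, he⟩

/-- The valuative relation for `Q`. On each flag it reduces to the count `card_mul_validCount` for
the corresponding greedy basis. The empty `T` has weight zero because of the factor `T.card`. -/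
theorem card_smul_sum_iq_nestedRk [Fintype α] [Fintype I] (hb : 1 ≤ b)
    (hblk : ∀ i, b ≤ tot blk {i} (Finset.univ : Finset α)) :
    ∑ L ∈ orders (Finset.univ : Finset I),
        (Fintype.card I : ℤ) • iq (nestedRk blk b L) ∅ Finset.univ =
      ∑ T : Finset I, ∑ L ∈ orders Tᶜ,
        ((T.card * (T.card - 1).factorial : ℕ) : ℤ) • iq (sumRk blk b T L) ∅ Finset.univ := by
  classical
  have h := IsValuative.sum_eq_zero (ι := List I ⊕ (_ : Finset I) × List I)
    ((orders Finset.univ).disjSum (Finset.univ.sigma fun T : Finset I ↦ orders Tᶜ))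
    (Sum.elim (fun _ ↦ (Fintype.card I : ℤ))
      (fun p ↦ -((p.1.card * (p.1.card - 1).factorial : ℕ) : ℤ)))
    (Sum.elim (fun L ↦ nestedRk blk b L) (fun p ↦ sumRk blk b p.1 p.2)) ?_
    (isValuative_iq (Finset.empty_subset (Finset.univ : Finset α)))
  · rw [Finset.sum_disjSum, Finset.sum_sigma] at h
    simp only [Sum.elim_inl, Sum.elim_inr, neg_smul, Finset.sum_neg_distrib] at h
    rw [← sub_eq_add_neg, sub_eq_zero] at h
    exact h
  intro t ht i₀ hi₀
  have hdisj : ∀ T : Finset I, ∀ L ∈ orders Tᶜ, Disjoint T L.toFinset := fun T L hL ↦ by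
    rw [(mem_orders.1 hL).2]
    exact disjoint_compl_right
  -- The terms that agree with `i₀` on the initial sets are those with the same greedy basis `B`, so
  -- they are singled out by `Valid` and `Good`.
  obtain ⟨B, hB⟩ : ∃ B : Finset α, ∀ S, IsInitial t S →
      (Sum.elim (fun L ↦ nestedRk blk b L) (fun p ↦ sumRk blk b p.1 p.2) i₀ :
        Finset α → ℕ) S = (B ∩ S).card := by
    apply exists_card_inter_eq ht
    · rcases i₀ with L | ⟨T, L⟩
      · exact nestedRk_empty (mem_orders.1 (by simpa using hi₀)).1
      · have hL : L ∈ orders Tᶜ := by simpa using hi₀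
        simp [sumRk, nestedRk_empty (mem_orders.1 hL).1, tot]
    · rcases i₀ with L | ⟨T, L⟩
      · exact nestedRk_mono L
      · exact fun S S' h ↦ add_le_add (min_le_min_right _ (tot_mono h)) (nestedRk_mono L h)
    · rcases i₀ with L | ⟨T, L⟩
      · intro S e he
        refine (nestedRk_le_nestedRk_erase (mem_orders.1 (by simpa using hi₀)).1 he).trans ?_
        simp only [Sum.elim_inl]
        split_ifs <;> omega
      · have hL : L ∈ orders Tᶜ := by simpa using hi₀
        exact fun S e he ↦ sumRk_le_sumRk_erase (mem_orders.1 hL).1 (hdisj T L hL) he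
  have htot : ∀ S : Finset α, S.card = tot blk Finset.univ S := fun S ↦ by simp [tot]
  rw [Finset.sum_filter, Finset.sum_disjSum, Finset.sum_sigma]
  refine (congrArg₂ (· + ·)
    (Finset.sum_congr rfl (g := fun L ↦ if Valid blk b t B L then (Fintype.card I : ℤ) else 0)
      fun L hL ↦ ?_)
    (Finset.sum_congr rfl (g := fun T ↦ ∑ L ∈ orders Tᶜ,
      if Valid blk b t B L then -((T.card * goodCount blk b t B T : ℕ) : ℤ) else 0)
      fun T _ ↦ Finset.sum_congr rfl fun L hL ↦ ?_)).trans ?_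
  · rw [mem_orders] at hL
    refine if_congr ?_ rfl rfl
    rw [← nestedRk_eq_iff_valid ht hblk hL.1]
    refine forall₂_congr fun S hS ↦ ?_
    rw [hB S hS, htot, hL.2, Sum.elim_inl]
  · have hL' := mem_orders.1 hL
    refine (if_congr (Q := Good blk b t B T ∧ Valid blk b t B L) ?_ rfl rfl).trans ?_
    · rw [← min_tot_add_nestedRk_eq_iff ht hblk hL'.1 (hdisj T L hL)]
      refine forall₂_congr fun S hS ↦ ?_
      rw [hB S hS, htot, hL'.2, Sum.elim_inr, sumRk, Finset.union_compl]
    · simp only [goodCount]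
      split_ifs <;> simp_all
  simp only [← Finset.sum_filter, Finset.sum_const, nsmul_eq_mul]
  have h2 := card_mul_validCount (blk := blk) (t := t) (B := B) hb Finset.univ
  rw [Finset.powerset_univ, Finset.card_univ] at h2
  have h3 := congrArg (Nat.cast (R := ℤ)) h2
  push_cast at h3
  simp only [validCount, ← Finset.compl_eq_univ_sdiff] at h3
  push_cast
  simp only [mul_neg, Finset.sum_neg_distrib]
  rw [← sub_eq_add_neg, sub_eq_zero, mul_comm, h3]
  exact Finset.sum_congr rfl fun T _ ↦ mul_comm _ _

end Relation

/-! ### Rank functions of uniform and Catalan matroids -/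

section Ranks

theorem rkFun_eq_of {α : Type*} {M : Matroid α} {A : Finset α} {k : ℕ}
    (hle : ∀ J : Finset α, J ⊆ A → M.Indep (J : Set α) → J.card ≤ k)
    (hex : ∃ J : Finset α, J ⊆ A ∧ M.Indep (J : Set α) ∧ J.card = k) : rkFun M A = k := by
  have h : (rkFun M A : ℕ∞) = k := by
    rw [coe_rkFun]
    apply le_antisymm
    · rw [Matroid.eRk_le_iff]
      intro J hJ hi
      obtain ⟨J, rfl⟩ : ∃ J' : Finset α, (J' : Set α) = J :=
        ⟨(A.finite_toSet.subset hJ).toFinset, by simp⟩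
      rw [Set.encard_coe_eq_coe_finsetCard]
      exact_mod_cast hle J (Finset.coe_subset.1 hJ) hi
    · obtain ⟨J, hJ, hi, rfl⟩ := hex
      rw [← Set.encard_coe_eq_coe_finsetCard]
      exact hi.encard_le_eRk_of_subset (Finset.coe_subset.2 hJ)
  exact_mod_cast h

theorem rkFun_uniform (k N : ℕ) (A : Finset (Fin N)) : rkFun (uniform k N) A = min A.card k := by
  apply rkFun_eq_of
  · intro J hJ hi
    exact le_min (Finset.card_le_card hJ) ((uniform_indep_iff k N J).1 hi)
  · obtain ⟨J, hJ, hc⟩ := Finset.exists_subset_card_eq (min_le_left A.card k)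
    exact ⟨J, hJ, (uniform_indep_iff k N J).2 (hc.le.trans (min_le_right _ _)), hc⟩

/-- Build an independent set from the last block forwards, adding from each block as many elements
of `A` as the bound on the suffix starting there permits. -/
theorem exists_card_eq_nestedRk {α I : Type*} [DecidableEq I] [DecidableEq α] {blk : α → I} {b : ℕ}
    {L : List I} (hL : L.Nodup) (A : Finset α) :
    ∃ J ⊆ A, (∀ x ∈ J, blk x ∈ L) ∧ (∀ P, P <:+ L → tot blk P.toFinset J ≤ b * P.length) ∧
      J.card = nestedRk blk b L A := by
  induction L with
  | nil => exact ⟨∅, by simp [nestedRk]⟩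
  | cons i L ih =>
    obtain ⟨hi, hL'⟩ := List.nodup_cons.1 hL
    obtain ⟨J, hJA, hJL, hJ, hJc⟩ := ih hL'
    have h1 := nestedRk_append_le (blk := blk) (b := b) (Q := []) (P := L) hL' A
    simp only [List.nil_append, List.toFinset_nil, tot_empty, zero_add] at h1
    have h2 : nestedRk blk b (i :: L) A =
      min (tot blk {i} A + nestedRk blk b L A) (b * (L.length + 1)) := rfl
    rw [mul_add] at h2
    obtain ⟨K, hK, hKc⟩ := Finset.exists_subset_card_eq
      (s := A.filter fun x ↦ blk x ∈ ({i} : Finset I)) (n := nestedRk blk b (i :: L) A - J.card)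
      (by change _ ≤ tot blk {i} A; omega)
    have hd : Disjoint J K := Finset.disjoint_left.2 fun x hxJ hxK ↦ by
      have h3 := (Finset.mem_filter.1 (hK hxK)).2
      rw [Finset.mem_singleton] at h3
      exact hi (h3 ▸ hJL x hxJ)
    have hc : (J ∪ K).card = nestedRk blk b (i :: L) A := by
      rw [Finset.card_union_of_disjoint hd, hKc]
      omega
    refine ⟨J ∪ K, Finset.union_subset hJA (hK.trans (Finset.filter_subset _ _)), ?_, ?_, hc⟩
    · intro x hx
      rcases Finset.mem_union.1 hx with hx | hx
      · exact List.mem_cons_of_mem _ (hJL x hx)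
      · have h3 := (Finset.mem_filter.1 (hK hx)).2
        rw [Finset.mem_singleton] at h3
        exact h3 ▸ List.mem_cons_self
    · intro P hP
      rcases List.suffix_cons_iff.1 hP with rfl | hP
      · refine (Finset.card_filter_le _ _).trans ?_
        rw [hc, h2, List.length_cons, mul_add]
        exact min_le_right _ _
      · refine le_of_eq_of_le (tot_congr fun x hx ↦ ?_) (hJ P hP)
        rw [Finset.mem_union, or_iff_left]
        intro hxK
        have h3 := (Finset.mem_filter.1 (hK hxK)).2
        rw [Finset.mem_singleton] at h3
        exact hi (h3 ▸ hP.subset (List.mem_toFinset.1 hx))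

theorem tot_divNat_univ {n c : ℕ} (i : Fin n) (p : ℕ → Prop) [DecidablePred p] :
    tot (Fin.divNat (n := c)) {i} (Finset.univ.filter fun x : Fin (n * c) ↦ p (x % c)) =
      ((Finset.range c).filter p).card := by
  rw [tot, Finset.filter_filter]
  have hdiv : ∀ x : Fin (n * c), Fin.divNat x ∈ ({i} : Finset (Fin n)) ↔ (x : ℕ) / c = i :=
      fun x ↦ by
    rw [Finset.mem_singleton, Fin.ext_iff, Fin.coe_divNat]
  refine Finset.card_nbij (fun x ↦ x % c) ?_ ?_ ?_
  · intro x hx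
    simp only [Finset.coe_filter, Finset.mem_univ, true_and, Set.mem_ofPred_eq,
      Finset.mem_range] at hx ⊢
    refine ⟨Nat.mod_lt _ (Nat.pos_of_ne_zero ?_), hx.1⟩
    rintro rfl
    exact x.elim0
  · intro x hx y hy hxy
    simp only [Finset.coe_filter, Finset.mem_univ, true_and, Set.mem_ofPred_eq, hdiv] at hx hy
    simp only at hxy
    rw [Fin.ext_iff, ← Nat.div_add_mod x c, ← Nat.div_add_mod y c, hx.2, hy.2, hxy]
  · intro y hy
    simp only [Finset.coe_filter, Set.mem_ofPred_eq, Finset.mem_range] at hy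
    have h1 : c * i + y < n * c := by
      calc c * i + y < c * i + c := by omega
        _ = (i + 1) * c := by ring
        _ ≤ n * c := Nat.mul_le_mul_right _ i.2
    have h2 : (c * i + y) % c = y := by rw [Nat.mul_add_mod, Nat.mod_eq_of_lt hy.1]
    refine ⟨⟨c * i + y, h1⟩, ?_, h2⟩
    simp only [Finset.coe_filter, Finset.mem_univ, true_and, Set.mem_ofPred_eq, hdiv, h2]
    refine ⟨hy.2, ?_⟩
    rw [Nat.mul_add_div (by omega), Nat.div_eq_of_lt hy.1, add_zero]

theorem suffix_finRange_iff {n : ℕ} {P : List (Fin n)} :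
    P <:+ List.finRange n ↔ ∃ k, P = (List.finRange n).drop k :=
  ⟨fun h ↦ ⟨_, List.suffix_iff_eq_drop.1 h⟩, fun ⟨_, h⟩ ↦ h ▸ List.drop_suffix _ _⟩

theorem mem_drop_finRange {n k : ℕ} {i : Fin n} : i ∈ (List.finRange n).drop k ↔ k ≤ i := by
  rw [List.mem_drop_iff_getElem]
  simp only [List.getElem_finRange, List.length_finRange]
  constructor
  · rintro ⟨j, hj, rfl⟩
    simp
  · intro h
    refine ⟨i - k, by omega, Fin.ext ?_⟩
    simp
    omega

/-- Of the Schubert conditions only those at the block boundaries matter. Among the zeros of a block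
the tail count of `S` is the same as at the start of the block, so the condition there is weaker. -/
theorem catalan_indep_iff (n a b : ℕ) (J : Finset (Fin (n * (a + b)))) :
    (catalan n a b).Indep (J : Set (Fin (n * (a + b)))) ↔
      ∀ P, P <:+ List.finRange n → tot Fin.divNat P.toFinset J ≤ b * P.length := by
  rw [catalan, schubert_indep_iff]
  set S : Finset (Fin (n * (a + b))) := Finset.univ.filter (fun i ↦ a ≤ i.val % (a + b)) with hS
  have htot : ∀ P : List (Fin n), P.Nodup → tot Fin.divNat P.toFinset S = b * P.length := by
    intro P hP
    induction P with
    | nil => simp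
    | cons i P ih =>
      rw [tot_toFinset_cons hP, ih (List.nodup_cons.1 hP).2, hS, tot_divNat_univ i (fun y ↦ a ≤ y),
        List.length_cons, mul_add, mul_one, add_comm]
      congr 1
      rw [show (Finset.range (a + b)).filter (fun y ↦ a ≤ y) = Finset.Ico a (a + b) by
        ext y
        simp only [Finset.mem_filter, Finset.mem_range, Finset.mem_Ico]
        tauto, Nat.card_Ico]
      omega
  have htail : ∀ (T : Finset (Fin (n * (a + b)))) (k : ℕ),
      tot Fin.divNat ((List.finRange n).drop k).toFinset T =
        (T.filter fun x ↦ k * (a + b) ≤ x.val).card := fun T k ↦ by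
    rw [tot]
    congr 1
    refine Finset.filter_congr fun x _ ↦ ?_
    have hpos : 0 < a + b := Nat.pos_of_mul_pos_left (x.val.zero_le.trans_lt x.2)
    rw [List.mem_toFinset, mem_drop_finRange, Fin.coe_divNat, Nat.le_div_iff_mul_le hpos]
  have hdrop : ∀ k, ((List.finRange n).drop k).Nodup := fun k ↦
    (List.nodup_finRange n).sublist (List.drop_sublist _ _)
  constructor
  · intro h P hP
    obtain ⟨k, rfl⟩ := suffix_finRange_iff.1 hP
    rw [← htot _ (hdrop k), htail, htail]
    by_cases hk : k * (a + b) < n * (a + b)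
    · exact h ⟨k * (a + b), hk⟩
    · refine le_of_eq_of_le (Finset.card_eq_zero.2 (Finset.filter_eq_empty_iff.2 fun x _ ↦ ?_))
        (Nat.zero_le _)
      have := x.2
      omega
  · intro h j
    have h' : ∀ k, (J.filter fun x ↦ k * (a + b) ≤ x.val).card ≤
        (S.filter fun x ↦ k * (a + b) ≤ x.val).card := fun k ↦ by
      rw [← htail, ← htail, htot _ (hdrop k)]
      exact h _ (List.drop_suffix _ _)
    obtain ⟨j, hj⟩ := j
    set k := j / (a + b) with hk
    have hjk : (a + b) * k + j % (a + b) = j := Nat.div_add_mod _ _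
    have hpos : 0 < a + b := Nat.pos_of_ne_zero fun h ↦ by
      rw [h, mul_zero] at hj
      omega
    have hlt := Nat.mod_lt j hpos
    have hmul : k * (a + b) = (a + b) * k := mul_comm _ _
    have hmul' : (k + 1) * (a + b) = (a + b) * k + (a + b) := by ring
    have hmod : ∀ x : Fin (n * (a + b)), (a + b) * k ≤ x.val → x.val < (a + b) * k + (a + b) →
        x.val % (a + b) = x.val - (a + b) * k := fun x h1 h2 ↦ by
      obtain ⟨y, hy⟩ := Nat.exists_eq_add_of_le h1
      rw [hy, Nat.mul_add_mod, Nat.mod_eq_of_lt (by omega)]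
      omega
    simp only [tailCard, Fin.le_def]
    by_cases hr : j % (a + b) ≤ a
    · calc (J.filter fun x ↦ j ≤ x.val).card
          ≤ (J.filter fun x ↦ k * (a + b) ≤ x.val).card :=
            Finset.card_le_card fun x hx ↦ by
              rw [Finset.mem_filter] at hx ⊢
              exact ⟨hx.1, by omega⟩
        _ ≤ (S.filter fun x ↦ k * (a + b) ≤ x.val).card := h' k
        _ ≤ (S.filter fun x ↦ j ≤ x.val).card :=
            Finset.card_le_card fun x hx ↦ by
              rw [Finset.mem_filter] at hx ⊢
              refine ⟨hx.1, ?_⟩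
              have h1 := (Finset.mem_filter.1 hx.1).2
              by_cases h2 : x.val < (a + b) * k + (a + b)
              · rw [hmod x (by omega) h2] at h1
                omega
              · omega
    -- Past the zeros of a block, all positions up to the end of the block belong to `S`, so the
    -- condition follows from the one at the next block boundary.
    · have hsplit : ∀ T : Finset (Fin (n * (a + b))), (T.filter fun x ↦ j ≤ x.val).card =
          (T.filter fun x ↦ (k + 1) * (a + b) ≤ x.val).card +
          (T.filter fun x ↦ j ≤ x.val ∧ x.val < (k + 1) * (a + b)).card := fun T ↦ by
        rw [← Finset.card_filter_add_card_filter_not (s := T.filter fun x ↦ j ≤ x.val)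
          (fun x ↦ (k + 1) * (a + b) ≤ x.val), Finset.filter_filter, Finset.filter_filter]
        congr 2
        · refine Finset.filter_congr fun x _ ↦ ?_
          omega
        · refine Finset.filter_congr fun x _ ↦ ?_
          omega
      rw [hsplit, hsplit S]
      refine add_le_add (h' (k + 1)) (Finset.card_le_card fun x hx ↦ ?_)
      rw [Finset.mem_filter] at hx ⊢
      refine ⟨Finset.mem_filter.2 ⟨Finset.mem_univ _, ?_⟩, hx.2⟩
      rw [hmod x (by omega) (by omega)]
      omega

theorem rkFun_catalan (n a b : ℕ) (A : Finset (Fin (n * (a + b)))) :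
    rkFun (catalan n a b) A = nestedRk Fin.divNat b (List.finRange n) A := by
  apply rkFun_eq_of
  · intro J hJ hi
    rw [catalan_indep_iff] at hi
    obtain ⟨Q, P, hQP, h⟩ := exists_nestedRk_eq (blk := Fin.divNat (m := n) (n := a + b)) (b := b)
      (List.nodup_finRange n) A
    have hn := List.nodup_finRange n
    rw [hQP] at hn
    have h1 := tot_toFinset_append (blk := Fin.divNat (m := n) (n := a + b)) hn J
    have h2 : J.card = tot (Fin.divNat (m := n) (n := a + b)) (Q ++ P).toFinset J := by
      rw [tot, Finset.filter_true_of_mem]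
      intro x _
      rw [List.mem_toFinset, ← hQP]
      exact List.mem_finRange _
    rw [h, h2, h1]
    exact add_le_add (tot_mono hJ) (hi P ⟨Q, hQP.symm⟩)
  · obtain ⟨J, hJA, -, hJ, hc⟩ := exists_card_eq_nestedRk
      (blk := Fin.divNat (m := n) (n := a + b)) (b := b) (List.nodup_finRange n) A
    exact ⟨J, hJA, (catalan_indep_iff n a b J).2 hJ, hc⟩

end Ranks

/-! ### The recursion for Catalan matroids -/

section CatalanRecursion

theorem nestedRk_map {α β I J : Type*} [DecidableEq I] [DecidableEq J] {blk : α → I}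
    {blk' : β → J} {f : I → J} (hf : Function.Injective f) {e : α ↪ β}
    (he : ∀ x, blk' (e x) = f (blk x)) (b : ℕ) (L : List I) (A : Finset α) :
    nestedRk blk' b (L.map f) (A.map e) = nestedRk blk b L A := by
  induction L with
  | nil => rfl
  | cons i L ih =>
    rw [List.map_cons, nestedRk, nestedRk, ih, List.length_map]
    congr 2
    rw [tot, tot, Finset.filter_map, Finset.card_map]
    congr 1
    refine Finset.filter_congr fun x _ ↦ ?_
    simp [he, hf.eq_iff]

variable {n : ℕ} (a b : ℕ)

/-- Any order of the blocks gives the same polynomial: the `i`-th block of `L` is identified with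
the `i`-th block of the Catalan matroid. Here elements are pairs, and the first coordinate is the
block. -/
theorem iq_nestedRk_eq {L : List (Fin n)} (hL : L.Nodup) :
    iq (nestedRk (Prod.fst : Fin n × Fin (a + b) → Fin n) b L) ∅
      (Finset.univ.filter fun x ↦ x.1 ∈ L) = invKLPoly (catalan L.length a b) := by
  rw [invKLPoly_eq_iq (M := catalan L.length a b) (E := Finset.univ)
    (by rw [Finset.coe_univ]; rfl)]
  let e : Fin (L.length * (a + b)) ↪ Fin n × Fin (a + b) :=
    finProdFinEquiv.symm.toEmbedding.trans
      (Function.Embedding.prodMap ⟨L.get, List.nodup_iff_injective_get.1 hL⟩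
        (Function.Embedding.refl _))
  have h := iq_map_union (e := e) (C := ∅) (c := 0) (r := rkFun (catalan L.length a b))
    (r' := nestedRk (Prod.fst : Fin n × Fin (a + b) → Fin n) b L) (E := Finset.univ)
    (by simp) (fun A _ ↦ by
      rw [Finset.union_empty, rkFun_catalan, add_zero]
      have h := nestedRk_map (blk := Fin.divNat) (blk' := Prod.fst) (e := e)
        (List.nodup_iff_injective_get.1 hL) (fun _ ↦ rfl) b (List.finRange L.length) A
      rwa [← List.ofFn_eq_map, List.ofFn_get] at h)
    (Finset.empty_subset Finset.univ) le_rfl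
  rw [← h]
  congr 1
  ext x
  simp only [Finset.mem_filter, Finset.mem_univ, true_and, Finset.union_empty, Finset.mem_map]
  constructor
  · intro hx
    obtain ⟨i, hi⟩ := List.get_of_mem hx
    exact ⟨finProdFinEquiv (i, x.2), by simp [e, Prod.ext_iff, ← hi]⟩
  · rintro ⟨y, rfl⟩
    exact List.get_mem _ _

theorem iq_min_tot_eq (T : Finset (Fin n)) :
    iq (fun S ↦ min (tot (Prod.fst : Fin n × Fin (a + b) → Fin n) T S) (b * T.card)) ∅
      (Finset.univ.filter fun x ↦ x.1 ∈ T) =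
          invKLPoly (uniform (T.card * b) (T.card * (a + b))) := by
  rw [invKLPoly_eq_iq (M := uniform (T.card * b) (T.card * (a + b))) (E := Finset.univ)
    (by rw [Finset.coe_univ]; rfl)]
  let e : Fin (T.card * (a + b)) ↪ Fin n × Fin (a + b) :=
    finProdFinEquiv.symm.toEmbedding.trans
      (Function.Embedding.prodMap (T.orderEmbOfFin rfl).toEmbedding (Function.Embedding.refl _))
  have h := iq_map_union (e := e) (C := ∅) (c := 0)
    (r := rkFun (uniform (T.card * b) (T.card * (a + b))))
    (r' := fun S ↦ min (tot (Prod.fst : Fin n × Fin (a + b) → Fin n) T S) (b * T.card))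
    (E := Finset.univ) (by simp) (fun A _ ↦ by
      rw [Finset.union_empty, rkFun_uniform, add_zero, mul_comm b, tot, Finset.filter_true_of_mem,
        Finset.card_map]
      intro x hx
      obtain ⟨y, -, rfl⟩ := Finset.mem_map.1 hx
      exact Finset.orderEmbOfFin_mem T rfl _)
    (Finset.empty_subset Finset.univ) le_rfl
  rw [← h]
  congr 1
  ext x
  simp only [Finset.mem_filter, Finset.mem_univ, true_and, Finset.union_empty, Finset.mem_map]
  constructor
  · intro hx
    rw [← Finset.mem_coe, ← Finset.range_orderEmbOfFin T rfl] at hx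
    obtain ⟨i, hi⟩ := hx
    exact ⟨finProdFinEquiv (i, x.2), by simp [e, hi]⟩
  · rintro ⟨y, rfl⟩
    exact Finset.orderEmbOfFin_mem T rfl _

theorem iq_sumRk_eq {T : Finset (Fin n)} {L : List (Fin n)} (hL : L.Nodup)
    (hT : L.toFinset = Tᶜ) :
    iq (sumRk (Prod.fst : Fin n × Fin (a + b) → Fin n) b T L) ∅ Finset.univ =
      invKLPoly (uniform (T.card * b) (T.card * (a + b))) * invKLPoly (catalan L.length a b) := by
  set E : Finset (Fin n × Fin (a + b)) := Finset.univ.filter fun x ↦ x.1 ∈ T with hE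
  set E' : Finset (Fin n × Fin (a + b)) := Finset.univ.filter fun x ↦ x.1 ∈ L with hE'
  have hmem : ∀ i, i ∈ L ↔ i ∉ T := fun i ↦ by
    rw [← List.mem_toFinset, hT, Finset.mem_compl]
  have hd : Disjoint E E' := Finset.disjoint_left.2 fun x hx hx' ↦
    (hmem _).1 (Finset.mem_filter.1 hx').2 (Finset.mem_filter.1 hx).2
  have hU : E ∪ E' = Finset.univ := by
    ext x
    simp only [hE, hE', Finset.mem_union, Finset.mem_filter, Finset.mem_univ, true_and, hmem]
    tauto
  have hE0 : ∀ A ⊆ E, ∀ S, nestedRk Prod.fst b L (A ∪ S) = nestedRk Prod.fst b L S :=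
    fun A hA S ↦ nestedRk_congr fun x hx ↦ by
      rw [Finset.mem_union, or_iff_right]
      exact fun h ↦ (hmem _).1 hx (Finset.mem_filter.1 (hA h)).2
  have hE0' : ∀ A ⊆ E', ∀ S, tot Prod.fst T (S ∪ A) = tot Prod.fst T S :=
    fun A hA S ↦ tot_congr fun x hx ↦ by
      rw [Finset.mem_union, or_iff_left]
      exact fun h ↦ (hmem _).1 (Finset.mem_filter.1 (hA h)).2 hx
  have hr : ∀ A ⊆ E, sumRk Prod.fst b T L A = min (tot Prod.fst T A) (b * T.card) :=
    fun A hA ↦ by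
      have := hE0 A hA ∅
      rw [Finset.union_empty, nestedRk_empty hL] at this
      rw [sumRk, this, add_zero]
  have hr' : ∀ A ⊆ E', sumRk Prod.fst b T L A = nestedRk Prod.fst b L A := fun A hA ↦ by
    have := hE0' A hA ∅
    rw [Finset.empty_union] at this
    rw [sumRk, this]
    simp [tot]
  have h := iq_union (r := sumRk (Prod.fst : Fin n × Fin (a + b) → Fin n) b T L) hd
    (fun A hA A' hA' ↦ by
      rw [hr A hA, hr' A' hA', sumRk, hE0 A hA, hE0' A' hA'])
    (fun S S' h ↦ add_le_add (min_le_min_right _ (tot_mono h)) (nestedRk_mono L h))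
    (Finset.empty_subset E) le_rfl (Finset.empty_subset E') le_rfl
  rw [hU, Finset.empty_union, iq_congr hr (Finset.empty_subset E) le_rfl,
    iq_congr hr' (Finset.empty_subset E') le_rfl, iq_min_tot_eq, iq_nestedRk_eq a b hL] at h
  exact h

/-- The terms of the valuative relation depend only on `m = |T|`. There are `n!` orders on the left
and `binom(n, m) (n - m)!` pairs `(T, L)` on the right, each with weight `m!` for `m ≥ 1`, so that
`n!` cancels. -/
theorem smul_invKLPoly_catalan (n : ℕ) {a b : ℕ} (hb : 1 ≤ b) :
    (n : ℤ[X]) * invKLPoly (catalan n a b) = ∑ m ∈ Finset.Icc 1 n,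
      invKLPoly (uniform (m * b) (m * (a + b))) * invKLPoly (catalan (n - m) a b) := by
  have hblk : ∀ i : Fin n, b ≤ tot (Prod.fst : Fin n × Fin (a + b) → Fin n) {i} Finset.univ :=
    fun i ↦ by
      have h1 : (Finset.univ.map ⟨fun y : Fin (a + b) ↦ (i, y), Prod.mk_right_injective i⟩).card ≤
          tot (Prod.fst : Fin n × Fin (a + b) → Fin n) {i} Finset.univ :=
        Finset.card_le_card fun x hx ↦ by
          obtain ⟨y, -, rfl⟩ := Finset.mem_map.1 hx
          simp
      rw [Finset.card_map, Finset.card_univ, Fintype.card_fin] at h1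
      omega
  have h := card_smul_sum_iq_nestedRk (α := Fin n × Fin (a + b)) hb hblk
  have hlen : ∀ (T : Finset (Fin n)), ∀ L ∈ orders T, L.length = T.card := fun T L hL ↦ by
    rw [← (mem_orders.1 hL).2, List.toFinset_card_of_nodup (mem_orders.1 hL).1]
  have e1 : ∀ L ∈ orders (Finset.univ : Finset (Fin n)),
      iq (nestedRk (Prod.fst : Fin n × Fin (a + b) → Fin n) b L) ∅ Finset.univ =
        invKLPoly (catalan n a b) := fun L hL ↦ by
    have h1 := iq_nestedRk_eq a b (mem_orders.1 hL).1
    rw [hlen _ L hL, Finset.card_univ, Fintype.card_fin, Finset.filter_true_of_mem] at h1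
    · exact h1
    · intro x _
      rw [← List.mem_toFinset, (mem_orders.1 hL).2]
      exact Finset.mem_univ _
  have e2 : ∀ T : Finset (Fin n), ∀ L ∈ orders Tᶜ,
      iq (sumRk (Prod.fst : Fin n × Fin (a + b) → Fin n) b T L) ∅ Finset.univ =
        invKLPoly (uniform (T.card * b) (T.card * (a + b))) *
          invKLPoly (catalan (n - T.card) a b) := fun T L hL ↦ by
    rw [iq_sumRk_eq a b (mem_orders.1 hL).1 (mem_orders.1 hL).2, hlen _ L hL, Finset.card_compl,
      Fintype.card_fin]
  rw [Finset.sum_congr rfl fun L hL ↦ by rw [e1 L hL],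
    Finset.sum_congr rfl fun T _ ↦ Finset.sum_congr rfl fun L hL ↦ by rw [e2 T L hL]] at h
  simp only [Finset.sum_const, card_orders, Finset.card_univ, Fintype.card_fin,
    Finset.card_compl] at h
  rw [← Finset.powerset_univ, Finset.sum_powerset_apply_card (fun m ↦ (n - m).factorial •
    ((m * (m - 1).factorial : ℕ) : ℤ) • (invKLPoly (uniform (m * b) (m * (a + b))) *
      invKLPoly (catalan (n - m) a b))), Finset.card_univ, Fintype.card_fin] at h
  have hne : ((n.factorial : ℕ) : ℤ[X]) ≠ 0 := by exact_mod_cast n.factorial_ne_zero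
  apply mul_left_cancel₀ hne
  rw [Finset.mul_sum]
  -- The term `m = 0` has weight zero and is split off.
  rw [Finset.range_eq_Ico, Finset.sum_eq_sum_Ico_succ_bot (by omega)] at h
  simp only [nsmul_eq_mul, zsmul_eq_mul, zero_mul, Nat.cast_zero, Int.cast_zero, mul_zero,
    zero_add] at h
  rw [show Finset.Icc 1 n = Finset.Ico 1 (n + 1) from rfl]
  convert h using 1
  · push_cast
    rfl
  · refine Finset.sum_congr rfl fun m hm ↦ ?_
    rw [Finset.mem_Ico] at hm
    rw [← Nat.choose_mul_factorial_mul_factorial (show m ≤ n by omega),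
      ← Nat.mul_factorial_pred (show m ≠ 0 by omega)]
    push_cast
    ring

end CatalanRecursion

/-! ### Binomial coefficient identities -/

theorem coeff_one_sub_X_pow (n i : ℕ) :
    PowerSeries.coeff i ((1 - PowerSeries.X) ^ n : PowerSeries ℤ) = (-1) ^ i * n.choose i := by
  have h : ((1 - PowerSeries.X) ^ n : PowerSeries ℤ) =
      (((1 : ℤ[X]) - X) ^ n : ℤ[X]) := by simp
  rw [h, coeff_coe]
  have h2 : ((1 : ℤ[X]) - X) ^ n = ((1 + X) ^ n : ℤ[X]).comp (C (-1) * X) := by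
    simp [sub_eq_add_neg]
  rw [h2, comp_C_mul_X_coeff, coeff_one_add_X_pow]
  simp [mul_comm]

/-- Compare the coefficients of `X ^ n` in `(1 - X)^(m+n+1) * (1 - X)^(-(m+1)) = (1 - X)^n`. -/
theorem alternating_sum_choose_mul_choose (m n : ℕ) :
    ∑ s ∈ Finset.range (n + 1),
      (-1 : ℤ) ^ s * (m + n + 1).choose s * (m + n - s).choose (n - s) = (-1) ^ n := by
  have h : ((1 - PowerSeries.X) ^ (m + n + 1) * (PowerSeries.mk 1) ^ (m + 1) : PowerSeries ℤ) =
      (1 - PowerSeries.X) ^ n := by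
    rw [show m + n + 1 = n + (m + 1) by ring, pow_add, mul_assoc, ← mul_pow, mul_comm (1 - _),
      PowerSeries.mk_one_mul_one_sub_eq_one, one_pow, mul_one]
  have h2 := congrArg (PowerSeries.coeff n) h
  rw [PowerSeries.coeff_mul, coeff_one_sub_X_pow, Nat.choose_self, Nat.cast_one, mul_one,
    Finset.Nat.sum_antidiagonal_eq_sum_range_succ
      (fun i j ↦ PowerSeries.coeff i ((1 - PowerSeries.X) ^ (m + n + 1) : PowerSeries ℤ) *
        PowerSeries.coeff j ((PowerSeries.mk 1) ^ (m + 1) : PowerSeries ℤ))] at h2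
  rw [← h2]
  refine Finset.sum_congr rfl fun s hs ↦ ?_
  rw [coeff_one_sub_X_pow, PowerSeries.mk_one_pow_eq_mk_choose_add, PowerSeries.coeff_mk]
  rw [Finset.mem_range] at hs
  rw [show m + (n - s) = m + n - s by omega,
    Nat.choose_symm_of_eq_add (show m + n - s = m + (n - s) by omega)]

/-! ### Uniform matroids -/

theorem sum_Icc_card_sdiff {α M : Type*} [DecidableEq α] [AddCommMonoid M] {F G : Finset α}
    (h : F ⊆ G) (f : ℕ → M) :
    ∑ H ∈ Finset.Icc F G, f (H \ F).card =
      ∑ i ∈ Finset.range ((G \ F).card + 1), (G \ F).card.choose i • f i := by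
  rw [Finset.Icc_eq_image_powerset h, Finset.sum_image, ← Finset.sum_powerset_apply_card]
  · refine Finset.sum_congr rfl fun A hA ↦ ?_
    rw [Finset.mem_powerset] at hA
    rw [Finset.union_sdiff_cancel_left (Finset.disjoint_of_subset_right hA Finset.disjoint_sdiff)]
  · intro A hA B hB hAB
    rw [Finset.mem_coe, Finset.mem_powerset] at hA hB
    have hd := Finset.disjoint_sdiff (s := F) (t := G)
    rw [← Finset.union_sdiff_cancel_left (Finset.disjoint_of_subset_right hA hd),
      ← Finset.union_sdiff_cancel_left (Finset.disjoint_of_subset_right hB hd)]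
    exact congrArg (· \ F) hAB

/-- The coefficient of `X ^ j` in the inverse Kazhdan–Lusztig polynomial of the uniform matroid of
rank `d` on `d + m` elements. -/
def uniformCoeff (m d j : ℕ) : ℤ :=
  (d + m).choose j * (d + m - j - 1).choose (d - j - 1) -
    if j = 0 then 0 else ((d + m).choose (d - j) : ℤ) * (m + j - 1).choose (j - 1)

/-- The inverse Kazhdan–Lusztig polynomial of the uniform matroid of rank `d` on `d + m`
elements. -/
def uniformIq (m d : ℕ) : ℤ[X] :=
  ∑ j ∈ (Finset.range d).filter (fun j ↦ 2 * j < d), monomial j (uniformCoeff m d j)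

/-- The Kazhdan–Lusztig polynomial of the uniform matroid of rank `d` on `d + m` elements. -/
def uniformKl (m d : ℕ) : ℤ[X] :=
  ∑ i ∈ Finset.range d, (-1) ^ (d + 1 + i) * (((d + m).choose i : ℕ) : ℤ[X]) * uniformIq m (d - i)

theorem coeff_uniformIq (m d j : ℕ) :
    (uniformIq m d).coeff j = if 2 * j < d then uniformCoeff m d j else 0 := by
  rw [uniformIq, finsetSum_coeff]
  simp only [coeff_monomial]
  rw [Finset.sum_ite_eq']
  simp only [Finset.mem_filter, Finset.mem_range]
  congr 1
  exact propext ⟨fun h ↦ h.2, fun h ↦ ⟨by omega, h⟩⟩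

theorem coeff_neg_one_pow_mul_natCast_mul (i c j : ℕ) (p : ℤ[X]) :
    ((-1) ^ i * (c : ℤ[X]) * p).coeff j = (-1) ^ i * c * p.coeff j := by
  rw [show ((-1) ^ i * (c : ℤ[X]) * p) = C ((-1) ^ i * (c : ℤ)) * p by simp, coeff_C_mul]

theorem coeff_uniformKl_eq_zero {m d j : ℕ} (h : d ≤ 2 * j) : (uniformKl m d).coeff j = 0 := by
  rw [uniformKl, finsetSum_coeff]
  refine Finset.sum_eq_zero fun i _ ↦ ?_
  rw [coeff_neg_one_pow_mul_natCast_mul, coeff_uniformIq, if_neg (by omega), mul_zero]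

/-- `uniformKl` is what the relation between `P` and `Q` gives when all proper flats are Boolean,
with `P = 1`. Inserted into the Kazhdan–Lusztig sum, each `uniformIq m (d - s)` collects the factor
`∑ binom(s, i) (X - 1)^i = X^s`. -/
theorem sum_choose_mul_uniformKl (m d : ℕ) :
    ∑ i ∈ Finset.range d, (((d + m).choose i : ℕ) : ℤ[X]) * ((X - 1) ^ i * uniformKl m (d - i)) =
      ∑ s ∈ Finset.range d,
        (-1) ^ (d + 1 + s) * (((d + m).choose s : ℕ) : ℤ[X]) * (uniformIq m (d - s) * X ^ s) := by
  have h1 : ∀ i ∈ Finset.range d,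
      (((d + m).choose i : ℕ) : ℤ[X]) * ((X - 1) ^ i * uniformKl m (d - i)) =
      ∑ l ∈ Finset.range (d - i), (-1) ^ (d + 1 + (i + l)) *
        (((d + m).choose (i + l) : ℕ) : ℤ[X]) * (((i + l).choose i : ℕ) : ℤ[X]) *
          (X - 1) ^ i * uniformIq m (d - (i + l)) := by
    intro i hi
    rw [Finset.mem_range] at hi
    rw [uniformKl, Finset.mul_sum, Finset.mul_sum]
    refine Finset.sum_congr rfl fun l hl ↦ ?_
    have h2 := Nat.choose_mul (n := d + m) (k := i + l) (s := i) (by omega)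
    rw [Nat.add_sub_cancel_left] at h2
    have h3 : (((d + m).choose (i + l) : ℕ) : ℤ[X]) * (((i + l).choose i : ℕ) : ℤ[X]) =
      (((d + m).choose i : ℕ) : ℤ[X]) * (((d + m - i).choose l : ℕ) : ℤ[X]) := by
      exact_mod_cast h2
    have h4 : (-1 : ℤ[X]) ^ (d + 1 + (i + l)) = (-1) ^ (d - i + 1 + l) := by
      rw [show d + 1 + (i + l) = (d - i + 1 + l) + 2 * i by omega, pow_add, pow_mul]
      simp
    rw [h4, show d - i + m = d + m - i by omega, show d - i - l = d - (i + l) by omega]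
    linear_combination (-(-1) ^ (d - i + 1 + l) * (X - 1) ^ i * uniformIq m (d - (i + l))) * h3
  rw [Finset.sum_congr rfl h1, Finset.sum_range_diag_flip d
    (fun i l ↦ (-1) ^ (d + 1 + (i + l)) *
        (((d + m).choose (i + l) : ℕ) : ℤ[X]) * (((i + l).choose i : ℕ) : ℤ[X]) *
          (X - 1) ^ i * uniformIq m (d - (i + l))) |>.symm]
  refine Finset.sum_congr rfl fun s _ ↦ ?_
  have h5 : (X : ℤ[X]) ^ s =
      ∑ i ∈ Finset.range (s + 1), ((s.choose i : ℕ) : ℤ[X]) * (X - 1) ^ i := by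
    conv_lhs => rw [show (X : ℤ[X]) = (X - 1) + 1 by ring, add_pow]
    refine Finset.sum_congr rfl fun i _ ↦ ?_
    rw [one_pow]
    ring
  rw [h5, Finset.mul_sum, Finset.mul_sum]
  refine Finset.sum_congr rfl fun i hi ↦ ?_
  rw [Finset.mem_range] at hi
  rw [show i + (s - i) = s by omega]
  ring

/-- The characteristic polynomial of the uniform matroid of rank `d` on `d + m` elements. -/
def uniformChi (m d : ℕ) : ℤ[X] :=
  ∑ i ∈ Finset.range (d + m + 1), (((d + m).choose i : ℕ) : ℤ[X]) * ((-1) ^ i * X ^ (d - i))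

/-- All sets of size at least `d` contribute to the constant term, through the truncated exponent `d
- i`. Their alternating sum is minus that over the smaller sets, which is a single binomial
coefficient. -/
theorem coeff_uniformChi_zero {m d : ℕ} (hm : 1 ≤ m) (hd : 1 ≤ d) :
    (uniformChi m d).coeff 0 = (-1) ^ d * (d + m - 1).choose (d - 1) := by
  obtain ⟨d, rfl⟩ := Nat.exists_eq_add_of_le' hd
  have h1 : (uniformChi m (d + 1)).coeff 0 = ∑ i ∈ Finset.range (d + 1 + m + 1),
      if d + 1 ≤ i then (-1 : ℤ) ^ i * (d + 1 + m).choose i else 0 := by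
    rw [uniformChi, finsetSum_coeff]
    refine Finset.sum_congr rfl fun i _ ↦ ?_
    rw [show ∀ c : ℕ, ∀ e : ℕ, ((c : ℤ[X]) * ((-1) ^ i * X ^ e)) = (-1) ^ i * (c : ℤ[X]) * X ^ e by
      intros; ring, coeff_neg_one_pow_mul_natCast_mul, coeff_X_pow]
    split_ifs <;> omega
  have h2 := Int.alternating_sum_range_choose_of_ne (n := d + 1 + m) (by omega)
  have h3 : ∑ i ∈ Finset.range (d + 1), (-1 : ℤ) ^ i * (d + 1 + m).choose i =
      (-1) ^ d * (d + m).choose d := by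
    rw [show d + 1 + m = d + m + 1 by ring]
    exact Int.alternating_sum_range_choose_eq_choose ..
  have h4 : ∑ i ∈ Finset.range (d + 1 + m + 1),
      (if i < d + 1 then (-1 : ℤ) ^ i * (d + 1 + m).choose i else 0) =
      ∑ i ∈ Finset.range (d + 1), (-1 : ℤ) ^ i * (d + 1 + m).choose i := by
    rw [← Finset.sum_filter]
    refine Finset.sum_congr ?_ fun _ _ ↦ rfl
    ext i
    simp only [Finset.mem_filter, Finset.mem_range]
    omega
  have h5 : (∑ i ∈ Finset.range (d + 1 + m + 1),
      (if i < d + 1 then (-1 : ℤ) ^ i * (d + 1 + m).choose i else 0)) +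
      (∑ i ∈ Finset.range (d + 1 + m + 1),
      if d + 1 ≤ i then (-1 : ℤ) ^ i * (d + 1 + m).choose i else 0) = 0 := by
    rw [← h2, ← Finset.sum_add_distrib]
    refine Finset.sum_congr rfl fun i _ ↦ ?_
    split_ifs <;> omega
  rw [h1, show d + 1 + m - 1 = d + m by omega, Nat.add_sub_cancel, pow_succ]
  rw [h4, h3] at h5
  linarith

theorem coeff_uniformChi {m d j : ℕ} (hj : 1 ≤ j) (hjd : j ≤ d) :
    (uniformChi m d).coeff j = (-1) ^ (d + j) * (d + m).choose (d - j) := by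
  rw [uniformChi, finsetSum_coeff, Finset.sum_eq_single (d - j)]
  · rw [show ∀ c : ℕ, ∀ e i : ℕ, ((c : ℤ[X]) * ((-1) ^ i * X ^ e)) =
        (-1) ^ i * (c : ℤ[X]) * X ^ e by
      intros; ring, coeff_neg_one_pow_mul_natCast_mul, coeff_X_pow, if_pos (by omega), mul_one]
    rw [show d + j = (d - j) + 2 * j by omega, pow_add (-1 : ℤ) _ (2 * j), pow_mul]
    simp
  · intro i _ hi
    rw [show ∀ c : ℕ, ∀ e i : ℕ, ((c : ℤ[X]) * ((-1) ^ i * X ^ e)) =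
        (-1) ^ i * (c : ℤ[X]) * X ^ e by
      intros; ring, coeff_neg_one_pow_mul_natCast_mul, coeff_X_pow, if_neg (by omega), mul_zero]
  · intro h
    rw [Finset.mem_range] at h
    omega

/-- The lower half of the Kazhdan–Lusztig recursion for uniform matroids. For `j > 0` the first
terms of the coefficients `uniformCoeff` cancel because `∑ (-1)^s binom(j, s) = 0`, and the second
terms add up to minus the coefficient of the characteristic polynomial by
`alternating_sum_choose_mul_choose`. -/
theorem coeff_sum_add_uniformChi {m d j : ℕ} (hm : 1 ≤ m) (hj : 2 * j < d) :
    (∑ i ∈ Finset.range d, (((d + m).choose i : ℕ) : ℤ[X]) * ((X - 1) ^ i * uniformKl m (d - i)) +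
      uniformChi m d).coeff j = 0 := by
  have h1 : (∑ i ∈ Finset.range d,
      (((d + m).choose i : ℕ) : ℤ[X]) * ((X - 1) ^ i * uniformKl m (d - i))).coeff j =
      ∑ s ∈ Finset.range (j + 1), (-1) ^ (d + 1 + s) * ((d + m).choose s : ℤ) *
        uniformCoeff m (d - s) (j - s) := by
    rw [sum_choose_mul_uniformKl, finsetSum_coeff,
      ← Finset.sum_subset (Finset.range_subset_range.2 (show j + 1 ≤ d by omega))]
    · refine Finset.sum_congr rfl fun s hs ↦ ?_
      rw [Finset.mem_range] at hs
      rw [coeff_neg_one_pow_mul_natCast_mul, coeff_mul_X_pow', if_pos (by omega), coeff_uniformIq,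
        if_pos (by omega)]
    · intro s _ hs
      rw [Finset.mem_range] at hs
      rw [coeff_neg_one_pow_mul_natCast_mul, coeff_mul_X_pow', if_neg (by omega), mul_zero]
  rw [coeff_add, h1]
  rcases Nat.eq_zero_or_pos j with rfl | hj0
  · rw [coeff_uniformChi_zero hm (by omega)]
    simp [uniformCoeff, pow_succ]
  rw [coeff_uniformChi hj0 (by omega)]
  -- At `s = j` the index `j - s` is zero, where `uniformCoeff` has no second term.
  have h2 : ∀ s ∈ Finset.range (j + 1), (-1) ^ (d + 1 + s) * ((d + m).choose s : ℤ) *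
        uniformCoeff m (d - s) (j - s) =
      (-1) ^ (d + 1) * ((d + m).choose j : ℤ) * (d + m - j - 1).choose (d - j - 1) *
        ((-1) ^ s * j.choose s) + (if s = j then 0 else
          (-1) ^ d * ((d + m).choose (d - j) : ℤ) *
            ((-1) ^ s * (m + j).choose s * (m + j - 1 - s).choose (j - 1 - s))) := by
    intro s hs
    rw [Finset.mem_range] at hs
    have e1 : ((d + m).choose j : ℤ) * j.choose s =
        (d + m).choose s * (d + m - s).choose (j - s) := by
      exact_mod_cast Nat.choose_mul (n := d + m) (k := j) (s := s) (by omega)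
    have e2 : ((d + m).choose (d - j) : ℤ) * (m + j).choose s =
        (d + m).choose s * (d + m - s).choose (d - j) := by
      have a1 := Nat.choose_mul (n := d + m) (k := d - j + s) (s := d - j) (by omega)
      have a2 := Nat.choose_mul (n := d + m) (k := d - j + s) (s := s) (by omega)
      rw [show d + m - (d - j) = m + j by omega, show d - j + s - (d - j) = s by omega] at a1
      rw [show d - j + s - s = d - j by omega] at a2
      have a3 : (d - j + s).choose (d - j) = (d - j + s).choose s := Nat.choose_symm_add
      rw [a3] at a1
      exact_mod_cast a1.symm.trans a2
    rw [uniformCoeff, show d - s + m = d + m - s by omega,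
      show d + m - s - (j - s) - 1 = d + m - j - 1 by omega,
      show d - s - (j - s) - 1 = d - j - 1 by omega]
    rw [pow_add (-1 : ℤ) (d + 1) s]
    by_cases hsj : s = j
    · rw [if_pos (by omega), if_pos hsj, sub_zero, add_zero]
      linear_combination (-(-1) ^ (d + 1) * (-1) ^ s *
        ((d + m - j - 1).choose (d - j - 1) : ℤ)) * e1
    · rw [if_neg (by omega), if_neg hsj, show d - s - (j - s) = d - j by omega,
        show m + (j - s) - 1 = m + j - 1 - s by omega, show j - s - 1 = j - 1 - s by omega]
      linear_combination (-(-1) ^ (d + 1) * (-1) ^ s *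
        ((d + m - j - 1).choose (d - j - 1) : ℤ)) * e1 - ((-1) ^ d * (-1) ^ s *
        ((m + j - 1 - s).choose (j - 1 - s) : ℤ)) * e2
  rw [Finset.sum_congr rfl h2, Finset.sum_add_distrib, ← Finset.mul_sum,
    Int.alternating_sum_range_choose_of_ne (by omega), mul_zero, zero_add, Finset.sum_range_succ,
    if_pos rfl, add_zero]
  obtain ⟨j, rfl⟩ := Nat.exists_eq_add_of_le' hj0
  have h3 : ∀ s ∈ Finset.range (j + 1), (if s = j + 1 then 0 else
          (-1) ^ d * ((d + m).choose (d - (j + 1)) : ℤ) *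
            ((-1) ^ s * (m + (j + 1)).choose s * (m + (j + 1) - 1 - s).choose (j + 1 - 1 - s))) =
      (-1) ^ d * ((d + m).choose (d - (j + 1)) : ℤ) *
        ((-1) ^ s * (m + j + 1).choose s * (m + j - s).choose (j - s)) := by
    intro s hs
    rw [Finset.mem_range] at hs
    rw [if_neg (by omega)]
    rfl
  rw [Finset.sum_congr rfl h3, ← Finset.mul_sum, alternating_sum_choose_mul_choose]
  ring

/-! ### Intervals of a uniform rank function -/

section Uniform

variable {α : Type*} [Fintype α] [DecidableEq α] {k m : ℕ} {r : Finset α → ℕ}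
  (hα : Fintype.card α = k + m) (hr : ∀ A, r A = min A.card k)

include hr

omit [Fintype α] in
theorem chi_of_card_le {F H : Finset α} (hFH : F ⊆ H) (hH : H.card ≤ k) :
    chi r F H = (X - 1) ^ (H \ F).card := by
  have h : ∀ A ∈ Finset.Icc F H, ((-1) ^ (A \ F).card * X ^ (r H - r A) : ℤ[X]) =
      (-1) ^ (A \ F).card * X ^ ((H \ F).card - (A \ F).card) := by
    intro A hA
    rw [Finset.mem_Icc] at hA
    have h1 := Finset.card_le_card hA.1
    have h2 := Finset.card_le_card hA.2
    rw [hr, hr, Finset.card_sdiff_of_subset hA.1, Finset.card_sdiff_of_subset hFH]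
    congr 2
    omega
  rw [chi, Finset.sum_congr rfl h, sum_Icc_card_sdiff hFH
    (fun i ↦ ((-1) ^ i * X ^ ((H \ F).card - i) : ℤ[X])), sub_eq_neg_add, add_pow]
  refine Finset.sum_congr rfl fun i _ ↦ ?_
  rw [nsmul_eq_mul]
  ring

omit [Fintype α] in
-- Intervals of sets of size at most `k` are Boolean, and `∑ (X - 1)^|A \ F| = X^|H \ F|` has no
-- terms in the lower half.
theorem kl_of_card_le {F H : Finset α} (hFH : F ⊆ H) (hH : H.card ≤ k) : kl r F H = 1 := by
  induction hn : (H \ F).card using Nat.strong_induction_on generalizing F with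
  | _ n ih =>
    subst hn
    by_cases hF : F = H
    · rw [hF, kl_self]
    have hlt := Finset.card_lt_card (hFH.ssubset_of_ne hF)
    have hc := Finset.card_sdiff_of_subset hFH
    have hrk : r H - r F = (H \ F).card := by rw [hr, hr]; omega
    have hne : r H ≠ r F := by rw [hr, hr]; omega
    refine kl_eq_of_coeff hne ?_ ?_
    · intro i hi
      rw [coeff_one, if_neg (by omega)]
    · intro i hi
      have h : ∑ A ∈ Finset.Icc F H, ((X : ℤ[X]) - 1) ^ (A \ F).card = X ^ (H \ F).card := by
        rw [sum_Icc_card_sdiff hFH (fun i ↦ ((X : ℤ[X]) - 1) ^ i)]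
        conv_rhs => rw [show (X : ℤ[X]) = (X - 1) + 1 by ring, add_pow]
        refine Finset.sum_congr rfl fun i _ ↦ ?_
        rw [nsmul_eq_mul, one_pow]
        ring
      have h2 : ∀ A ∈ Finset.Ioc F H, chi r F A * kl r A H = (X - 1) ^ (A \ F).card := by
        intro A hA
        have hA' := Finset.mem_Ioc.1 hA
        rw [ih _ (card_sdiff_lt_of_mem_Ioc hA) hA'.2 rfl, mul_one,
          chi_of_card_le hr hA'.1.le ((Finset.card_le_card hA'.2).trans hH)]
      rw [sum_Icc_eq_add_sum_Ioc hFH, Finset.sdiff_self, Finset.card_empty, pow_zero] at h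
      rw [Finset.sum_congr rfl h2, h, coeff_X_pow, if_neg (by omega)]

include hα

theorem chi_univ {F : Finset α} (hF : F.card ≤ k) :
    chi r F Finset.univ = uniformChi m (k - F.card) := by
  have hc : (Finset.univ \ F).card = k - F.card + m := by
    rw [Finset.card_sdiff_of_subset (Finset.subset_univ F), Finset.card_univ]
    omega
  have h : ∀ A ∈ Finset.Icc F Finset.univ,
      ((-1) ^ (A \ F).card * X ^ (r Finset.univ - r A) : ℤ[X]) =
      (-1) ^ (A \ F).card * X ^ (k - F.card - (A \ F).card) := by
    intro A hA
    rw [Finset.mem_Icc] at hA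
    have h1 := Finset.card_le_card hA.1
    rw [hr, hr, Finset.card_sdiff_of_subset hA.1, Finset.card_univ]
    congr 2
    omega
  rw [chi, Finset.sum_congr rfl h, sum_Icc_card_sdiff (Finset.subset_univ F)
    (fun i ↦ ((-1) ^ i * X ^ (k - F.card - i) : ℤ[X])), hc, uniformChi]
  exact Finset.sum_congr rfl fun i _ ↦ nsmul_eq_mul _ _

omit hr in
/-- A sum over an upper interval of terms that vanish on the sets of size at least `k` other
than the whole set. -/
theorem sum_Icc_univ_eq (hm : 1 ≤ m) {F : Finset α} (hF : F.card ≤ k) (f : ℕ → ℤ[X]) (p : ℤ[X]) :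
    ∑ H ∈ Finset.Icc F Finset.univ,
        (if H.card < k then f (H \ F).card else if H = Finset.univ then p else 0) =
      ∑ i ∈ Finset.range (k - F.card), (((k - F.card + m).choose i : ℕ) : ℤ[X]) * f i + p := by
  have hc : (Finset.univ \ F).card = k - F.card + m := by
    rw [Finset.card_sdiff_of_subset (Finset.subset_univ F), Finset.card_univ]
    omega
  have h : ∀ H ∈ Finset.Icc F Finset.univ,
      (if H.card < k then f (H \ F).card else if H = Finset.univ then p else 0) =
      (fun i ↦ if i < k - F.card then f i else if i = k - F.card + m then p else 0)
        (H \ F).card := by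
    intro H hH
    rw [Finset.mem_Icc] at hH
    have h1 := Finset.card_le_card hH.1
    have h2 := Finset.card_sdiff_of_subset hH.1
    have h3 : H = Finset.univ ↔ (H \ F).card = k - F.card + m := by
      rw [← Finset.card_eq_iff_eq_univ, hα]
      omega
    have h4 : H.card < k ↔ (H \ F).card < k - F.card := by omega
    simp only [h3, h4]
  rw [Finset.sum_congr rfl h, sum_Icc_card_sdiff (Finset.subset_univ F)
    (fun i ↦ if i < k - F.card then f i else if i = k - F.card + m then p else 0), hc,
    Finset.sum_range_succ, if_neg (by omega), if_pos rfl, Nat.choose_self, one_smul,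
    ← Finset.sum_subset (Finset.range_subset_range.2 (show k - F.card ≤ k - F.card + m by omega))]
  · congr 1
    refine Finset.sum_congr rfl fun i hi ↦ ?_
    rw [if_pos (Finset.mem_range.1 hi), nsmul_eq_mul]
  · intro i hi hi'
    rw [Finset.mem_range] at hi hi'
    rw [if_neg hi', if_neg (by omega), smul_zero]

/-- The sets `H` of size less than `k` give Boolean lower intervals, the whole set gives the
characteristic polynomial, and the other sets of size at least `k` are not closed and give zero. -/
theorem kl_univ (hm : 1 ≤ m) {F : Finset α} (hF : F.card < k) :
    kl r F Finset.univ = uniformKl m (k - F.card) := by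
  induction hn : (Finset.univ \ F).card using Nat.strong_induction_on generalizing F with
  | _ n ih =>
    subst hn
    have hrk : r Finset.univ - r F = k - F.card := by
      rw [hr, hr, Finset.card_univ]
      omega
    refine kl_eq_of_coeff (by omega) ?_ ?_
    · intro i hi
      exact coeff_uniformKl_eq_zero (by omega)
    · intro i hi
      have h := sum_Icc_univ_eq hα hm hF.le
        (fun i ↦ (X - 1) ^ i * uniformKl m (k - F.card - i)) (uniformChi m (k - F.card))
      rw [sum_Icc_eq_add_sum_Ioc (Finset.subset_univ F), if_pos hF, Finset.sdiff_self,
        Finset.card_empty, pow_zero, one_mul, Nat.sub_zero] at h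
      have h2 : ∀ H ∈ Finset.Ioc F Finset.univ, chi r F H * kl r H Finset.univ =
          if H.card < k then (X - 1) ^ (H \ F).card * uniformKl m (k - F.card - (H \ F).card)
          else if H = Finset.univ then uniformChi m (k - F.card) else 0 := by
        intro H hH
        have hH' := Finset.mem_Ioc.1 hH
        have hc := Finset.card_lt_card hH'.1
        split_ifs with h3 h4
        · rw [ih _ (card_sdiff_lt_of_mem_Ioc hH) h3 rfl, chi_of_card_le hr hH'.1.le h3.le,
            Finset.card_sdiff_of_subset hH'.1.le, show k - F.card - (H.card - F.card) =
                k - H.card by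
              omega]
        · rw [h4, kl_self, mul_one, chi_univ hα hr hF.le]
        · rw [kl_of_eq (by rw [hr, hr, Finset.card_univ]; omega), if_neg h4, mul_zero]
      rw [Finset.sum_congr rfl h2, h]
      exact coeff_sum_add_uniformChi hm (by omega)

/-- With Boolean lower intervals the recursion for `iq` expresses `uniformKl` through `uniformIq`,
and that expression is the definition of `uniformKl`. -/
theorem iq_univ (hm : 1 ≤ m) {F : Finset α} (hF : F.card < k) :
    iq r F Finset.univ = uniformIq m (k - F.card) := by
  induction hn : (Finset.univ \ F).card using Nat.strong_induction_on generalizing F with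
  | _ n ih =>
    subst hn
    have hrk : r Finset.univ - r F = k - F.card := by
      rw [hr, hr, Finset.card_univ]
      omega
    have h := sum_Icc_univ_eq hα hm hF.le
      (fun i ↦ (-1) ^ i * uniformIq m (k - F.card - i))
      ((-1) ^ (k - F.card) * uniformKl m (k - F.card))
    rw [sum_Icc_eq_add_sum_Ioc (Finset.subset_univ F), if_pos hF, Finset.sdiff_self,
      Finset.card_empty, pow_zero, one_mul, Nat.sub_zero] at h
    have h2 : ∀ H ∈ Finset.Ioc F Finset.univ,
        (-1) ^ (r H - r F) * kl r F H * iq r H Finset.univ =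
        if H.card < k then (-1) ^ (H \ F).card * uniformIq m (k - F.card - (H \ F).card)
        else if H = Finset.univ then (-1) ^ (k - F.card) * uniformKl m (k - F.card) else 0 := by
      intro H hH
      have hH' := Finset.mem_Ioc.1 hH
      have hc := Finset.card_lt_card hH'.1
      split_ifs with h3 h4
      · rw [ih _ (card_sdiff_lt_of_mem_Ioc hH) h3 rfl, kl_of_card_le hr hH'.1.le h3.le,
          Finset.card_sdiff_of_subset hH'.1.le, hr, hr, mul_one,
          show k - F.card - (H.card - F.card) = k - H.card by omega, min_eq_left h3.le,
          min_eq_left hF.le]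
      · rw [h4, iq_self, mul_one, kl_univ hα hr hm hF, hrk]
      · rw [iq_of_eq (by rw [hr, hr, Finset.card_univ]; omega), if_neg h4, mul_zero]
    rw [iq_of_ne (by omega), Finset.sum_congr rfl h2, neg_eq_iff_add_eq_zero, add_comm, h,
        uniformKl,
      Finset.mul_sum, ← Finset.sum_add_distrib]
    refine Finset.sum_eq_zero fun i _ ↦ ?_
    rw [show k - F.card + 1 + i = k - F.card + (i + 1) by ring, pow_add, pow_succ]
    have : ((-1 : ℤ[X]) ^ (k - F.card)) * (-1) ^ (k - F.card) = 1 := by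
      rw [← mul_pow]; simp
    linear_combination (-((-1) ^ i * (((k - F.card + m).choose i : ℕ) : ℤ[X]) *
      uniformIq m (k - F.card - i))) * this

end Uniform

/-- After clearing the denominators `m + j` and `k + m - j`, both products of binomials in
`uniformCoeff` become multiples of `binom(k + m, k) * binom(k, j)` by absorption and trinomial
revision. -/
theorem uniformCoeff_eq {k m j : ℕ} (hm : 1 ≤ m) (hj : 2 * j < k) :
    (uniformCoeff m k j : ℚ) = (k + m).choose k *
      ((((k + m : ℕ) : ℚ) - k) * ((k : ℚ) - 2 * j) /
        ((((k + m : ℕ) : ℚ) - k + j) * (((k + m : ℕ) : ℚ) - j)) * k.choose j) := by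
  have e1 : ((k + m).choose k : ℚ) * k.choose j =
      (k + m).choose j * (k + m - j).choose (k - j) := by
    exact_mod_cast Nat.choose_mul (n := k + m) (k := k) (s := j) (by omega)
  -- This removes the truncated subtractions.
  obtain ⟨p, rfl⟩ : ∃ p, k = p + 1 + j := ⟨k - j - 1, by omega⟩
  have e2 : ((p + m + 1 : ℕ) : ℚ) * (p + m).choose p =
      (p + m + 1).choose (p + 1) * (p + 1 : ℕ) := by
    exact_mod_cast Nat.add_one_mul_choose_eq (p + m) p
  have hden1 : ((m : ℚ) + j) ≠ 0 := by positivity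
  have hden2 : ((p : ℚ) + 1 + m) ≠ 0 := by positivity
  rw [show p + 1 + j + m - j = p + m + 1 by omega, show p + 1 + j - j = p + 1 by omega] at e1
  rw [uniformCoeff, show p + 1 + j + m - j - 1 = p + m by omega,
    show p + 1 + j - j - 1 = p by omega, show p + 1 + j - j = p + 1 by omega]
  push_cast
  have hR : (((p + 1 + j + m).choose (p + 1 + j) : ℕ) : ℚ) *
      (((p : ℚ) + 1 + j + m - (p + 1 + j)) * (p + 1 + j - 2 * j) /
        ((p + 1 + j + m - (p + 1 + j) + j) * (p + 1 + j + m - j)) * (p + 1 + j).choose j) =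
      ((p + 1 + j + m).choose (p + 1 + j) * (p + 1 + j).choose j : ℚ) * (m * (p + 1 - j)) /
        ((m + j) * (p + 1 + m)) := by
    rw [show ((p : ℚ) + 1 + j + m - (p + 1 + j)) = m by ring,
      show ((p : ℚ) + 1 + j + m - j) = p + 1 + m by ring]
    ring
  rw [hR, eq_div_iff (mul_ne_zero hden1 hden2)]
  push_cast at e2
  rcases Nat.eq_zero_or_pos j with rfl | hj0
  · simp only [if_true, Nat.cast_zero] at *
    linear_combination (m : ℚ) * ((p + 1 + 0 + m).choose 0 : ℚ) * e2 - (m : ℚ) * (p + 1) * e1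
  obtain ⟨j, rfl⟩ := Nat.exists_eq_add_of_le' hj0
  have e3 : ((m + j + 1 : ℕ) : ℚ) * (m + j).choose j =
      (m + j + 1).choose (j + 1) * (j + 1 : ℕ) := by
    exact_mod_cast Nat.add_one_mul_choose_eq (m + j) j
  have e4 : ((p + 1 + (j + 1) + m).choose (p + 1 + (j + 1)) : ℚ) *
      (p + 1 + (j + 1)).choose (j + 1) =
      (p + 1 + (j + 1) + m).choose (p + 1) * (m + j + 1).choose (j + 1) := by
    have a1 := Nat.choose_mul (n := p + 1 + (j + 1) + m) (k := p + 1 + (j + 1)) (s := p + 1)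
      (by omega)
    rw [show p + 1 + (j + 1) + m - (p + 1) = m + j + 1 by omega, Nat.add_sub_cancel_left,
      Nat.choose_symm_add (a := p + 1) (b := j + 1)] at a1
    exact_mod_cast a1
  rw [if_neg (by omega), show m + (j + 1) - 1 = m + j by omega, Nat.add_sub_cancel]
  push_cast at e3 ⊢
  linear_combination ((m : ℚ) + (j + 1)) * ((p + 1 + (j + 1) + m).choose (j + 1) : ℚ) * e2 -
    ((m : ℚ) + (j + 1)) * (p + 1) * e1 -
    ((p : ℚ) + 1 + m) * ((p + 1 + (j + 1) + m).choose (p + 1) : ℚ) * e3 +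
    ((p : ℚ) + 1 + m) * (j + 1) * e4

/-- The inverse Kazhdan–Lusztig polynomial of a uniform matroid. -/
theorem invKLPolyQ_uniform {k N : ℕ} (hk : 1 ≤ k) (hN : k < N) :
    invKLPolyQ (uniform k N) = closedFormula k N := by
  obtain ⟨m, rfl⟩ := Nat.exists_eq_add_of_lt hN
  rw [add_assoc]
  generalize hm' : m + 1 = m'
  have hm : 1 ≤ m' := by omega
  clear hm' hN m
  have hE : ((Finset.univ : Finset (Fin (k + m'))) : Set (Fin (k + m'))) =
      (uniform k (k + m')).E := by
    rw [Finset.coe_univ]; rfl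
  rw [invKLPolyQ, invKLPoly_eq_iq hE,
    iq_univ (k := k) (m := m') (Fintype.card_fin _) (rkFun_uniform k _) hm
        (by rw [Finset.card_empty]; exact hk),
    Finset.card_empty, Nat.sub_zero, closedFormula]
  ext j
  rw [coeff_map, coeff_uniformIq, coeff_C_mul, finsetSum_coeff]
  simp only [coeff_C_mul_X_pow]
  rw [Finset.sum_ite_eq]
  by_cases hj : 2 * j < k
  · rw [if_pos hj, if_pos (Finset.mem_range.2 (by omega)), eq_intCast, uniformCoeff_eq hm hj]
  · rw [if_neg hj, if_neg (by rw [Finset.mem_range]; omega), map_zero, mul_zero]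

/-! ### Sums over partitions -/

theorem zPart_eq_prod_Icc {n N : ℕ} (h : n ≤ N) (l : n.Partition) :
    zPart l = ∏ i ∈ Finset.Icc 1 N, i ^ l.parts.count i * (l.parts.count i).factorial := by
  refine Finset.prod_subset (Finset.Icc_subset_Icc_right h) fun i hi hi' ↦ ?_
  rw [Finset.mem_Icc] at hi hi'
  rw [Multiset.count_eq_zero_of_notMem, pow_zero, Nat.factorial_zero, one_mul]
  intro hl
  have := l.le_of_mem_parts hl
  omega

/-- The partition of `n` obtained from a partition of `n - i` by adding a part `i`. -/
def consPart {n i : ℕ} (hi : 1 ≤ i) (hn : i ≤ n) (l : (n - i).Partition) : n.Partition where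
  parts := i ::ₘ l.parts
  parts_pos := by
    intro j hj
    rcases Multiset.mem_cons.1 hj with rfl | hj
    · exact hi
    · exact l.parts_pos hj
  parts_sum := by
    rw [Multiset.sum_cons, l.parts_sum]
    omega

theorem zPart_consPart {n i : ℕ} (hi : 1 ≤ i) (hn : i ≤ n) (l : (n - i).Partition) :
    zPart (consPart hi hn l) = i * (l.parts.count i + 1) * zPart l := by
  have hm : i ∈ Finset.Icc 1 n := Finset.mem_Icc.2 ⟨hi, hn⟩
  rw [zPart, zPart_eq_prod_Icc (Nat.sub_le n i) l, ← Finset.mul_prod_erase _ _ hm,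
    ← Finset.mul_prod_erase _ _ hm, consPart]
  have h : ∀ j ∈ (Finset.Icc 1 n).erase i,
      j ^ (i ::ₘ l.parts).count j * ((i ::ₘ l.parts).count j).factorial =
      j ^ l.parts.count j * (l.parts.count j).factorial := by
    intro j hj
    rw [Multiset.count_cons_of_ne (Finset.ne_of_mem_erase hj)]
  rw [Finset.prod_congr rfl h, Multiset.count_cons_self, Nat.factorial_succ]
  ring

theorem sum_mul_count {n : ℕ} (l : n.Partition) :
    ∑ i ∈ Finset.Icc 1 n, i * l.parts.count i = n := by
  conv_rhs => rw [← l.parts_sum, Finset.sum_multiset_count]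
  symm
  refine Finset.sum_subset_zero_on_sdiff ?_ ?_ fun i _ ↦ by rw [smul_eq_mul, mul_comm]
  · intro i hi
    rw [Multiset.mem_toFinset] at hi
    exact Finset.mem_Icc.2 ⟨l.parts_pos hi, l.le_of_mem_parts hi⟩
  · intro i hi
    rw [Finset.mem_sdiff, Multiset.mem_toFinset] at hi
    rw [Multiset.count_eq_zero_of_notMem hi.2, mul_zero]

/-- The sum over the partitions `λ` of `n` of the products `∏ u λᵢ`, weighted by `1 / z_λ`. -/
def partitionSum (u : ℕ → ℚ[X]) (n : ℕ) : ℚ[X] :=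
  ∑ l : n.Partition, C (1 / (zPart l : ℚ)) * (l.parts.map u).prod

theorem partitionSum_zero (u : ℕ → ℚ[X]) : partitionSum u 0 = 1 := by
  rw [partitionSum, Fintype.sum_unique]
  simp [zPart]

/-- Partitions without a part `i` contribute zero. The others arise uniquely by adding a part `i` to
a partition of `n - i`, which multiplies `z` by `i` times the new multiplicity of `i`; the weight
cancels this factor. -/
theorem sum_count_mul (u : ℕ → ℚ[X]) {n i : ℕ} (hi : 1 ≤ i) (hn : i ≤ n) :
    ∑ l : n.Partition, C (((i * l.parts.count i : ℕ) : ℚ) / zPart l) * (l.parts.map u).prod =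
      u i * partitionSum u (n - i) := by
  rw [partitionSum, Finset.mul_sum]
  symm
  refine Finset.sum_of_injOn (consPart hi hn) ?_
    (fun _ _ ↦ Finset.mem_coe.2 (Finset.mem_univ _)) ?_ ?_
  · intro l _ l' _ h
    have h2 := congrArg Nat.Partition.parts h
    exact Nat.Partition.ext ((Multiset.cons_inj_right i).1 h2)
  · intro l _ hl
    rw [Multiset.count_eq_zero_of_notMem, mul_zero, Nat.cast_zero, zero_div, C_0, zero_mul]
    intro hm
    obtain ⟨s, hs⟩ := Multiset.exists_cons_of_mem hm
    refine hl ⟨⟨s, fun hj ↦ l.parts_pos (hs ▸ Multiset.mem_cons_of_mem hj), ?_⟩,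
      Finset.mem_coe.2 (Finset.mem_univ _), Nat.Partition.ext hs.symm⟩
    have := l.parts_sum
    rw [hs, Multiset.sum_cons] at this
    omega
  · intro l _
    have h1 : ((i : ℚ) * (l.parts.count i + 1)) ≠ 0 := by positivity
    rw [zPart_consPart, consPart, Multiset.map_cons, Multiset.prod_cons, Multiset.count_cons_self,
      show (((i * (l.parts.count i + 1) : ℕ) : ℚ) /
        ((i * (l.parts.count i + 1) * zPart l : ℕ) : ℚ)) = 1 / zPart l by
      push_cast
      rw [← div_div, div_self h1]]
    ring

/-- Write `n` as the sum of `i` times the multiplicity of `i` in each partition, and exchange the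
sums. -/
theorem natCast_mul_partitionSum (u : ℕ → ℚ[X]) (n : ℕ) :
    (n : ℚ[X]) * partitionSum u n =
      ∑ i ∈ Finset.Icc 1 n, u i * partitionSum u (n - i) := by
  have h : ∀ i ∈ Finset.Icc 1 n, u i * partitionSum u (n - i) =
      ∑ l : n.Partition, C (((i * l.parts.count i : ℕ) : ℚ) / zPart l) * (l.parts.map u).prod :=
    fun i hi ↦ (sum_count_mul u (Finset.mem_Icc.1 hi).1 (Finset.mem_Icc.1 hi).2).symm
  rw [Finset.sum_congr rfl h, Finset.sum_comm, partitionSum, Finset.mul_sum]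
  refine Finset.sum_congr rfl fun l _ ↦ ?_
  rw [← Finset.sum_mul, ← map_sum, ← Finset.sum_div, ← Nat.cast_sum, sum_mul_count, ← C_eq_natCast,
    ← mul_assoc, ← C_mul, mul_one_div]

theorem eq_partitionSum {u c : ℕ → ℚ[X]} (h0 : c 0 = 1)
    (h : ∀ n : ℕ, (n : ℚ[X]) * c n = ∑ i ∈ Finset.Icc 1 n, u i * c (n - i)) (n : ℕ) :
    c n = partitionSum u n := by
  induction n using Nat.strong_induction_on with
  | _ n ih =>
    rcases Nat.eq_zero_or_pos n with rfl | hn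
    · rw [h0, partitionSum_zero]
    refine mul_left_cancel₀ (Nat.cast_ne_zero.2 hn.ne' : (n : ℚ[X]) ≠ 0) ?_
    rw [h, natCast_mul_partitionSum]
    refine Finset.sum_congr rfl fun i hi ↦ ?_
    rw [Finset.mem_Icc] at hi
    rw [ih _ (by omega)]

theorem invKLPoly_catalan_zero (a b : ℕ) : invKLPoly (catalan 0 a b) = 1 := by
  have h0 : 0 * (a + b) = 0 := zero_mul _
  have : IsEmpty (Fin (0 * (a + b))) := by rw [h0]; infer_instance
  have hE : ((∅ : Finset (Fin (0 * (a + b)))) : Set (Fin (0 * (a + b)))) = (catalan 0 a b).E :=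
    Subsingleton.elim _ _
  rw [invKLPoly_eq_iq hE, iq_self]

/-- The inverse Kazhdan–Lusztig polynomials of the `(a, b)`-Catalan matroids in terms of those of
uniform matroids. -/
theorem invKLPolyQ_catalan (n a : ℕ) {b : ℕ} (hb : 1 ≤ b) :
    invKLPolyQ (catalan n a b) =
      partitionSum (fun m ↦ invKLPolyQ (uniform (m * b) (m * (a + b)))) n := by
  refine eq_partitionSum (c := fun n ↦ invKLPolyQ (catalan n a b)) ?_ (fun n ↦ ?_) n
  · simp only [invKLPolyQ, invKLPoly_catalan_zero, Polynomial.map_one]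
  · have h := congrArg (Polynomial.map (Int.castRingHom ℚ)) (smul_invKLPoly_catalan n (a := a) hb)
    rw [Polynomial.map_mul, Polynomial.map_natCast, Polynomial.map_sum] at h
    simpa only [invKLPolyQ, Polynomial.map_mul] using h

end CatalanMatroid

end

/-! ### The main theorem -/

theorem corollary4p5 (n a b : ℕ) (ha : 1 ≤ a) (hb : 1 ≤ b) :
    CatalanMatroid.invKLPolyQ (CatalanMatroid.catalan n a b) =
      ∑ l : n.Partition,
        Polynomial.C (1 / (CatalanMatroid.zPart l : ℚ)) * CatalanMatroid.invKLPolyU a b l ∧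
    CatalanMatroid.invKLPolyQ (CatalanMatroid.catalan n a b) =
      ∑ l : n.Partition,
        Polynomial.C (1 / (CatalanMatroid.zPart l : ℚ)) *
          (l.parts.map (fun m ↦ CatalanMatroid.closedFormula (m * b) (m * (a + b)))).prod := by
  have h := CatalanMatroid.invKLPolyQ_catalan n a hb
  refine ⟨h, h.trans (Finset.sum_congr rfl fun l _ ↦ ?_)⟩
  congr 2
  refine Multiset.map_congr rfl fun m hm ↦ CatalanMatroid.invKLPolyQ_uniform ?_ ?_
  · exact Nat.mul_pos (l.parts_pos hm) hb
  · exact Nat.mul_lt_mul_of_pos_left (by omega) (l.parts_pos hm)
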